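/- Let $n=2$ or $n=3$. Write $\langle a\rangle=(1+|a|^2)^{1/2}$, let $\|\cdot\|$ be the norm of the complex space $L^2(\mathbb R^{2n})$, with points $(x,y)\in\mathbb R^n\times\mathbb R^n$, and let $\langle D_x\rangle^r$ be the Fourier multiplier in $x$ with symbol $\langle\xi\rangle^r$, that is $\langle D_x\rangle^r=(1-\Delta_x)^{r/2}$; similarly $\langle D_y\rangle^r=(1-\Delta_y)^{r/2}$. Let $V\in C^2(\mathbb R^n)$ be real-valued and let $H\in C^1(\mathbb R^n)$ be real scalar-valued if $n=2$ and $\mathbb R^3$-valued if $n=3$. Put $$Q=y\cdot\partial_x-\partial_xV(x)\cdot\partial_y-H(x)\cdot(y\wedge\partial_y),\qquad P=Q-\Delta_y+\frac{|y|^2}{4}-\frac n2,$$ where $y\wedge\partial_y=y_1\partial_{y_2}-y_2\partial_{y_1}$ if $n=2$ and $y\wedge\partial_y=(y_2\partial_{y_3}-y_3\partial_{y_2},\,y_3\partial_{y_1}-y_1\partial_{y_3},\,y_1\partial_{y_2}-y_2\partial_{y_1})$ if $n=3$. Let $C_0$, $s\le 2/3$ and $\delta<2/3$ be real numbers such that for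 all $x\in\mathbb R^n$ $$|\partial_x^\alpha V(x)|\le C_0\langle\partial_xV(x)\rangle^{s}\ \text{ for all } |\alpha|=2,\qquad |H(x)|\le C_0\langle\partial_xV(x)\rangle^{\delta},\qquad |\partial_xH(x)|\le C_0\langle\partial_xV(x)\rangle^{s/2}.$$ Then there is a constant $C$, depending only on $C_0$ and $s$, such that for every $u\in C_0^\infty(\mathbb R^{2n})$ (complex-valued) $$\|\langle\partial_xV\rangle^{2/3}u\|+\|\langle D_x\rangle^{2/3}u\|+\|Qu\|+\|\langle D_y\rangle^{2}u\|+\|\langle y\rangle^{2}u\|\le C\big(\|Pu\|+\|u\|\big).$$ -/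

import Mathlib

open MeasureTheory
open scoped NNReal ENNReal FourierTransform ContDiff

namespace FokkerPlanck

noncomputable section

/-- The Euclidean space `ℝⁿ`. -/
abbrev Space (n : ℕ) : Type := EuclideanSpace ℝ (Fin n)

/-- The phase space `ℝ²ⁿ`, with points `p = (x, y)`: position `x = p.1`, velocity `y = p.2`. -/
abbrev Phase (n : ℕ) : Type := Space n × Space n

/-- The bracket `⟨a⟩ = (1 + |a|²)^{1/2}`. -/
def bracket {E : Type*} [Norm E] (a : E) : ℝ := Real.sqrt (1 + ‖a‖ ^ 2)

variable {n : ℕ}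

/-- The partial derivative `∂f/∂xⱼ` of a real function on `ℝⁿ`. -/
def pd (j : Fin n) (f : Space n → ℝ) (x : Space n) : ℝ :=
  fderiv ℝ f x (EuclideanSpace.single j 1)

/-- The partial derivative `∂u/∂xⱼ` on phase space. -/
def dx (j : Fin n) (u : Phase n → ℂ) (p : Phase n) : ℂ :=
  fderiv ℝ u p (EuclideanSpace.single j 1, 0)

/-- The partial derivative `∂u/∂yⱼ` on phase space. -/
def dy (j : Fin n) (u : Phase n → ℂ) (p : Phase n) : ℂ :=
  fderiv ℝ u p (0, EuclideanSpace.single j 1)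

/-- The velocity Laplacian `Δ_y u`. -/
def laplaceY (u : Phase n → ℂ) (p : Phase n) : ℂ := ∑ j, dy j (dy j u) p

/-- `H(x) · (y ∧ ∂_y) u` for `n = 2`, with `H` scalar and `y ∧ ∂_y = y₁ ∂_{y₂} - y₂ ∂_{y₁}`. -/
def magnetic2 (H : Space 2 → ℝ) (u : Phase 2 → ℂ) (p : Phase 2) : ℂ :=
  (H p.1 : ℂ) * ((p.2 0 : ℂ) * dy 1 u p - (p.2 1 : ℂ) * dy 0 u p)

/-- `H(x) · (y ∧ ∂_y) u` for `n = 3`, with `H = (H₁, H₂, H₃)` and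
`y ∧ ∂_y = (y₂ ∂_{y₃} - y₃ ∂_{y₂}, y₃ ∂_{y₁} - y₁ ∂_{y₃}, y₁ ∂_{y₂} - y₂ ∂_{y₁})`. -/
def magnetic3 (H : Space 3 → Space 3) (u : Phase 3 → ℂ) (p : Phase 3) : ℂ :=
  (H p.1 0 : ℂ) * ((p.2 1 : ℂ) * dy 2 u p - (p.2 2 : ℂ) * dy 1 u p)
    + (H p.1 1 : ℂ) * ((p.2 2 : ℂ) * dy 0 u p - (p.2 0 : ℂ) * dy 2 u p)
    + (H p.1 2 : ℂ) * ((p.2 0 : ℂ) * dy 1 u p - (p.2 1 : ℂ) * dy 0 u p)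

/-- The transport part `Q = y · ∂_x - ∂_x V(x) · ∂_y - H(x) · (y ∧ ∂_y)`; the argument `B` is the
operator `H(x) · (y ∧ ∂_y)`, which is `magnetic2 H` for `n = 2` and `magnetic3 H` for `n = 3`. -/
def opQ (V : Space n → ℝ) (B : (Phase n → ℂ) → Phase n → ℂ) (u : Phase n → ℂ) (p : Phase n) : ℂ :=
  ∑ j, (p.2 j : ℂ) * dx j u p - ∑ j, (gradient V p.1 j : ℂ) * dy j u p - B u p

/-- The Fokker-Planck operator `P = Q - Δ_y + |y|²/4 - n/2`. -/
def opP (V : Space n → ℝ) (B : (Phase n → ℂ) → Phase n → ℂ) (u : Phase n → ℂ) (p : Phase n) : ℂ :=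
  opQ V B u p - laplaceY u p + (((‖p.2‖ ^ 2 / 4 - (n : ℝ) / 2 : ℝ)) : ℂ) * u p

/-- The Fourier multiplier `⟨D⟩^r` on `ℝⁿ`. The Fourier transform here is
`𝓕 f ξ = ∫ exp(-2πi x·ξ) f(x) dx`, so that `-Δ` has the symbol `|2πξ|²`, and the symbol of
`⟨D⟩^r = (1 - Δ)^{r/2}` is `⟨2πξ⟩^r`. -/
def bracketD (r : ℝ) (f : Space n → ℂ) : Space n → ℂ :=
  𝓕⁻ (fun ξ : Space n => ((bracket ((2 * Real.pi) • ξ) ^ r : ℝ) : ℂ) * 𝓕 f ξ)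

/-- `⟨D_x⟩^r`, acting in the `x` variable for each fixed `y`. -/
def bracketDx (r : ℝ) (u : Phase n → ℂ) (p : Phase n) : ℂ :=
  bracketD r (fun x => u (x, p.2)) p.1

/-- `⟨D_y⟩^r`, acting in the `y` variable for each fixed `x`. -/
def bracketDy (r : ℝ) (u : Phase n → ℂ) (p : Phase n) : ℂ :=
  bracketD r (fun y => u (p.1, y)) p.2

/-- The norm of `L²(ℝ²ⁿ)`, with values in `[0, ∞]`. -/
def normL2 (f : Phase n → ℂ) : ℝ≥0∞ := eLpNorm f 2 volume

/-- The assumptions on the potential `V` and the magnetic field `H`, whose values are in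
`F = ℝ` for `n = 2` and in `F = ℝ³` for `n = 3`. -/
structure Admissible {F : Type*} [NormedAddCommGroup F] [NormedSpace ℝ F]
    (C₀ s δ : ℝ) (V : Space n → ℝ) (H : Space n → F) : Prop where
  contDiff_V : ContDiff ℝ 2 V
  contDiff_H : ContDiff ℝ 1 H
  bound_V : ∀ (i j : Fin n) (x : Space n), |pd i (pd j V) x| ≤ C₀ * bracket (gradient V x) ^ s
  bound_H : ∀ x : Space n, ‖H x‖ ≤ C₀ * bracket (gradient V x) ^ δ
  bound_dH : ∀ x : Space n, ‖fderiv ℝ H x‖ ≤ C₀ * bracket (gradient V x) ^ (s / 2)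

/-- The maximal estimate with constant `C` for the function `u`. It is an inequality in `[0, ∞]`
whose right-hand side is finite for every test function `u`. -/
def MaximalEstimate (C : ℝ≥0) (V : Space n → ℝ) (B : (Phase n → ℂ) → Phase n → ℂ)
    (u : Phase n → ℂ) : Prop :=
  normL2 (fun p => ((bracket (gradient V p.1) ^ (2 / 3 : ℝ) : ℝ) : ℂ) * u p)
      + normL2 (bracketDx (2 / 3) u)
      + normL2 (opQ V B u)
      + normL2 (bracketDy 2 u)
      + normL2 (fun p => ((bracket p.2 ^ 2 : ℝ) : ℂ) * u p)
    ≤ C * (normL2 (opP V B u) + normL2 u)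

end

end FokkerPlanck

namespace FokkerPlanck

noncomputable section

variable {n : ℕ}

/-! ### Square-integrable functions on phase space -/

/-! Put E = ∂ₓV, μ = ⟨E⟩^{1/3} and N = ‖Pu‖ + ‖u‖. The hypotheses fit the scale of μ: |E| ≤ μ³, ∂E
and H are O(μ²), ∂H is O(μ), and hence ∂μ is O(1). The argument needs only C¹ coefficients, real
inner products and translations in x; no pseudodifferential calculus enters.

Weights. The transport field is divergence free, so Q is antisymmetric, and pairing Pu with φu
leaves the ∂_y-energy, the |y|²-energy and the derivative of φ along the field
(`integral_weight_P`). The weights μ², |y|² and E·y/μ² are used together; along the field the last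
one decreases at the rate |E|²/μ² ≈ μ⁴ up to errors, which produces ‖μ²u‖². The three quadratic
inequalities close by absorption (`quadratic_system_weights`) and bound μ²u, μ∂_y u, |y|∂_y u and
|y|²u by multiples of N.

Regularity in x. Let U, a, D be the sizes of |Dₓ|^{2/3}u, |Dₓ|^{1/3}∂_y u and Δ_y u. Fractional
derivatives are measured by differences with steps 2^{-k}: a translation commutes with P up to an
error proportional to the step, in weighted norms that are already bounded (`abs_ip_comm_le`), and
on the Fourier side the sum over scales rebuilds the power of |ξⱼ| (`sum_major_le`,
`sum_ip_diff_diff_le`, `nrm_frac_sq_le`). The energy of the differences gives a² ≲ NU + N²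
(`nrm_frac_one_dy_le`). The commutator [∂_{yⱼ}, Q] = ∂_{xⱼ} - ∑ bⱼₖ ∂_{yₖ} trades a derivative in x
for Q and ∂_y, which gives U² ≲ (‖Qu‖ + N)a + N² (`nrm_frac_two_le`). Pairing the equation with Δ_y
u, where ⟨Qu, Δ_y u⟩ = -∑⟨∂_{xⱼ}u, ∂_{yⱼ}u⟩, gives D² ≲ ND + Ua + N² (`nrm_laplaceY_sq_le`). Since
‖Qu‖ ≲ D + N, the system closes (`quadratic_system_maximal`) with U and D bounded by multiples of N.
-/

instance : (volume : Measure (Phase n)).IsAddHaarMeasure :=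
  inferInstanceAs ((volume : Measure (Space n)).prod volume).IsAddHaarMeasure

/-- The real-valued norm of `L²(ℝ²ⁿ)`. -/
def nrm (f : Phase n → ℂ) : ℝ := (eLpNorm f 2 volume).toReal

/-- The real inner product of `L²(ℝ²ⁿ)`. -/
def ip (f g : Phase n → ℂ) : ℝ := ∫ p, inner ℝ (f p) (g p)

/-- Square integrability on phase space. -/
abbrev SqInt (f : Phase n → ℂ) : Prop := MemLp f 2 volume

lemma nrm_nonneg (f : Phase n → ℂ) : 0 ≤ nrm f := ENNReal.toReal_nonneg

lemma SqInt.normL2_eq {f : Phase n → ℂ} (hf : SqInt f) : normL2 f = ENNReal.ofReal (nrm f) := by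
  rw [nrm, ENNReal.ofReal_toReal hf.2.ne, normL2]

lemma SqInt.integrable_sq {f : Phase n → ℂ} (hf : SqInt f) : Integrable fun p => ‖f p‖ ^ 2 :=
  hf.integrable_norm_pow (p := 2) (by norm_num)

lemma SqInt.integrable_mul_norm {f g : Phase n → ℂ} (hf : SqInt f) (hg : SqInt g) :
    Integrable fun p => ‖f p‖ * ‖g p‖ :=
  hf.norm.integrable_mul hg.norm

lemma SqInt.nrm_sq {f : Phase n → ℂ} (hf : SqInt f) : nrm f ^ 2 = ∫ p, ‖f p‖ ^ 2 := by
  have h := hf.eLpNorm_eq_integral_rpow_norm (by norm_num) (by norm_num)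
  have h0 : 0 ≤ ∫ p, ‖f p‖ ^ 2 := integral_nonneg fun p => by positivity
  have h1 : ∫ p, ‖f p‖ ^ (ENNReal.toReal 2) = ∫ p, ‖f p‖ ^ 2 := by
    congr 1; ext p; norm_num
  rw [h1] at h
  rw [nrm, h, ENNReal.toReal_ofReal (by positivity), ← Real.rpow_natCast, ← Real.rpow_mul h0]
  norm_num

lemma ip_self {f : Phase n → ℂ} (hf : SqInt f) : ip f f = nrm f ^ 2 := by
  rw [hf.nrm_sq, ip]; congr 1; ext p; rw [real_inner_self_eq_norm_sq]

lemma integral_norm_mul_le {f g : Phase n → ℂ} (hf : SqInt f) (hg : SqInt g) :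
    ∫ p, ‖f p‖ * ‖g p‖ ≤ nrm f * nrm g := by
  have h := integral_mul_le_Lp_mul_Lq_of_nonneg (μ := (volume : Measure (Phase n)))
    (p := 2) (q := 2) (f := fun p => ‖f p‖) (g := fun p => ‖g p‖) Real.HolderConjugate.two_two
    (ae_of_all _ fun p => norm_nonneg _) (ae_of_all _ fun p => norm_nonneg _)
    (by simpa using hf.norm) (by simpa using hg.norm)
  refine h.trans_eq ?_
  have e : ∀ {f : Phase n → ℂ}, SqInt f →
      (∫ p, ‖f p‖ ^ (2 : ℝ)) ^ (1 / (2 : ℝ)) = nrm f := by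
    intro f hf
    have : ∫ p, ‖f p‖ ^ (2 : ℝ) = nrm f ^ 2 := by
      rw [hf.nrm_sq]; congr 1; ext p; norm_num
    rw [this, ← Real.sqrt_eq_rpow, Real.sqrt_sq (nrm_nonneg f)]
  rw [e hf, e hg]

lemma abs_integral_le {f g : Phase n → ℂ} (hf : SqInt f) (hg : SqInt g) {G : Phase n → ℝ} {C : ℝ}
    (hC : 0 ≤ C) (h : ∀ p, |G p| ≤ C * (‖f p‖ * ‖g p‖)) :
    |∫ p, G p| ≤ C * (nrm f * nrm g) :=
  calc |∫ p, G p| = ‖∫ p, G p‖ := rfl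
    _ ≤ ∫ p, C * (‖f p‖ * ‖g p‖) :=
      norm_integral_le_of_norm_le ((hf.integrable_mul_norm hg).const_mul C)
        (ae_of_all _ fun p => h p)
    _ = C * ∫ p, ‖f p‖ * ‖g p‖ := integral_const_mul _ _
    _ ≤ _ := mul_le_mul_of_nonneg_left (integral_norm_mul_le hf hg) hC

lemma abs_ip_le {f g : Phase n → ℂ} (hf : SqInt f) (hg : SqInt g) :
    |ip f g| ≤ nrm f * nrm g := by
  refine (abs_integral_le hf hg zero_le_one fun p => ?_).trans_eq (one_mul _)
  rw [one_mul]
  exact abs_real_inner_le_norm (f p) (g p)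

lemma nrm_mono {f g : Phase n → ℂ} (hg : SqInt g) (h : ∀ p, ‖f p‖ ≤ ‖g p‖) : nrm f ≤ nrm g :=
  ENNReal.toReal_mono hg.2.ne (eLpNorm_mono h)

lemma nrm_congr_norm {f g : Phase n → ℂ} (h : ∀ p, ‖f p‖ = ‖g p‖) : nrm f = nrm g := by
  rw [nrm, nrm, eLpNorm_congr_norm_ae (ae_of_all _ h)]

lemma nrm_add_le {f g : Phase n → ℂ} (hf : SqInt f) (hg : SqInt g) :
    nrm (fun p => f p + g p) ≤ nrm f + nrm g := by
  rw [nrm, nrm, nrm, ← ENNReal.toReal_add hf.2.ne hg.2.ne]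
  exact ENNReal.toReal_mono (ENNReal.add_ne_top.mpr ⟨hf.2.ne, hg.2.ne⟩)
    (eLpNorm_add_le hf.1 hg.1 (by norm_num))

lemma nrm_neg (f : Phase n → ℂ) : nrm (fun p => -f p) = nrm f :=
  nrm_congr_norm fun _ => norm_neg _

lemma nrm_sub_le {f g : Phase n → ℂ} (hf : SqInt f) (hg : SqInt g) :
    nrm (fun p => f p - g p) ≤ nrm f + nrm g := by
  have := nrm_add_le hf hg.neg
  rw [show nrm (-g) = nrm g from nrm_neg g] at this
  simpa [sub_eq_add_neg] using this

lemma nrm_const_smul (a : ℝ) (f : Phase n → ℂ) : nrm (fun p => a • f p) = |a| * nrm f := by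
  rw [nrm, nrm, show (fun p => a • f p) = a • f from rfl, eLpNorm_const_smul, ENNReal.toReal_mul]
  simp

lemma nrm_sum_le {ι : Type*} (s : Finset ι) {f : ι → Phase n → ℂ} (hf : ∀ i, SqInt (f i)) :
    nrm (fun p => ∑ i ∈ s, f i p) ≤ ∑ i ∈ s, nrm (f i) := by
  classical
  induction s using Finset.induction_on with
  | empty => simp [nrm]
  | insert a s ha ih =>
    simp only [Finset.sum_insert ha]
    exact (nrm_add_le (hf a) (memLp_finsetSum s fun i _ => hf i)).trans (by gcongr)

/-! ### Continuous functions with compact support -/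

/-- Continuous functions with compact support. -/
def CC {F : Type*} [NormedAddCommGroup F] (f : Phase n → F) : Prop :=
  Continuous f ∧ HasCompactSupport f

/-- Test functions. -/
def Test (u : Phase n → ℂ) : Prop := ContDiff ℝ ∞ u ∧ HasCompactSupport u

section CC

set_option linter.unusedSectionVars false

variable {F : Type*} [NormedAddCommGroup F] [NormedSpace ℝ F] {f g : Phase n → F}

lemma CC.integrable (hf : CC f) : Integrable f :=
  hf.1.integrable_of_hasCompactSupport hf.2

lemma CC.sqInt {f : Phase n → ℂ} (hf : CC f) : SqInt f :=
  hf.1.memLp_of_hasCompactSupport hf.2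

lemma CC.add (hf : CC f) (hg : CC g) : CC fun p => f p + g p := ⟨hf.1.add hg.1, hf.2.add hg.2⟩

lemma CC.neg (hf : CC f) : CC fun p => -f p := ⟨hf.1.neg, hf.2.neg⟩

lemma CC.sub (hf : CC f) (hg : CC g) : CC fun p => f p - g p := by
  simpa [sub_eq_add_neg] using hf.add hg.neg

lemma CC.zero : CC (fun _ : Phase n => (0 : F)) := ⟨continuous_const, HasCompactSupport.zero⟩

lemma CC.sum {ι : Type*} (s : Finset ι) {f : ι → Phase n → F} (hf : ∀ i, CC (f i)) :
    CC fun p => ∑ i ∈ s, f i p := by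
  classical
  induction s using Finset.induction_on with
  | empty => simpa using CC.zero
  | insert a s ha ih => simpa only [Finset.sum_insert ha] using (hf a).add ih

lemma CC.smul (hf : CC f) {w : Phase n → ℝ} (hw : Continuous w) : CC fun p => w p • f p :=
  ⟨hw.smul hf.1, hf.2.smul_left⟩

lemma CC.mul {f : Phase n → ℝ} (hf : CC f) {w : Phase n → ℝ} (hw : Continuous w) :
    CC fun p => w p * f p := hf.smul hw

lemma CC.inner {f g : Phase n → ℂ} (hf : CC f) (hg : Continuous g) :
    CC fun p => (inner ℝ (f p) (g p) : ℝ) := by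
  refine ⟨hf.1.inner hg, hf.2.mono fun p hp => ?_⟩
  contrapose! hp
  simp_all

lemma CC.norm_sq {f : Phase n → ℂ} (hf : CC f) : CC fun p => ‖f p‖ ^ 2 := by
  simpa only [real_inner_self_eq_norm_sq] using hf.inner hf.1

lemma CC.fderiv (hf : HasCompactSupport f) (h : ContDiff ℝ 1 f) {v : Phase n → Phase n}
    (hv : Continuous v) : CC fun p => fderiv ℝ f p (v p) := by
  refine ⟨(h.continuous_fderiv (by norm_num)).clm_apply hv, (hf.fderiv (𝕜 := ℝ)).mono fun p hp => ?_⟩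
  contrapose! hp
  simp_all

lemma CC.shift (hf : CC f) (v : Phase n) : CC fun p => f (p + v) :=
  ⟨hf.1.comp (by fun_prop), hf.2.comp_homeomorph (Homeomorph.addRight v)⟩

end CC

lemma Test.cc {u : Phase n → ℂ} (hu : Test u) : CC u := ⟨hu.1.continuous, hu.2⟩

lemma Test.deriv {u : Phase n → ℂ} (hu : Test u) (v : Phase n) :
    Test fun p => fderiv ℝ u p v := by
  refine ⟨(hu.1.fderiv_right (m := ∞) (by simp)).clm_apply contDiff_const, ?_⟩
  exact (CC.fderiv hu.2 (hu.1.of_le (by simp)) continuous_const).2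

lemma Test.sub {u v : Phase n → ℂ} (hu : Test u) (hv : Test v) : Test fun p => u p - v p :=
  ⟨hu.1.sub hv.1, (hu.cc.sub hv.cc).2⟩

lemma Test.shift {u : Phase n → ℂ} (hu : Test u) (v : Phase n) : Test fun p => u (p + v) :=
  ⟨hu.1.comp (by fun_prop), (hu.cc.shift v).2⟩

lemma Test.dx {u : Phase n → ℂ} (hu : Test u) (j : Fin n) : Test (dx j u) := hu.deriv _

lemma Test.dy {u : Phase n → ℂ} (hu : Test u) (j : Fin n) : Test (dy j u) := hu.deriv _

lemma Test.contDiff {u : Phase n → ℂ} (hu : Test u) {k : ℕ} : ContDiff ℝ k u :=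
  hu.1.of_le (by exact_mod_cast le_top)

lemma Test.differentiable {u : Phase n → ℂ} (hu : Test u) : Differentiable ℝ u :=
  hu.1.differentiable (by simp)

lemma nrm_shift (f : Phase n → ℂ) (hf : CC f) (v : Phase n) :
    nrm (fun p => f (p + v)) = nrm f := by
  rw [nrm, nrm]
  congr 1
  exact eLpNorm_comp_measurePreserving hf.1.aestronglyMeasurable
    (measurePreserving_add_right volume v)

lemma integral_shift {F : Type*} [NormedAddCommGroup F] [NormedSpace ℝ F] (f : Phase n → F)
    (v : Phase n) : ∫ p, f (p + v) = ∫ p, f p :=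
  integral_add_right_eq_self f v

/-! ### Integration by parts -/

/-- The unit vector of `∂/∂xⱼ`. -/
def ex (j : Fin n) : Phase n := (EuclideanSpace.single j 1, 0)

/-- The unit vector of `∂/∂yⱼ`. -/
def ey (j : Fin n) : Phase n := (0, EuclideanSpace.single j 1)

lemma space_eq_sum (a : Space n) : a = ∑ j, a j • EuclideanSpace.single j (1 : ℝ) := by
  ext i
  simp [Finset.sum_apply, Pi.single_apply]

lemma phase_apply {F : Type*} [NormedAddCommGroup F] [NormedSpace ℝ F] (L : Phase n →L[ℝ] F)
    (a b : Space n) : L (a, b) = ∑ j, a j • L (ex j) + ∑ j, b j • L (ey j) := by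
  have h : (a, b) = ∑ j, a j • ex j + ∑ j, b j • (ey j : Phase n) := by
    ext i
    · simp [ex, ey, Prod.fst_sum, Pi.single_apply]
    · simp [ex, ey, Prod.snd_sum, Pi.single_apply]
  rw [h]; simp

/-- A coefficient that is constant along v contributes nothing when the derivative is moved onto it.
Every component of the transport field has this property in its own direction. -/
lemma integral_mul_fderiv_eq_zero {a F : Phase n → ℝ} (ha : ContDiff ℝ 1 a) {v : Phase n}
    (hav : ∀ p, fderiv ℝ a p v = 0) (hF : ContDiff ℝ 1 F) (hFc : HasCompactSupport F) :
    ∫ p, a p * fderiv ℝ F p v = 0 := by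
  have h := integral_mul_fderiv_eq_neg_fderiv_mul_of_integrable (μ := (volume : Measure (Phase n)))
    (f := a) (g := F) (v := v) (by simp [hav])
    (((CC.fderiv hFc hF continuous_const).mul ha.continuous).integrable)
    ((CC.mul ⟨hF.continuous, hFc⟩ ha.continuous).integrable)
    (fun p _ => ha.differentiable (by norm_num) p) (fun p _ => hF.differentiable (by norm_num) p)
  simpa [hav] using h

lemma integral_fderiv_eq_zero {F : Phase n → ℝ} (hF : ContDiff ℝ 1 F) (hFc : HasCompactSupport F)
    (v : Phase n) : ∫ p, fderiv ℝ F p v = 0 := by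
  simpa using integral_mul_fderiv_eq_zero (a := fun _ => 1) contDiff_const (v := v) (by simp) hF hFc

lemma fderiv_inner {f g : Phase n → ℂ} {p : Phase n} (hf : DifferentiableAt ℝ f p)
    (hg : DifferentiableAt ℝ g p) (v : Phase n) :
    fderiv ℝ (fun p => (inner ℝ (f p) (g p) : ℝ)) p v
      = inner ℝ (f p) (fderiv ℝ g p v) + inner ℝ (fderiv ℝ f p v) (g p) := by
  rw [fderiv_inner_apply ℝ hf hg]

lemma ip_fderiv_right {f g : Phase n → ℂ} (hf : ContDiff ℝ 1 f) (hfc : HasCompactSupport f)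
    (hg : ContDiff ℝ 1 g) (v : Phase n) :
    ip f (fun p => fderiv ℝ g p v) = -ip (fun p => fderiv ℝ f p v) g := by
  have hcc : CC f := ⟨hf.continuous, hfc⟩
  have h := integral_fderiv_eq_zero (hf.inner ℝ hg) (hcc.inner hg.continuous).2 v
  simp_rw [fderiv_inner (hf.differentiable (by norm_num) _) (hg.differentiable (by norm_num) _)] at h
  have h1 : Integrable fun p => (inner ℝ (f p) (fderiv ℝ g p v) : ℝ) :=
    (hcc.inner ((hg.continuous_fderiv (by norm_num)).clm_apply continuous_const)).integrable
  have h2 : Integrable fun p => (inner ℝ (fderiv ℝ f p v) (g p) : ℝ) :=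
    ((CC.fderiv hfc hf continuous_const).inner hg.continuous).integrable
  rw [integral_add h1 h2] at h
  rw [ip, ip]; linarith

end

noncomputable section

variable {n : ℕ}

/-! ### The operators -/

/-- The coefficients of a transport operator `y·∂ₓ - E(x)·∂_y - ∑ bᵢⱼ(x) yᵢ ∂_{yⱼ}` with
antisymmetric `b`, together with the weight `μ = ⟨E⟩^{1/3}` that controls them. -/
structure Coeffs (n : ℕ) (K : ℝ) where
  E : Fin n → Space n → ℝ
  b : Fin n → Fin n → Space n → ℝ
  μ : Space n → ℝ
  one_le_K : 1 ≤ K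
  contDiff_E : ∀ j, ContDiff ℝ 1 (E j)
  contDiff_b : ∀ i j, ContDiff ℝ 1 (b i j)
  contDiff_μ : ContDiff ℝ 1 μ
  antisymm : ∀ i j x, b j i x = -b i j x
  one_le : ∀ x, 1 ≤ μ x
  pow_six : ∀ x, μ x ^ 6 = 1 + ∑ j, E j x ^ 2
  bound_dE : ∀ j x, ‖fderiv ℝ (E j) x‖ ≤ K * μ x ^ 2
  bound_b : ∀ i j x, |b i j x| ≤ K * μ x ^ 2
  bound_db : ∀ i j x, ‖fderiv ℝ (b i j) x‖ ≤ K * μ x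
  bound_dμ : ∀ x, ‖fderiv ℝ μ x‖ ≤ K

namespace Coeffs

variable {K : ℝ} (c : Coeffs n K)

/-- The transport operator. -/
def Q (u : Phase n → ℂ) (p : Phase n) : ℂ :=
  ∑ j, p.2 j • dx j u p - ∑ j, c.E j p.1 • dy j u p
    - ∑ i, ∑ j, (c.b i j p.1 * p.2 i) • dy j u p

/-- The Fokker-Planck operator. -/
def P (u : Phase n → ℂ) (p : Phase n) : ℂ :=
  c.Q u p - laplaceY u p + (‖p.2‖ ^ 2 / 4 - (n : ℝ) / 2) • u p

/-- The velocity component of the transport field. -/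
def acc (p : Phase n) : Space n :=
  WithLp.toLp 2 fun j => -c.E j p.1 - ∑ i, c.b i j p.1 * p.2 i

/-- The vector field of the transport operator. -/
def field (p : Phase n) : Phase n := (p.2, c.acc p)

lemma acc_apply (p : Phase n) (j : Fin n) :
    c.acc p j = -c.E j p.1 - ∑ i, c.b i j p.1 * p.2 i := rfl

lemma Q_eq (u : Phase n → ℂ) (p : Phase n) : c.Q u p = fderiv ℝ u p (c.field p) := by
  rw [field, phase_apply, Q, sub_sub, sub_eq_add_neg, Finset.sum_comm (γ := Fin n)]
  congr 1
  rw [← Finset.sum_add_distrib, ← Finset.sum_neg_distrib]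
  refine Finset.sum_congr rfl fun j _ => ?_
  rw [acc_apply, sub_smul, neg_smul, Finset.sum_smul, neg_add, sub_eq_add_neg]
  rfl

lemma contDiff_acc_apply (j : Fin n) : ContDiff ℝ 1 fun p => c.acc p j := by
  have h1 := c.contDiff_E
  have h2 := c.contDiff_b
  simp only [acc_apply]
  refine ((h1 j).comp contDiff_fst).neg.sub (ContDiff.sum fun i _ => ?_)
  exact ((h2 i j).comp contDiff_fst).mul (by fun_prop)

lemma contDiff_field : ContDiff ℝ 1 c.field := by
  refine contDiff_snd.prodMk ?_
  rw [contDiff_euclidean]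
  exact c.contDiff_acc_apply

lemma b_self (j : Fin n) (x : Space n) : c.b j j x = 0 := by
  have := c.antisymm j j x
  linarith

/-- At fixed x the field is affine in y, so its derivatives in y can be read off exactly from this
expansion. -/
lemma field_add (p : Phase n) (w : Space n) (t : ℝ) :
    c.field (p + t • ((0, w) : Phase n))
      = c.field p + t • ((w, WithLp.toLp 2 fun k => -∑ i, c.b i k p.1 * w i) : Phase n) := by
  refine Prod.ext ?_ ?_
  · simp [field]
  · ext k
    simp only [field, Prod.snd_add, Prod.smul_snd, PiLp.add_apply, PiLp.smul_apply, acc_apply,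
      Prod.fst_add, Prod.smul_fst, smul_zero, add_zero, smul_eq_mul, mul_add,
      Finset.sum_add_distrib, mul_neg, Finset.mul_sum]
    have : ∀ i, c.b i k p.1 * (t * w i) = t * (c.b i k p.1 * w i) := fun i => by ring
    simp only [this]
    ring

lemma fderiv_field (p : Phase n) (w : Space n) :
    fderiv ℝ c.field p (0, w) = (w, WithLp.toLp 2 fun k => -∑ i, c.b i k p.1 * w i) := by
  have h := ((c.contDiff_field.differentiable (by norm_num) p).hasFDerivAt.hasLineDerivAt
    ((0, w) : Phase n))
  unfold HasLineDerivAt at h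
  simp_rw [field_add] at h
  refine h.unique ?_
  have := ((hasDerivAt_id (0 : ℝ)).smul_const
    ((w, WithLp.toLp 2 fun k => -∑ i, c.b i k p.1 * w i) : Phase n)).const_add (c.field p)
  simpa using this

lemma fderiv_acc_apply (p : Phase n) (w : Space n) (j : Fin n) :
    fderiv ℝ (fun p => c.acc p j) p (0, w) = -∑ i, c.b i j p.1 * w i := by
  have h1 : HasFDerivAt c.field (fderiv ℝ c.field p) p :=
    (c.contDiff_field.differentiable (by norm_num) p).hasFDerivAt
  let L : Phase n →L[ℝ] ℝ := (EuclideanSpace.proj j).comp (ContinuousLinearMap.snd ℝ _ _)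
  have h2 := (L.hasFDerivAt.comp p h1).fderiv
  have h3 : (L ∘ c.field) = fun p => c.acc p j := rfl
  rw [h3] at h2
  rw [h2]
  simp [L, fderiv_field]

/-- The transport field is divergence free. -/
lemma integral_fderiv_field {F : Phase n → ℝ} (hF : ContDiff ℝ 1 F) (hFc : HasCompactSupport F) :
    ∫ p, fderiv ℝ F p (c.field p) = 0 := by
  simp_rw [field, phase_apply, smul_eq_mul]
  have hx : ∀ j, ContDiff ℝ 1 fun p : Phase n => p.2 j := fun j => by fun_prop
  have hi : ∀ {a : Phase n → ℝ} (v : Phase n), ContDiff ℝ 1 a →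
      Integrable fun p => a p * fderiv ℝ F p v := fun v ha =>
    ((CC.fderiv hFc hF continuous_const).mul ha.continuous).integrable
  rw [integral_add (integrable_finsetSum _ fun j _ => hi _ (hx j))
    (integrable_finsetSum _ fun j _ => hi _ (c.contDiff_acc_apply j)),
    integral_finsetSum _ fun j _ => hi _ (hx j),
    integral_finsetSum _ fun j _ => hi _ (c.contDiff_acc_apply j)]
  rw [Finset.sum_eq_zero, Finset.sum_eq_zero, add_zero]
  · intro j _
    refine integral_mul_fderiv_eq_zero (c.contDiff_acc_apply j) (fun p => ?_) hF hFc
    -- The j-th acceleration depends on yⱼ only through bⱼⱼ, which vanishes by antisymmetry.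
    rw [ey, fderiv_acc_apply]
    simp [b_self]
  · intro j _
    refine integral_mul_fderiv_eq_zero (hx j) (fun p => ?_) hF hFc
    let L : Phase n →L[ℝ] ℝ := (EuclideanSpace.proj j).comp (ContinuousLinearMap.snd ℝ _ _)
    have : fderiv ℝ (fun p : Phase n => p.2 j) p = L := L.hasFDerivAt.fderiv
    simp [this, L, ex]

lemma contDiff_Q {u : Phase n → ℂ} (hu : Test u) : ContDiff ℝ 1 (c.Q u) := by
  rw [show c.Q u = fun p => fderiv ℝ u p (c.field p) from funext (c.Q_eq u)]
  exact ((hu.contDiff (k := 2)).fderiv_right (m := 1) (by norm_num)).clm_apply c.contDiff_field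

lemma cc_Q {u : Phase n → ℂ} (hu : Test u) : CC (c.Q u) := by
  rw [show c.Q u = fun p => fderiv ℝ u p (c.field p) from funext (c.Q_eq u)]
  exact CC.fderiv hu.2 hu.contDiff c.contDiff_field.continuous

lemma cc_laplaceY {u : Phase n → ℂ} (hu : Test u) : CC (laplaceY u) :=
  CC.sum _ fun j => ((hu.dy j).dy j).cc

lemma cc_P {u : Phase n → ℂ} (hu : Test u) : CC (c.P u) :=
  ((c.cc_Q hu).sub (cc_laplaceY hu)).add (hu.cc.smul (by fun_prop))

/-- The integral of the derivative of ⟨f, g⟩ along a divergence-free field is zero. -/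
lemma ip_Q {f g : Phase n → ℂ} (hf : Test f) (hg : Test g) :
    ip (c.Q f) g = -ip f (c.Q g) := by
  have h := c.integral_fderiv_field (hf.contDiff.inner ℝ (hg.contDiff (k := 1)))
    (hf.cc.inner hg.cc.1).2
  simp_rw [fderiv_inner (hf.differentiable _) (hg.differentiable _), ← Q_eq] at h
  rw [integral_add (hf.cc.inner (c.cc_Q hg).1).integrable
    ((c.cc_Q hf).inner hg.cc.1).integrable] at h
  rw [ip, ip]; linarith

lemma ip_comm (f g : Phase n → ℂ) : ip f g = ip g f := by
  simp_rw [ip, real_inner_comm]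

/-- The source of all regularity in x: by symmetry of the second derivative, only the y-derivative
of the field survives in the commutator, and that is the direction ∂_{xⱼ} plus a magnetic term. -/
lemma fderiv_Q {v : Phase n → ℂ} (hv : Test v) (p : Phase n) (j : Fin n) :
    fderiv ℝ (c.Q v) p (ey j)
      = c.Q (dy j v) p + (dx j v p - ∑ k, c.b j k p.1 • dy k v p) := by
  have h1 : DifferentiableAt ℝ (fderiv ℝ v) p :=
    ((hv.contDiff (k := 2)).fderiv_right (m := 1) (by norm_num)).differentiable (by norm_num) p
  have h2 : DifferentiableAt ℝ c.field p := c.contDiff_field.differentiable (by norm_num) p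
  rw [show c.Q v = fun p => fderiv ℝ v p (c.field p) from funext (c.Q_eq v), Q_eq,
    fderiv_clm_apply h1 h2]
  have hs : IsSymmSndFDerivAt ℝ v p :=
    (hv.contDiff (k := 2)).contDiffAt.isSymmSndFDerivAt (by simp)
  have h3 : fderiv ℝ (dy j v) p (c.field p) = fderiv ℝ (fderiv ℝ v) p (c.field p) (ey j) := by
    rw [show dy j v = fun p => fderiv ℝ v p (ey j) from rfl,
      fderiv_clm_apply h1 (differentiableAt_const _)]
    simp
  rw [h3, hs.eq]
  simp only [add_apply, ContinuousLinearMap.comp_apply,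
    ContinuousLinearMap.flip_apply]
  rw [add_comm]
  congr 1
  rw [ey, fderiv_field, phase_apply, sub_eq_add_neg, ← Finset.sum_neg_distrib]
  congr 1
  · simp
    rfl
  · refine Finset.sum_congr rfl fun k _ => ?_
    simp
    exact Or.inl rfl

/-- The polarised commutator identity for `∂_{yⱼ}` and the transport operator. -/
lemma ip_Q_dy_sub {u v : Phase n → ℂ} (hu : Test u) (hv : Test v) (j : Fin n) :
    ip (c.Q u) (dy j v) - ip (c.Q v) (dy j u)
      = ip u (dx j v) - ∑ k, ip (fun p => c.b j k p.1 • u p) (dy k v) := by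
  have hb : ∀ k, Continuous fun p : Phase n => c.b j k p.1 := fun k =>
    (c.contDiff_b j k).continuous.comp continuous_fst
  -- `h1` moves Q and `h2` moves ∂_{yⱼ}; in the sum the terms with Q∂_{yⱼ}v cancel and only the
  -- commutator remains.
  have h1 := c.ip_Q hu (hv.dy j)
  have h2 := ip_fderiv_right (hu.contDiff (k := 1)) hu.2 (c.contDiff_Q hv) (ey j)
  have h3 : ip u (fun p => fderiv ℝ (c.Q v) p (ey j))
      = ip u (c.Q (dy j v)) + (ip u (dx j v)
        - ∑ k, ip (fun p => c.b j k p.1 • u p) (dy k v)) := by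
    simp only [ip]
    rw [← integral_finsetSum, ← integral_sub, ← integral_add]
    · congr 1; ext p
      rw [fderiv_Q c hv]
      simp only [inner_add_right, inner_sub_right, inner_sum, inner_smul_left, inner_smul_right]
      rfl
    · exact (hu.cc.inner (c.cc_Q (hv.dy j)).1).integrable
    · refine ((hu.cc.inner (hv.dx j).cc.1).sub (CC.sum _ fun k => ?_)).integrable
      exact (hu.cc.smul (hb k)).inner (hv.dy k).cc.1
    · exact (hu.cc.inner (hv.dx j).cc.1).integrable
    · exact (CC.sum _ fun k => (hu.cc.smul (hb k)).inner (hv.dy k).cc.1).integrable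
    · exact fun k _ => ((hu.cc.smul (hb k)).inner (hv.dy k).cc.1).integrable
  rw [h3] at h2
  have h4 : ip (fun p => fderiv ℝ u p (ey j)) (c.Q v) = ip (c.Q v) (dy j u) := ip_comm _ _
  rw [h4] at h2
  linarith

/-- The weighted energy identity. -/
lemma integral_weight_P {u : Phase n → ℂ} (hu : Test u) {φ : Phase n → ℝ} (hφ : ContDiff ℝ 1 φ) :
    ∫ p, φ p * inner ℝ (c.P u p) (u p)
      = -(1 / 2) * (∫ p, fderiv ℝ φ p (c.field p) * ‖u p‖ ^ 2)
        + (∑ j, ∫ p, φ p * ‖dy j u p‖ ^ 2)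
        + (∑ j, ∫ p, fderiv ℝ φ p (ey j) * inner ℝ (dy j u p) (u p))
        + ∫ p, φ p * (‖p.2‖ ^ 2 / 4 - (n : ℝ) / 2) * ‖u p‖ ^ 2 := by
  have hφd : Differentiable ℝ φ := hφ.differentiable (by norm_num)
  have hφ' : ∀ {v : Phase n → Phase n}, Continuous v → Continuous fun p => fderiv ℝ φ p (v p) :=
    fun hv => (hφ.continuous_fderiv (by norm_num)).clm_apply hv
  have key : ∀ {f : Phase n → ℂ}, Test f → ∀ (v : Phase n → Phase n) (p : Phase n),
      fderiv ℝ (fun p => φ p * inner ℝ (f p) (u p)) p (v p)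
        = fderiv ℝ φ p (v p) * inner ℝ (f p) (u p)
          + (φ p * inner ℝ (f p) (fderiv ℝ u p (v p))
            + φ p * inner ℝ (fderiv ℝ f p (v p)) (u p)) := by
    intro f hf v p
    rw [fderiv_fun_mul (hφd p) ((hf.differentiable p).inner ℝ (hu.differentiable p))]
    simp only [add_apply, smul_apply, smul_eq_mul]
    rw [fderiv_inner (hf.differentiable p) (hu.differentiable p)]
    ring
  -- The integral of the field derivative of φ|u|² vanishes, so the transport term leaves only the
  -- derivative of φ.
  have e1 : ∫ p, φ p * inner ℝ (c.Q u p) (u p)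
      = -(1 / 2) * ∫ p, fderiv ℝ φ p (c.field p) * ‖u p‖ ^ 2 := by
    have h := c.integral_fderiv_field (hφ.mul (hu.contDiff.inner ℝ (hu.contDiff (k := 1))))
      ((hu.cc.inner hu.cc.1).mul hφ.continuous).2
    have h' : ∀ p, fderiv ℝ (fun p => φ p * inner ℝ (u p) (u p)) p (c.field p)
        = fderiv ℝ φ p (c.field p) * ‖u p‖ ^ 2 + 2 * (φ p * inner ℝ (c.Q u p) (u p)) := by
      intro p
      rw [key hu c.field p, ← Q_eq, real_inner_comm (c.Q u p) (u p), real_inner_self_eq_norm_sq]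
      ring
    rw [funext h', integral_add, integral_const_mul] at h
    · linarith
    · exact (hu.cc.norm_sq.mul (hφ' c.contDiff_field.continuous)).integrable
    · exact ((((c.cc_Q hu).inner hu.cc.1).mul hφ.continuous).integrable).const_mul 2
  have e2 : ∀ j, ∫ p, φ p * inner ℝ (dy j (dy j u) p) (u p)
      = -(∫ p, φ p * ‖dy j u p‖ ^ 2)
        - ∫ p, fderiv ℝ φ p (ey j) * inner ℝ (dy j u p) (u p) := by
    intro j
    have h := integral_fderiv_eq_zero
      (hφ.mul ((hu.dy j).contDiff.inner ℝ (hu.contDiff (k := 1))))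
      (((hu.dy j).cc.inner hu.cc.1).mul hφ.continuous).2 (ey j)
    have h' : ∀ p, fderiv ℝ (fun p => φ p * inner ℝ (dy j u p) (u p)) p (ey j)
        = fderiv ℝ φ p (ey j) * inner ℝ (dy j u p) (u p) + (φ p * ‖dy j u p‖ ^ 2
          + φ p * inner ℝ (dy j (dy j u) p) (u p)) := by
      intro p
      rw [key (hu.dy j) (fun _ => ey j) p, show fderiv ℝ u p (ey j) = dy j u p from rfl,
        real_inner_self_eq_norm_sq]
      rfl
    rw [funext h', integral_add, integral_add] at h
    · linarith
    · exact ((hu.dy j).cc.norm_sq.mul hφ.continuous).integrable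
    · exact ((((hu.dy j).dy j).cc.inner hu.cc.1).mul hφ.continuous).integrable
    · exact (((hu.dy j).cc.inner hu.cc.1).mul (hφ' continuous_const)).integrable
    · exact (((hu.dy j).cc.norm_sq.mul hφ.continuous).add
        ((((hu.dy j).dy j).cc.inner hu.cc.1).mul hφ.continuous)).integrable
  have e3 : ∀ p, φ p * inner ℝ (c.P u p) (u p) = φ p * inner ℝ (c.Q u p) (u p)
      - ∑ j, φ p * inner ℝ (dy j (dy j u) p) (u p)
      + φ p * (‖p.2‖ ^ 2 / 4 - (n : ℝ) / 2) * ‖u p‖ ^ 2 := by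
    intro p
    rw [P, laplaceY, inner_add_left, inner_sub_left, sum_inner, inner_smul_left,
      real_inner_self_eq_norm_sq, mul_add, mul_sub, Finset.mul_sum]
    simp only [RCLike.conj_to_real]
    ring
  have i1 := (((c.cc_Q hu).inner hu.cc.1).mul hφ.continuous)
  have i2 : ∀ j, CC fun p => φ p * inner ℝ (dy j (dy j u) p) (u p) := fun j =>
    (((hu.dy j).dy j).cc.inner hu.cc.1).mul hφ.continuous
  rw [funext e3, integral_add, integral_sub, integral_finsetSum, e1]
  · simp only [e2, Finset.sum_sub_distrib, Finset.sum_neg_distrib]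
    ring
  · exact fun j _ => (i2 j).integrable
  · exact i1.integrable
  · exact (CC.sum _ i2).integrable
  · exact (i1.sub (CC.sum _ i2)).integrable
  · exact (hu.cc.norm_sq.mul (by have := hφ.continuous; fun_prop)).integrable

end Coeffs

end

noncomputable section

variable {n : ℕ}

/-! ### Weighted estimates -/

lemma abs_integral_le_three {f₁ g₁ f₂ g₂ f₃ g₃ : Phase n → ℂ} (hf₁ : SqInt f₁) (hg₁ : SqInt g₁)
    (hf₂ : SqInt f₂) (hg₂ : SqInt g₂) (hf₃ : SqInt f₃) (hg₃ : SqInt g₃)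
    {G : Phase n → ℝ} {C₁ C₂ C₃ : ℝ} (h₁ : 0 ≤ C₁) (h₂ : 0 ≤ C₂) (h₃ : 0 ≤ C₃)
    (h : ∀ p, |G p| ≤ C₁ * (‖f₁ p‖ * ‖g₁ p‖) + C₂ * (‖f₂ p‖ * ‖g₂ p‖)
      + C₃ * (‖f₃ p‖ * ‖g₃ p‖)) :
    |∫ p, G p| ≤ C₁ * (nrm f₁ * nrm g₁) + C₂ * (nrm f₂ * nrm g₂) + C₃ * (nrm f₃ * nrm g₃) := by
  have i₁ := (hf₁.integrable_mul_norm hg₁).const_mul C₁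
  have i₂ := (hf₂.integrable_mul_norm hg₂).const_mul C₂
  have i₃ := (hf₃.integrable_mul_norm hg₃).const_mul C₃
  calc |∫ p, G p| = ‖∫ p, G p‖ := rfl
    _ ≤ ∫ p, (C₁ * (‖f₁ p‖ * ‖g₁ p‖) + C₂ * (‖f₂ p‖ * ‖g₂ p‖) + C₃ * (‖f₃ p‖ * ‖g₃ p‖)) :=
      norm_integral_le_of_norm_le ((i₁.add i₂).add i₃) (ae_of_all _ fun p => h p)
    _ = C₁ * (∫ p, ‖f₁ p‖ * ‖g₁ p‖) + C₂ * (∫ p, ‖f₂ p‖ * ‖g₂ p‖)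
        + C₃ * (∫ p, ‖f₃ p‖ * ‖g₃ p‖) := by
      rw [← integral_const_mul, ← integral_const_mul, ← integral_const_mul, ← integral_add i₁ i₂]
      exact integral_add (i₁.add i₂) i₃
    _ ≤ _ := by
      gcongr
      exacts [integral_norm_mul_le hf₁ hg₁, integral_norm_mul_le hf₂ hg₂,
        integral_norm_mul_le hf₃ hg₃]

/-- If X exceeded (a + b + 1)N, then X > N, so the right-hand side would be at most (a + b)NX, which
is less than X². -/
lemma le_mul_of_sq_le {X N a b : ℝ} (hN : 0 ≤ N) (ha : 0 ≤ a) (hb : 0 ≤ b)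
    (h : X ^ 2 ≤ a * (N * X) + b * N ^ 2) : X ≤ (a + b + 1) * N := by
  by_contra hlt
  push Not at hlt
  have hab : 0 ≤ a + b := by positivity
  have h1 : 0 ≤ (a + b) * N := by positivity
  have hNX : N < X := by linarith
  have hX : 0 < X := by linarith
  have h2 : b * N ^ 2 ≤ b * (N * X) := by gcongr; nlinarith
  have h3 : (a + b + 1) * N * X < X * X := by gcongr
  have h4 : 0 ≤ N * X := by positivity
  linarith [h3, h2, h4, h]

/-- The system of quadratic inequalities behind the weighted estimates. -/
lemma quadratic_system_weights {c : ℝ} (hc : 1 ≤ c) : ∃ C : ℝ, 0 ≤ C ∧ ∀ N X A B : ℝ,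
    0 ≤ N → 0 ≤ X → 0 ≤ A → 0 ≤ B → A ^ 2 ≤ c * (N * X + A * N) →
    B ^ 2 ≤ c * (N * B + A * X + A ^ 2) →
    X ^ 2 ≤ c * (N * A + A * B + N ^ 2 + A ^ 2 + A * X) →
    X ≤ C * N ∧ A ≤ C * N ∧ B ≤ C * N := by
  have hc0 : 0 ≤ c := by linarith
  obtain ⟨M, hM0, hM⟩ : ∃ M : ℝ, 0 ≤ M ∧ M = 12 * c ^ 2 := ⟨_, by positivity, rfl⟩
  obtain ⟨D, hD0, hD⟩ : ∃ D : ℝ, 0 ≤ D ∧ D = 2 * M * c + (M * c ^ 2 + M) + 1 :=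
    ⟨_, by positivity, rfl⟩
  obtain ⟨D₂, hD₂0, hD₂⟩ : ∃ D₂ : ℝ, 0 ≤ D₂ ∧ D₂ = 2 * c * D + c ^ 2 := ⟨_, by positivity, rfl⟩
  obtain ⟨D₃, hD₃0, hD₃⟩ : ∃ D₃ : ℝ, 0 ≤ D₃ ∧ D₃ = D ^ 2 + (c ^ 2 + 2 * c) * D₂ + c ^ 2 :=
    ⟨_, by positivity, rfl⟩
  refine ⟨D + (0 + D₂ + 1) + (0 + D₃ + 1), by positivity, fun N X A B hN hX hA hB h₁ h₂ h₃ => ?_⟩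
  have hA2 : A ^ 2 ≤ 2 * c * (N * X) + c ^ 2 * N ^ 2 := by
    linarith [sq_nonneg (A - c * N)]
  -- The point is that X² enters with coefficient 1, which fixes how much of B² may be spent in the
  -- next bound.
  have hB2 : B ^ 2 ≤ X ^ 2 + (c ^ 2 + 2 * c) * A ^ 2 + c ^ 2 * N ^ 2 := by
    linarith [sq_nonneg (B - c * N), sq_nonneg (X - c * A)]
  -- The product AB costs B²/4, hence X²/4, and AX costs another X²/4; half of X² is absorbed on the
  -- left. Since A² is only linear in X, this bounds X.
  have hX2 : X ^ 2 ≤ M * A ^ 2 + M * N ^ 2 := by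
    have e1 : c * (A * B) ≤ B ^ 2 / 4 + c ^ 2 * A ^ 2 := by linarith [sq_nonneg (B / 2 - c * A)]
    have e2 : c * (A * X) ≤ X ^ 2 / 4 + c ^ 2 * A ^ 2 := by linarith [sq_nonneg (X / 2 - c * A)]
    have e3 : c * (N * A) ≤ c ^ 2 * A ^ 2 + N ^ 2 / 4 := by linarith [sq_nonneg (N / 2 - c * A)]
    have e4 : c ≤ c ^ 2 := by nlinarith
    have e5 : c * A ^ 2 ≤ c ^ 2 * A ^ 2 := by gcongr
    have e6 : c * N ^ 2 ≤ c ^ 2 * N ^ 2 := by gcongr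
    have e7 : N ^ 2 ≤ c ^ 2 * N ^ 2 := le_mul_of_one_le_left (sq_nonneg N) (one_le_pow₀ hc)
    have e8 : 0 ≤ c ^ 2 * N ^ 2 := by positivity
    have e9 : 0 ≤ c ^ 2 * A ^ 2 := by positivity
    rw [hM]
    linarith
  have hX1 : X ≤ D * N := by
    rw [hD]
    refine le_mul_of_sq_le hN (by positivity) (by positivity) ?_
    linarith [mul_le_mul_of_nonneg_left hA2 hM0]
  have hA1 : A ^ 2 ≤ 0 * (N * A) + D₂ * N ^ 2 := by
    have : N * X ≤ N * (D * N) := by gcongr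
    have h2c : 0 ≤ 2 * c := by linarith
    rw [hD₂]
    linarith [mul_le_mul_of_nonneg_left this h2c]
  have hB1 : B ^ 2 ≤ 0 * (N * B) + D₃ * N ^ 2 := by
    have t1 : X ^ 2 ≤ D ^ 2 * N ^ 2 := by
      rw [← mul_pow]; gcongr
    have t2 : 0 ≤ c ^ 2 + 2 * c := by positivity
    rw [hD₃]
    linarith [mul_le_mul_of_nonneg_left hA1 t2]
  have gA := le_mul_of_sq_le hN le_rfl hD₂0 hA1
  have gB := le_mul_of_sq_le hN le_rfl hD₃0 hB1
  have r1 : 0 ≤ D * N := by positivity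
  have r2 : 0 ≤ (0 + D₂ + 1) * N := by positivity
  have r3 : 0 ≤ (0 + D₃ + 1) * N := by positivity
  refine ⟨?_, ?_, ?_⟩ <;> rw [add_mul, add_mul] <;> linarith

/-! ### Energy estimates with the weights μ², |y|² and E·y/μ². -/

namespace Coeffs

variable {K : ℝ} (c : Coeffs n K)

lemma continuous_μ : Continuous fun p : Phase n => c.μ p.1 :=
  c.contDiff_μ.continuous.comp continuous_fst

lemma μ_pos (x : Space n) : 0 < c.μ x := zero_lt_one.trans_le (c.one_le x)

include c in
lemma K_nonneg : 0 ≤ K := zero_le_one.trans c.one_le_K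

lemma abs_E_le (j : Fin n) (x : Space n) : |c.E j x| ≤ c.μ x ^ 3 := by
  refine abs_le_of_sq_le_sq ?_ (pow_nonneg (c.μ_pos x).le 3)
  have h : c.E j x ^ 2 ≤ ∑ j, c.E j x ^ 2 :=
    Finset.single_le_sum (fun i _ => sq_nonneg (c.E i x)) (Finset.mem_univ j)
  nlinarith [c.pow_six x]

/-- `μ² u`, `μ u`, etc.: multiplication by weights `μ^a |y|^b`. -/
def wt (a b : ℕ) (u : Phase n → ℂ) (p : Phase n) : ℂ := (c.μ p.1 ^ a * ‖p.2‖ ^ b) • u p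

lemma norm_wt (a b : ℕ) (u : Phase n → ℂ) (p : Phase n) :
    ‖c.wt a b u p‖ = c.μ p.1 ^ a * ‖p.2‖ ^ b * ‖u p‖ := by
  have := c.μ_pos p.1
  rw [wt, norm_smul, Real.norm_of_nonneg (by positivity)]

lemma cc_wt (a b : ℕ) {u : Phase n → ℂ} (hu : CC u) : CC (c.wt a b u) :=
  hu.smul ((c.continuous_μ.pow a).mul (by fun_prop))

lemma nrm_le_wt (a : ℕ) {u : Phase n → ℂ} (hu : CC u) : nrm u ≤ nrm (c.wt a 0 u) := by
  refine nrm_mono (c.cc_wt a 0 hu).sqInt fun p => ?_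
  rw [norm_wt]
  have := one_le_pow₀ (c.one_le p.1) (n := a)
  nlinarith [norm_nonneg (u p)]

lemma nrm_wt_mono {a a' : ℕ} (h : a ≤ a') (b : ℕ) {u : Phase n → ℂ} (hu : CC u) :
    nrm (c.wt a b u) ≤ nrm (c.wt a' b u) := by
  refine nrm_mono (c.cc_wt a' b hu).sqInt fun p => ?_
  rw [norm_wt, norm_wt]
  gcongr
  exact c.one_le p.1

lemma abs_coord_le (y : Space n) (j : Fin n) : |y j| ≤ ‖y‖ := by
  simpa using PiLp.norm_apply_le y j

/-- Energy identity with φ = μ². The weight does not depend on y, and its derivative along the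
field, 2μ y·∂μ, is at most 2Kμ|y| because μ is Lipschitz. -/
lemma energy_mu {u : Phase n → ℂ} (hu : Test u) :
    (∑ j, nrm (c.wt 1 0 (dy j u)) ^ 2) + nrm (c.wt 1 1 u) ^ 2 / 4
      ≤ nrm (c.P u) * nrm (c.wt 2 0 u) + K * (nrm (c.wt 1 1 u) * nrm u)
        + n / 2 * (nrm (c.wt 2 0 u) * nrm u) := by
  have hμ : ContDiff ℝ 1 fun p : Phase n => c.μ p.1 := c.contDiff_μ.comp contDiff_fst
  have hfd : ∀ (p v : Phase n), fderiv ℝ (fun p : Phase n => c.μ p.1 ^ 2) p v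
      = 2 * c.μ p.1 * fderiv ℝ c.μ p.1 v.1 := by
    intro p v
    have h := ((c.contDiff_μ.differentiable (by norm_num) p.1).hasFDerivAt.comp p
      hasFDerivAt_fst).pow 2
    have h' := h.fderiv
    simp only [Function.comp_def] at h'
    rw [h']
    simp
  have h := c.integral_weight_P hu (hμ.pow 2)
  simp_rw [hfd] at h
  have s3 : ∀ j : Fin n, ∫ p : Phase n, 2 * c.μ p.1 * fderiv ℝ c.μ p.1 (ey j : Phase n).1
      * inner ℝ (dy j u p) (u p) = 0 := fun j => by simp [ey]
  simp_rw [s3, Finset.sum_const_zero, add_zero] at h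
  have s1 : |∫ p, c.μ p.1 ^ 2 * inner ℝ (c.P u p) (u p)|
      ≤ 1 * (nrm (c.P u) * nrm (c.wt 2 0 u)) := by
    refine abs_integral_le (c.cc_P hu).sqInt (c.cc_wt 2 0 hu.cc).sqInt zero_le_one fun p => ?_
    rw [norm_wt, abs_mul, abs_of_nonneg (by positivity)]
    have := abs_real_inner_le_norm (c.P u p) (u p)
    calc _ ≤ c.μ p.1 ^ 2 * (‖c.P u p‖ * ‖u p‖) := by gcongr
      _ = _ := by ring
  have s2 : |∫ p, 2 * c.μ p.1 * fderiv ℝ c.μ p.1 (c.field p).1 * ‖u p‖ ^ 2|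
      ≤ (2 * K) * (nrm (c.wt 1 1 u) * nrm u) := by
    refine abs_integral_le (c.cc_wt 1 1 hu.cc).sqInt hu.cc.sqInt
      (mul_nonneg zero_le_two c.K_nonneg) fun p => ?_
    have hp := c.μ_pos p.1
    have h1 : |fderiv ℝ c.μ p.1 p.2| ≤ K * ‖p.2‖ :=
      ((fderiv ℝ c.μ p.1).le_opNorm p.2).trans (by gcongr; exact c.bound_dμ p.1)
    rw [norm_wt, abs_mul, abs_mul, abs_of_nonneg (by positivity : 0 ≤ 2 * c.μ p.1),
      abs_of_nonneg (by positivity : 0 ≤ ‖u p‖ ^ 2)]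
    calc 2 * c.μ p.1 * |fderiv ℝ c.μ p.1 (c.field p).1| * ‖u p‖ ^ 2
        ≤ 2 * c.μ p.1 * (K * ‖p.2‖) * ‖u p‖ ^ 2 := by gcongr; exact h1
      _ = _ := by ring
  have s4 : ∀ j, ∫ p, c.μ p.1 ^ 2 * ‖dy j u p‖ ^ 2 = nrm (c.wt 1 0 (dy j u)) ^ 2 := by
    intro j
    rw [(c.cc_wt 1 0 (hu.dy j).cc).sqInt.nrm_sq]
    congr 1; ext p; rw [norm_wt]; ring
  have s5 : ∫ p, c.μ p.1 ^ 2 * (‖p.2‖ ^ 2 / 4 - (n : ℝ) / 2) * ‖u p‖ ^ 2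
      = nrm (c.wt 1 1 u) ^ 2 / 4 - n / 2 * ∫ p, c.μ p.1 ^ 2 * ‖u p‖ ^ 2 := by
    rw [(c.cc_wt 1 1 hu.cc).sqInt.nrm_sq, ← integral_div, ← integral_const_mul, ← integral_sub]
    · congr 1; ext p; rw [norm_wt]; ring
    · exact ((c.cc_wt 1 1 hu.cc).sqInt.integrable_sq.div_const 4)
    · exact ((hu.cc.norm_sq.mul (c.continuous_μ.pow 2)).integrable).const_mul _
  have s6 : |∫ p, c.μ p.1 ^ 2 * ‖u p‖ ^ 2| ≤ 1 * (nrm (c.wt 2 0 u) * nrm u) := by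
    refine abs_integral_le (c.cc_wt 2 0 hu.cc).sqInt hu.cc.sqInt zero_le_one fun p => ?_
    rw [norm_wt, abs_of_nonneg (by positivity)]
    exact le_of_eq (by ring)
  simp_rw [s4, s5] at h
  have s7 := abs_le.mp s1
  have s8 := abs_le.mp s2
  have s9 : (n : ℝ) / 2 * (∫ p, c.μ p.1 ^ 2 * ‖u p‖ ^ 2)
      ≤ n / 2 * (1 * (nrm (c.wt 2 0 u) * nrm u)) := by
    gcongr; exact (abs_le.mp s6).2
  linarith [s7.1, s7.2, s8.1, s8.2]

/-- The magnetic force does no work, by antisymmetry of b. -/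
lemma sum_acc_mul (p : Phase n) : ∑ j, c.acc p j * p.2 j = -∑ j, c.E j p.1 * p.2 j := by
  have h0 : ∑ j, ∑ i, c.b i j p.1 * p.2 i * p.2 j = 0 := by
    have h1 : ∑ j, ∑ i, c.b i j p.1 * p.2 i * p.2 j
        = -∑ j, ∑ i, c.b i j p.1 * p.2 i * p.2 j := by
      conv_rhs => rw [Finset.sum_comm]
      rw [← Finset.sum_neg_distrib]
      refine Finset.sum_congr rfl fun j _ => ?_
      rw [← Finset.sum_neg_distrib]
      refine Finset.sum_congr rfl fun i _ => ?_
      rw [c.antisymm j i]; ring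
    linarith
  simp only [acc_apply, sub_mul, neg_mul, Finset.sum_sub_distrib, Finset.sum_mul, h0, sub_zero,
    Finset.sum_neg_distrib]

/-- Energy identity with φ = |y|². Its derivative along the field is -2E·y, and |E||y| ≤ μ³|y| is
split as μ|y| times μ². -/
lemma energy_y {u : Phase n → ℂ} (hu : Test u) :
    (∑ j, nrm (c.wt 0 1 (dy j u)) ^ 2) + nrm (c.wt 0 2 u) ^ 2 / 4
      ≤ nrm (c.P u) * nrm (c.wt 0 2 u) + n * (nrm (c.wt 1 1 u) * nrm (c.wt 2 0 u))
        + (∑ j, 2 * (nrm (c.wt 1 0 (dy j u)) * nrm (c.wt 1 1 u)))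
        + n / 2 * nrm (c.wt 1 1 u) ^ 2 := by
  have hφ : ContDiff ℝ 1 fun p : Phase n => ‖p.2‖ ^ 2 := contDiff_snd.norm_sq ℝ
  have hfd : ∀ (p v : Phase n), fderiv ℝ (fun p : Phase n => ‖p.2‖ ^ 2) p v
      = 2 * ∑ j, v.2 j * p.2 j := by
    intro p v
    have h := ((hasStrictFDerivAt_norm_sq p.2).hasFDerivAt.comp p
      (hasFDerivAt_snd (𝕜 := ℝ) (p := p))).fderiv
    simp only [Function.comp_def] at h
    rw [h]
    simp [PiLp.inner_apply]
  have h := c.integral_weight_P hu hφ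
  have hfield : ∀ p : Phase n, 2 * ∑ j, (c.field p).2 j * p.2 j = -2 * ∑ j, c.E j p.1 * p.2 j := by
    intro p
    rw [show (c.field p).2 = c.acc p from rfl, sum_acc_mul]; ring
  have hey : ∀ (p : Phase n) (j : Fin n), 2 * ∑ i, (ey j : Phase n).2 i * p.2 i = 2 * p.2 j := by
    intro p j
    simp [ey]
  simp_rw [hfd, hfield, hey] at h
  have s1 : |∫ p : Phase n, ‖p.2‖ ^ 2 * inner ℝ (c.P u p) (u p)|
      ≤ 1 * (nrm (c.P u) * nrm (c.wt 0 2 u)) := by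
    refine abs_integral_le (c.cc_P hu).sqInt (c.cc_wt 0 2 hu.cc).sqInt zero_le_one fun p => ?_
    rw [norm_wt, abs_mul, abs_of_nonneg (by positivity)]
    have := abs_real_inner_le_norm (c.P u p) (u p)
    calc _ ≤ ‖p.2‖ ^ 2 * (‖c.P u p‖ * ‖u p‖) := by gcongr
      _ = _ := by ring
  have s2 : |∫ p : Phase n, -2 * (∑ j, c.E j p.1 * p.2 j) * ‖u p‖ ^ 2|
      ≤ (2 * n) * (nrm (c.wt 1 1 u) * nrm (c.wt 2 0 u)) := by
    refine abs_integral_le (c.cc_wt 1 1 hu.cc).sqInt (c.cc_wt 2 0 hu.cc).sqInt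
      (by positivity) fun p => ?_
    have hp := c.μ_pos p.1
    have h1 : |∑ j, c.E j p.1 * p.2 j| ≤ n * (c.μ p.1 ^ 3 * ‖p.2‖) := by
      refine (Finset.abs_sum_le_sum_abs _ _).trans ?_
      calc ∑ j, |c.E j p.1 * p.2 j| ≤ ∑ _j : Fin n, c.μ p.1 ^ 3 * ‖p.2‖ := by
            gcongr with j
            rw [abs_mul]
            gcongr
            exacts [c.abs_E_le j p.1, abs_coord_le p.2 j]
        _ = _ := by simp
    rw [norm_wt, norm_wt, abs_mul, abs_mul, abs_of_nonneg (by positivity : 0 ≤ ‖u p‖ ^ 2)]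
    calc |(-2 : ℝ)| * |∑ j, c.E j p.1 * p.2 j| * ‖u p‖ ^ 2
        ≤ 2 * (n * (c.μ p.1 ^ 3 * ‖p.2‖)) * ‖u p‖ ^ 2 := by
          gcongr
          norm_num
      _ = _ := by ring
  have s3 : ∀ j : Fin n, |∫ p : Phase n, 2 * p.2 j * inner ℝ (dy j u p) (u p)|
      ≤ 2 * (nrm (c.wt 1 0 (dy j u)) * nrm (c.wt 1 1 u)) := by
    intro j
    refine abs_integral_le (c.cc_wt 1 0 (hu.dy j).cc).sqInt (c.cc_wt 1 1 hu.cc).sqInt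
      (by positivity) fun p => ?_
    have hp := c.μ_pos p.1
    have h2 := abs_real_inner_le_norm (dy j u p) (u p)
    have h3 := one_le_pow₀ (c.one_le p.1) (n := 2)
    rw [norm_wt, norm_wt, abs_mul, abs_mul, abs_two]
    calc 2 * |p.2 j| * |inner ℝ (dy j u p) (u p)|
        ≤ 2 * ‖p.2‖ * (‖dy j u p‖ * ‖u p‖) := by
          gcongr
          exact abs_coord_le p.2 j
      -- The factor μ² ≥ 1 is inserted so that only the norms controlled by `energy_mu` occur.
      _ ≤ c.μ p.1 ^ 2 * (2 * ‖p.2‖ * (‖dy j u p‖ * ‖u p‖)) :=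
          le_mul_of_one_le_left (by positivity) h3
      _ = _ := by ring
  have s4 : ∀ j, ∫ p : Phase n, ‖p.2‖ ^ 2 * ‖dy j u p‖ ^ 2 = nrm (c.wt 0 1 (dy j u)) ^ 2 := by
    intro j
    rw [(c.cc_wt 0 1 (hu.dy j).cc).sqInt.nrm_sq]
    congr 1; ext p; rw [norm_wt]; ring
  have s5 : ∫ p : Phase n, ‖p.2‖ ^ 2 * (‖p.2‖ ^ 2 / 4 - (n : ℝ) / 2) * ‖u p‖ ^ 2
      = nrm (c.wt 0 2 u) ^ 2 / 4 - n / 2 * nrm (c.wt 0 1 u) ^ 2 := by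
    rw [(c.cc_wt 0 2 hu.cc).sqInt.nrm_sq, (c.cc_wt 0 1 hu.cc).sqInt.nrm_sq,
      ← integral_div, ← integral_const_mul, ← integral_sub]
    · congr 1; ext p; rw [norm_wt, norm_wt]; ring
    · exact ((c.cc_wt 0 2 hu.cc).sqInt.integrable_sq.div_const 4)
    · exact ((c.cc_wt 0 1 hu.cc).sqInt.integrable_sq).const_mul _
  simp_rw [s4, s5] at h
  have s6 : (n : ℝ) / 2 * nrm (c.wt 0 1 u) ^ 2 ≤ n / 2 * nrm (c.wt 1 1 u) ^ 2 := by
    have := c.nrm_wt_mono zero_le_one 1 hu.cc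
    have := nrm_nonneg (c.wt 0 1 u)
    gcongr
  have s7 := abs_le.mp s1
  have s8 := abs_le.mp s2
  have s9 : -(∑ j, ∫ p : Phase n, 2 * p.2 j * inner ℝ (dy j u p) (u p))
      ≤ ∑ j, 2 * (nrm (c.wt 1 0 (dy j u)) * nrm (c.wt 1 1 u)) := by
    rw [← Finset.sum_neg_distrib]
    gcongr with j
    linarith [(abs_le.mp (s3 j)).1]
  linarith [s7.1, s7.2, s8.1, s8.2]

/-- The normalised force `E / μ²`, which is Lipschitz. -/
def nE (j : Fin n) (x : Space n) : ℝ := c.E j x * (c.μ x ^ 2)⁻¹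

lemma contDiff_nE (j : Fin n) : ContDiff ℝ 1 (c.nE j) :=
  (c.contDiff_E j).mul ((c.contDiff_μ.pow 2).inv fun x => (pow_pos (c.μ_pos x) 2).ne')

lemma abs_nE_le (j : Fin n) (x : Space n) : |c.nE j x| ≤ c.μ x := by
  have hp := c.μ_pos x
  rw [nE, abs_mul, abs_of_nonneg (by positivity : 0 ≤ (c.μ x ^ 2)⁻¹), ← div_eq_mul_inv,
    div_le_iff₀ (by positivity)]
  calc _ ≤ _ := c.abs_E_le j x
    _ = _ := by ring

/-- The product rule gives ∂E/μ², bounded by K, and -2E∂μ/μ³, bounded by 2K since |E| ≤ μ³. -/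
lemma abs_fderiv_nE_le (j : Fin n) (x a : Space n) : |fderiv ℝ (c.nE j) x a| ≤ 3 * K * ‖a‖ := by
  have hp := c.μ_pos x
  have h1 := (c.contDiff_E j).differentiable (by norm_num) x
  have h2 := c.contDiff_μ.differentiable (by norm_num) x
  have h3 : HasFDerivAt (fun x => (c.μ x ^ 2)⁻¹)
      ((-(c.μ x ^ 2 * c.μ x ^ 2)⁻¹ * (2 * c.μ x)) • fderiv ℝ c.μ x) x := by
    have e1 : HasDerivAt (fun t : ℝ => (t ^ 2)⁻¹) (-(c.μ x ^ 2 * c.μ x ^ 2)⁻¹ * (2 * c.μ x))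
        (c.μ x) := by
      have := (hasDerivAt_pow 2 (c.μ x)).inv (pow_pos hp 2).ne'
      convert! this using 1
      field_simp
      norm_num
      ring
    exact e1.comp_hasFDerivAt x h2.hasFDerivAt
  have h4 := (h1.hasFDerivAt.mul h3).fderiv
  rw [show c.nE j = c.E j * fun x => (c.μ x ^ 2)⁻¹ from rfl, h4]
  simp only [add_apply, smul_apply, smul_eq_mul]
  have b1 : |fderiv ℝ (c.E j) x a| ≤ K * c.μ x ^ 2 * ‖a‖ :=
    ((fderiv ℝ (c.E j) x).le_opNorm a).trans (by gcongr; exact c.bound_dE j x)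
  have b2 : |fderiv ℝ c.μ x a| ≤ K * ‖a‖ :=
    ((fderiv ℝ c.μ x).le_opNorm a).trans (by gcongr; exact c.bound_dμ x)
  have hK := c.K_nonneg
  calc _ ≤ |c.E j x * (-(c.μ x ^ 2 * c.μ x ^ 2)⁻¹ * (2 * c.μ x) * fderiv ℝ c.μ x a)|
        + |(c.μ x ^ 2)⁻¹ * fderiv ℝ (c.E j) x a| := abs_add_le _ _
    _ = |c.E j x| * ((c.μ x ^ 2 * c.μ x ^ 2)⁻¹ * (2 * c.μ x) * |fderiv ℝ c.μ x a|)
        + (c.μ x ^ 2)⁻¹ * |fderiv ℝ (c.E j) x a| := by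
      simp only [abs_mul, abs_neg, abs_inv, abs_pow, abs_of_pos hp, abs_two]
    _ ≤ c.μ x ^ 3 * ((c.μ x ^ 2 * c.μ x ^ 2)⁻¹ * (2 * c.μ x) * (K * ‖a‖))
        + (c.μ x ^ 2)⁻¹ * (K * c.μ x ^ 2 * ‖a‖) := by
      gcongr
      exact c.abs_E_le j x
    _ = 3 * K * ‖a‖ := by field_simp; ring

/-- Energy identity with the multiplier φ = E·y/μ². It has no sign but satisfies |φ| ≤ nμ|y|, and
its derivative along the field is -μ⁴ plus terms of size 1, |y|² and μ³|y|. The main term is the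
only source of control on ‖μ²u‖. -/
lemma energy_force {u : Phase n → ℂ} (hu : Test u) :
    nrm (c.wt 2 0 u) ^ 2 / 2
      ≤ n * (nrm (c.P u) * nrm (c.wt 1 1 u))
        + (∑ j, n * (nrm (c.wt 1 0 (dy j u)) * nrm (c.wt 0 1 (dy j u))))
        + (∑ j, nrm (c.wt 1 0 (dy j u)) * nrm u)
        + (n / 4 * (nrm (c.wt 1 1 u) * nrm (c.wt 0 2 u)) + n * n / 2 * (nrm (c.wt 1 1 u) * nrm u))
        + (nrm u ^ 2 + 3 * K * n * nrm (c.wt 1 1 u) ^ 2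
          + n * n * K * (nrm (c.wt 1 1 u) * nrm (c.wt 2 0 u))) / 2 := by
  have hK := c.K_nonneg
  let φ : Phase n → ℝ := fun p => ∑ j, c.nE j p.1 * p.2 j
  have hφ : ContDiff ℝ 1 φ := ContDiff.sum fun j _ =>
    ((c.contDiff_nE j).comp contDiff_fst).mul (by fun_prop)
  have hfd : ∀ (p v : Phase n), fderiv ℝ φ p v
      = ∑ j, (c.nE j p.1 * v.2 j + p.2 j * fderiv ℝ (c.nE j) p.1 v.1) := by
    intro p v
    have h1 : ∀ j ∈ (Finset.univ : Finset (Fin n)), HasFDerivAt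
        (fun p : Phase n => c.nE j p.1 * p.2 j)
        (c.nE j p.1 • (EuclideanSpace.proj j).comp (ContinuousLinearMap.snd ℝ (Space n) (Space n))
          + p.2 j • (fderiv ℝ (c.nE j) p.1).comp (ContinuousLinearMap.fst ℝ _ _)) p := fun j _ =>
      (((c.contDiff_nE j).differentiable (by norm_num) p.1).hasFDerivAt.comp p
        hasFDerivAt_fst).mul
        ((EuclideanSpace.proj j).comp (ContinuousLinearMap.snd ℝ (Space n) (Space n))).hasFDerivAt
    rw [show fderiv ℝ φ p = _ from (HasFDerivAt.fun_sum h1).fderiv]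
    simp
  have hφb : ∀ p, |φ p| ≤ n * (c.μ p.1 * ‖p.2‖) := by
    intro p
    have hp := c.μ_pos p.1
    refine (Finset.abs_sum_le_sum_abs _ _).trans ?_
    calc ∑ j, |c.nE j p.1 * p.2 j| ≤ ∑ _j : Fin n, c.μ p.1 * ‖p.2‖ := by
          gcongr with j
          rw [abs_mul]
          gcongr
          exacts [c.abs_nE_le j p.1, abs_coord_le p.2 j]
      _ = _ := by simp
  have hey : ∀ (p : Phase n) (j : Fin n), fderiv ℝ φ p (ey j) = c.nE j p.1 := by
    intro p j
    rw [hfd]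
    simp [ey]
  have h := c.integral_weight_P hu hφ
  simp_rw [hey] at h
  have hfield : ∀ p, |fderiv ℝ φ p (c.field p) + c.μ p.1 ^ 4|
      ≤ 1 + 3 * K * n * ‖p.2‖ ^ 2 + n * n * K * (c.μ p.1 ^ 3 * ‖p.2‖) := by
    intro p
    have hp := c.μ_pos p.1
    -- As |E|² = μ⁶ - 1, the force contributes -|E|²/μ² = -μ⁴ + μ⁻². What remains is the derivative
    -- of E/μ² along y and the magnetic term.
    have e1 : fderiv ℝ φ p (c.field p) + c.μ p.1 ^ 4
        = (c.μ p.1 ^ 2)⁻¹ + (∑ j, p.2 j * fderiv ℝ (c.nE j) p.1 p.2)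
          - ∑ j, ∑ i, c.nE j p.1 * (c.b i j p.1 * p.2 i) := by
      have e2 : ∑ j, c.nE j p.1 * c.E j p.1 = c.μ p.1 ^ 4 - (c.μ p.1 ^ 2)⁻¹ := by
        have : ∑ j, c.nE j p.1 * c.E j p.1 = (c.μ p.1 ^ 2)⁻¹ * ∑ j, c.E j p.1 ^ 2 := by
          rw [Finset.mul_sum]
          exact Finset.sum_congr rfl fun j _ => by rw [nE]; ring
        rw [this, show ∑ j, c.E j p.1 ^ 2 = c.μ p.1 ^ 6 - 1 by linarith [c.pow_six p.1]]
        field_simp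
      rw [hfd]
      simp only [field, acc_apply, mul_sub, mul_neg, Finset.sum_add_distrib,
        Finset.sum_sub_distrib, Finset.sum_neg_distrib, e2, Finset.mul_sum]
      ring
    have e3 : |∑ j, p.2 j * fderiv ℝ (c.nE j) p.1 p.2| ≤ n * (‖p.2‖ * (3 * K * ‖p.2‖)) := by
      refine (Finset.abs_sum_le_sum_abs _ _).trans ?_
      calc ∑ j, |p.2 j * fderiv ℝ (c.nE j) p.1 p.2| ≤ ∑ _j : Fin n, ‖p.2‖ * (3 * K * ‖p.2‖) := by
            gcongr with j
            rw [abs_mul]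
            gcongr
            exacts [abs_coord_le p.2 j, c.abs_fderiv_nE_le j p.1 p.2]
        _ = _ := by simp
    have e4 : |∑ j, ∑ i, c.nE j p.1 * (c.b i j p.1 * p.2 i)|
        ≤ n * (n * (c.μ p.1 * (K * c.μ p.1 ^ 2 * ‖p.2‖))) := by
      refine (Finset.abs_sum_le_sum_abs _ _).trans ?_
      calc _ ≤ ∑ _j : Fin n, ∑ _i : Fin n, c.μ p.1 * (K * c.μ p.1 ^ 2 * ‖p.2‖) := by
            gcongr with j
            refine (Finset.abs_sum_le_sum_abs _ _).trans ?_
            gcongr with i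
            rw [abs_mul, abs_mul]
            gcongr
            exacts [c.abs_nE_le j p.1, c.bound_b i j p.1, abs_coord_le p.2 i]
        _ = _ := by simp
    have e5 : |(c.μ p.1 ^ 2)⁻¹| ≤ 1 := by
      rw [abs_of_nonneg (by positivity)]
      exact inv_le_one_of_one_le₀ (one_le_pow₀ (c.one_le p.1))
    rw [e1]
    calc _ ≤ |(c.μ p.1 ^ 2)⁻¹| + |∑ j, p.2 j * fderiv ℝ (c.nE j) p.1 p.2|
          + |∑ j, ∑ i, c.nE j p.1 * (c.b i j p.1 * p.2 i)| :=
          (abs_sub _ _).trans (by gcongr; exact abs_add_le _ _)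
      _ ≤ _ := by linarith
  have s1 : |∫ p, φ p * inner ℝ (c.P u p) (u p)| ≤ n * (nrm (c.P u) * nrm (c.wt 1 1 u)) := by
    refine abs_integral_le (c.cc_P hu).sqInt (c.cc_wt 1 1 hu.cc).sqInt (by positivity) fun p => ?_
    rw [norm_wt, abs_mul]
    have h1 := abs_real_inner_le_norm (c.P u p) (u p)
    have h2 := hφb p
    have hp := c.μ_pos p.1
    calc _ ≤ (n * (c.μ p.1 * ‖p.2‖)) * (‖c.P u p‖ * ‖u p‖) := by gcongr
      _ = _ := by ring
  have i0 : Continuous fun p : Phase n => fderiv ℝ φ p (c.field p) :=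
    (hφ.continuous_fderiv (by norm_num)).clm_apply c.contDiff_field.continuous
  have s2 : |(∫ p, fderiv ℝ φ p (c.field p) * ‖u p‖ ^ 2) + nrm (c.wt 2 0 u) ^ 2|
      ≤ nrm u ^ 2 + 3 * K * n * nrm (c.wt 1 1 u) ^ 2
          + n * n * K * (nrm (c.wt 1 1 u) * nrm (c.wt 2 0 u)) := by
    have e0 : (∫ p, fderiv ℝ φ p (c.field p) * ‖u p‖ ^ 2) + nrm (c.wt 2 0 u) ^ 2
        = ∫ p, (fderiv ℝ φ p (c.field p) + c.μ p.1 ^ 4) * ‖u p‖ ^ 2 := by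
      rw [(c.cc_wt 2 0 hu.cc).sqInt.nrm_sq, ← integral_add]
      · congr 1; ext p; rw [norm_wt]; ring
      · exact (hu.cc.norm_sq.mul i0).integrable
      · exact (c.cc_wt 2 0 hu.cc).sqInt.integrable_sq
    rw [e0, sq (nrm u), sq (nrm (c.wt 1 1 u)), ← one_mul (nrm u * nrm u)]
    refine abs_integral_le_three hu.cc.sqInt hu.cc.sqInt (c.cc_wt 1 1 hu.cc).sqInt
      (c.cc_wt 1 1 hu.cc).sqInt (c.cc_wt 1 1 hu.cc).sqInt (c.cc_wt 2 0 hu.cc).sqInt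
      zero_le_one (by positivity) (by positivity) fun p => ?_
    have hp := c.μ_pos p.1
    rw [norm_wt, norm_wt, abs_mul, abs_of_nonneg (by positivity : 0 ≤ ‖u p‖ ^ 2)]
    have h3 := one_le_pow₀ (c.one_le p.1) (n := 2)
    calc _ ≤ (1 + 3 * K * n * ‖p.2‖ ^ 2 + n * n * K * (c.μ p.1 ^ 3 * ‖p.2‖)) * ‖u p‖ ^ 2 := by
          gcongr; exact hfield p
      _ = 1 * (‖u p‖ * ‖u p‖) + 3 * K * n * (1 * ‖p.2‖ ^ 2 * ‖u p‖ ^ 2)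
          + n * n * K * (c.μ p.1 ^ 3 * ‖p.2‖ * ‖u p‖ ^ 2) := by ring
      _ ≤ 1 * (‖u p‖ * ‖u p‖) + 3 * K * n * (c.μ p.1 ^ 2 * ‖p.2‖ ^ 2 * ‖u p‖ ^ 2)
          + n * n * K * (c.μ p.1 ^ 3 * ‖p.2‖ * ‖u p‖ ^ 2) := by gcongr
      _ = _ := by ring
  have s3 : ∀ j, |∫ p, φ p * ‖dy j u p‖ ^ 2|
      ≤ n * (nrm (c.wt 1 0 (dy j u)) * nrm (c.wt 0 1 (dy j u))) := by
    intro j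
    refine abs_integral_le (c.cc_wt 1 0 (hu.dy j).cc).sqInt (c.cc_wt 0 1 (hu.dy j).cc).sqInt
      (by positivity) fun p => ?_
    rw [norm_wt, norm_wt, abs_mul, abs_of_nonneg (by positivity : 0 ≤ ‖dy j u p‖ ^ 2)]
    calc _ ≤ (n * (c.μ p.1 * ‖p.2‖)) * ‖dy j u p‖ ^ 2 := by gcongr; exact hφb p
      _ = _ := by ring
  have s4 : ∀ j, |∫ p, c.nE j p.1 * inner ℝ (dy j u p) (u p)|
      ≤ 1 * (nrm (c.wt 1 0 (dy j u)) * nrm u) := by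
    intro j
    refine abs_integral_le (c.cc_wt 1 0 (hu.dy j).cc).sqInt hu.cc.sqInt zero_le_one fun p => ?_
    have hp := c.μ_pos p.1
    rw [norm_wt, abs_mul]
    calc _ ≤ c.μ p.1 * (‖dy j u p‖ * ‖u p‖) := by
          gcongr
          exacts [c.abs_nE_le j p.1, abs_real_inner_le_norm _ _]
      _ = _ := by ring
  have s5 : |∫ p, φ p * (‖p.2‖ ^ 2 / 4 - (n : ℝ) / 2) * ‖u p‖ ^ 2|
      ≤ n / 4 * (nrm (c.wt 1 1 u) * nrm (c.wt 0 2 u)) + n * n / 2 * (nrm (c.wt 1 1 u) * nrm u)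
        + 0 * (nrm u * nrm u) := by
    refine abs_integral_le_three (c.cc_wt 1 1 hu.cc).sqInt (c.cc_wt 0 2 hu.cc).sqInt
      (c.cc_wt 1 1 hu.cc).sqInt hu.cc.sqInt hu.cc.sqInt hu.cc.sqInt
      (by positivity) (by positivity) le_rfl fun p => ?_
    have hp := c.μ_pos p.1
    rw [norm_wt, norm_wt, abs_mul, abs_mul, abs_of_nonneg (by positivity : 0 ≤ ‖u p‖ ^ 2)]
    have e1 : |‖p.2‖ ^ 2 / 4 - (n : ℝ) / 2| ≤ ‖p.2‖ ^ 2 / 4 + n / 2 := by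
      refine (abs_sub _ _).trans_eq ?_
      rw [abs_of_nonneg (by positivity), abs_of_nonneg (by positivity)]
    calc _ ≤ (n * (c.μ p.1 * ‖p.2‖)) * (‖p.2‖ ^ 2 / 4 + n / 2) * ‖u p‖ ^ 2 := by
          gcongr; exact hφb p
      _ = _ := by ring
  have t3 : |∑ j, ∫ p, φ p * ‖dy j u p‖ ^ 2|
      ≤ ∑ j, n * (nrm (c.wt 1 0 (dy j u)) * nrm (c.wt 0 1 (dy j u))) :=
    (Finset.abs_sum_le_sum_abs _ _).trans (Finset.sum_le_sum fun j _ => s3 j)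
  have t4 : |∑ j, ∫ p, c.nE j p.1 * inner ℝ (dy j u p) (u p)|
      ≤ ∑ j, nrm (c.wt 1 0 (dy j u)) * nrm u :=
    (Finset.abs_sum_le_sum_abs _ _).trans (Finset.sum_le_sum fun j _ => by simpa using s4 j)
  rw [abs_le] at s1 s2 s5 t3 t4
  linarith [s1.2, s2.2, s5.1, t3.1, t4.1]

end Coeffs

/-- The constant-tracking part of the weighted estimates. -/
lemma weights_of_energy (n : ℕ) {K : ℝ} (hK : 1 ≤ K) : ∃ C : ℝ, 0 ≤ C ∧
    ∀ (R U X ay bz : ℝ) (a b : Fin n → ℝ), 0 ≤ R → 0 ≤ U → 0 ≤ X → 0 ≤ ay → 0 ≤ bz →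
      (∀ j, 0 ≤ a j) → (∀ j, 0 ≤ b j) →
      (∑ j, a j ^ 2) + ay ^ 2 / 4 ≤ R * X + K * (ay * U) + n / 2 * (X * U) →
      (∑ j, b j ^ 2) + bz ^ 2 / 4
        ≤ R * bz + n * (ay * X) + (∑ j, 2 * (a j * ay)) + n / 2 * ay ^ 2 →
      X ^ 2 / 2 ≤ n * (R * ay) + (∑ j, n * (a j * b j)) + (∑ j, a j * U)
        + (n / 4 * (ay * bz) + n * n / 2 * (ay * U))
        + (U ^ 2 + 3 * K * n * ay ^ 2 + n * n * K * (ay * X)) / 2 →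
      X ≤ C * (R + U) ∧ (∀ j, a j ≤ C * (R + U)) ∧ (∀ j, b j ≤ C * (R + U)) ∧
        bz ≤ C * (R + U) := by
  have hn : (0 : ℝ) ≤ n := n.cast_nonneg
  have hnn : (0 : ℝ) ≤ n * n := by positivity
  -- A generous common bound for every numerical coefficient that appears below.
  obtain ⟨k, hk⟩ : ∃ k : ℝ, k = 100 * (n + 1) ^ 2 * K := ⟨_, rfl⟩
  have hk' : 100 * (n + 1) ^ 2 ≤ k := by
    rw [hk]; exact le_mul_of_one_le_right (by positivity) hK
  have hk1 : 1 ≤ k := by nlinarith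
  have hkK : 100 * K ≤ k := by
    rw [hk, mul_assoc, mul_comm ((n + 1 : ℝ) ^ 2)]
    have : (1 : ℝ) ≤ (n + 1) ^ 2 := one_le_pow₀ (by linarith)
    have := le_mul_of_one_le_right (by linarith : 0 ≤ K) this
    linarith
  have hkKn : 100 * (n * K) ≤ k ∧ 100 * (n * n * K) ≤ k := by
    have h1 : (n : ℝ) ≤ (n + 1) ^ 2 := by nlinarith
    have h2 : (n : ℝ) * n ≤ (n + 1) ^ 2 := by nlinarith
    have h3 := mul_le_mul_of_nonneg_right h1 (by linarith : 0 ≤ K)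
    have h4 := mul_le_mul_of_nonneg_right h2 (by linarith : 0 ≤ K)
    constructor <;> rw [hk] <;> linarith
  obtain ⟨C, hC, H⟩ := quadratic_system_weights hk1
  refine ⟨C, hC, fun R U X ay bz a b hR hU hX0 hay0 hbz0 ha0 hb0 w1 w2 w3 => ?_⟩
  obtain ⟨N, hN⟩ : ∃ N, N = R + U := ⟨_, rfl⟩
  rw [← hN]
  have hN1 : R ≤ N := by linarith
  have hN2 : U ≤ N := by linarith
  have hN0 : 0 ≤ N := by linarith
  have hsa : 0 ≤ ∑ j, a j ^ 2 := Finset.sum_nonneg fun j _ => sq_nonneg _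
  have hsb : 0 ≤ ∑ j, b j ^ 2 := Finset.sum_nonneg fun j _ => sq_nonneg _
  -- A collects the norms of μ∂_y u and μ|y|u, and B those of |y|∂_y u and |y|²u; up to a factor 4,
  -- A² and B² are the left-hand sides of the first two inequalities.
  obtain ⟨A, hA, hA0⟩ : ∃ A, A = Real.sqrt ((∑ j, a j ^ 2) + ay ^ 2) ∧ 0 ≤ A :=
    ⟨_, rfl, Real.sqrt_nonneg _⟩
  obtain ⟨B, hB, hB0⟩ : ∃ B, B = Real.sqrt ((∑ j, b j ^ 2) + bz ^ 2) ∧ 0 ≤ B :=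
    ⟨_, rfl, Real.sqrt_nonneg _⟩
  have hA2 : A ^ 2 = (∑ j, a j ^ 2) + ay ^ 2 := by
    rw [hA]; exact Real.sq_sqrt (by positivity)
  have hB2 : B ^ 2 = (∑ j, b j ^ 2) + bz ^ 2 := by
    rw [hB]; exact Real.sq_sqrt (by positivity)
  have hayA : ay ≤ A := by rw [hA]; exact Real.le_sqrt_of_sq_le (by linarith)
  have hbzB : bz ≤ B := by rw [hB]; exact Real.le_sqrt_of_sq_le (by linarith)
  have haA : ∀ j, a j ≤ A := fun j => by
    have := Finset.single_le_sum (f := fun j => a j ^ 2) (fun i _ => sq_nonneg (a i))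
      (Finset.mem_univ j)
    rw [hA]
    exact Real.le_sqrt_of_sq_le (by linarith [sq_nonneg ay])
  have hbB : ∀ j, b j ≤ B := fun j => by
    have := Finset.single_le_sum (f := fun j => b j ^ 2) (fun i _ => sq_nonneg (b i))
      (Finset.mem_univ j)
    rw [hB]
    exact Real.le_sqrt_of_sq_le (by linarith [sq_nonneg bz])
  have g1 : A ^ 2 ≤ k * (N * X + A * N) := by
    have e1 : R * X ≤ N * X := by gcongr
    have e2 : K * (ay * U) ≤ K * (A * N) := by gcongr
    have e3 : (n : ℝ) / 2 * (X * U) ≤ n / 2 * (X * N) := by gcongr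
    have e4 : A ^ 2 ≤ 4 * (N * X) + 4 * (K * (A * N)) + 4 * (n / 2 * (X * N)) := by
      rw [hA2]; linarith
    have p1 : 0 ≤ N * X := by positivity
    have p2 : 0 ≤ A * N := by positivity
    have q1 : 4 + 2 * (n : ℝ) ≤ k := by linarith [hkKn.1, hkKn.2]
    have q2 : 4 * K ≤ k := by linarith [hkKn.1, hkKn.2]
    linarith [mul_le_mul_of_nonneg_right q1 p1, mul_le_mul_of_nonneg_right q2 p2]
  have g2 : B ^ 2 ≤ k * (N * B + A * X + A ^ 2) := by
    have e1 : R * bz ≤ N * B := by gcongr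
    have e2 : n * (ay * X) ≤ n * (A * X) := by gcongr
    have e3 : ∑ j, 2 * (a j * ay) ≤ n * (2 * (A * A)) := by
      calc ∑ j, 2 * (a j * ay) ≤ ∑ _j : Fin n, 2 * (A * A) := by
            gcongr with j
            exact haA j
        _ = _ := by simp
    have e4 : (n : ℝ) / 2 * ay ^ 2 ≤ n / 2 * A ^ 2 := by gcongr
    have e5 : B ^ 2 ≤ 4 * (N * B) + 4 * (n * (A * X)) + 10 * n * A ^ 2 := by
      rw [hB2]; linarith
    have p1 : 0 ≤ N * B := by positivity
    have p2 : 0 ≤ A * X := by positivity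
    have p3 : 0 ≤ A ^ 2 := by positivity
    have q1 : 4 ≤ k := by linarith [hkKn.1, hkKn.2]
    have q2 : 4 * (n : ℝ) ≤ k := by linarith [hkKn.1, hkKn.2]
    have q3 : 10 * (n : ℝ) ≤ k := by linarith [hkKn.1, hkKn.2]
    linarith [mul_le_mul_of_nonneg_right q1 p1, mul_le_mul_of_nonneg_right q2 p2,
      mul_le_mul_of_nonneg_right q3 p3]
  have g3 : X ^ 2 ≤ k * (N * A + A * B + N ^ 2 + A ^ 2 + A * X) := by
    have e1 : n * (R * ay) ≤ n * (N * A) := by gcongr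
    have e2 : ∑ j, n * (a j * b j) ≤ n * (n * (A * B)) := by
      calc ∑ j, n * (a j * b j) ≤ ∑ _j : Fin n, n * (A * B) := by
            gcongr with j
            exacts [hb0 j, haA j, hbB j]
        _ = _ := by simp
    have e3 : ∑ j, a j * U ≤ n * (A * N) := by
      calc ∑ j, a j * U ≤ ∑ _j : Fin n, A * N := by
            gcongr with j
            exacts [haA j]
        _ = _ := by simp
    have e4 : (n : ℝ) / 4 * (ay * bz) ≤ n / 4 * (A * B) := by gcongr
    have e5 : (n : ℝ) * n / 2 * (ay * U) ≤ n * n / 2 * (A * N) := by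
      gcongr
    have e6 : U ^ 2 ≤ N ^ 2 := by gcongr
    have e7 : 3 * K * n * ay ^ 2 ≤ 3 * K * n * A ^ 2 := by gcongr
    have e8 : n * n * K * (ay * X) ≤ n * n * K * (A * X) := by gcongr
    have e9 : X ^ 2 ≤ (4 * n + n * n) * (N * A) + (2 * (n * n) + n / 2) * (A * B) + N ^ 2
        + 3 * K * n * A ^ 2 + n * n * K * (A * X) := by linarith
    have q1 : 4 * n + n * n ≤ k := by linarith [hkKn.1, hkKn.2]
    have q2 : 2 * ((n : ℝ) * n) + n / 2 ≤ k := by linarith [hkKn.1, hkKn.2]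
    have q4 : 3 * K * n ≤ k := by linarith [hkKn.1, hkKn.2]
    have q5 : n * n * K ≤ k := by linarith [hkKn.1, hkKn.2]
    have p1 : 0 ≤ N * A := by positivity
    have p2 : 0 ≤ A * B := by positivity
    have p3 : 0 ≤ N ^ 2 := by positivity
    have p4 : 0 ≤ A ^ 2 := by positivity
    have p5 : 0 ≤ A * X := by positivity
    linarith [mul_le_mul_of_nonneg_right q1 p1, mul_le_mul_of_nonneg_right q2 p2,
      mul_le_mul_of_nonneg_right hk1 p3, mul_le_mul_of_nonneg_right q4 p4,
      mul_le_mul_of_nonneg_right q5 p5]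
  obtain ⟨r1, r2, r3⟩ := H N X A B hN0 hX0 hA0 hB0 g1 g2 g3
  exact ⟨r1, fun j => (haA j).trans r2, fun j => (hbB j).trans r3, hbzB.trans r3⟩

/-- The weighted estimates: `μ² u`, `μ ∂_y u`, `μ |y| u`, `|y| ∂_y u` and `|y|² u` are controlled. -/
theorem exists_weighted_bound (n : ℕ) (K : ℝ) (hK : 1 ≤ K) : ∃ C : ℝ, 0 ≤ C ∧
    ∀ (c : Coeffs n K) (u : Phase n → ℂ), Test u →
      nrm (c.wt 2 0 u) ≤ C * (nrm (c.P u) + nrm u) ∧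
      (∀ j, nrm (c.wt 1 0 (dy j u)) ≤ C * (nrm (c.P u) + nrm u)) ∧
      (∀ j, nrm (c.wt 0 1 (dy j u)) ≤ C * (nrm (c.P u) + nrm u)) ∧
      nrm (c.wt 0 2 u) ≤ C * (nrm (c.P u) + nrm u) := by
  obtain ⟨C, hC, H⟩ := weights_of_energy n hK
  exact ⟨C, hC, fun c u hu => H _ _ _ _ _ _ _ (nrm_nonneg _) (nrm_nonneg _) (nrm_nonneg _)
    (nrm_nonneg _) (nrm_nonneg _) (fun _ => nrm_nonneg _) (fun _ => nrm_nonneg _)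
    (c.energy_mu hu) (c.energy_y hu) (c.energy_force hu)⟩

end

noncomputable section

variable {n : ℕ}

/-! ### Plancherel's theorem -/

section Plancherel

variable {V : Type*} [NormedAddCommGroup V] [InnerProductSpace ℝ V] [FiniteDimensional ℝ V]
  [MeasurableSpace V] [BorelSpace V]

open SchwartzMap in
/-- On `L¹ ∩ L²` the integral Fourier transform agrees with the one of `L²`. -/
lemma fourier_toLp_ae_eq {g : V → ℂ} (h1 : Integrable g) (h2 : MemLp g 2) :
    (𝓕 (h2.toLp g) : Lp ℂ 2 (volume : Measure V)) =ᵐ[volume] 𝓕 g := by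
  have hcont : Continuous (𝓕 g) :=
    VectorFourier.fourierIntegral_continuous Real.continuous_fourierChar
      (by exact continuous_inner) h1
  -- Both functions are locally integrable, so testing against smooth φ suffices. The transform
  -- moves onto φ on either side: through tempered distributions for the L² transform, by Fubini for
  -- the integral.
  refine ae_eq_of_integral_contDiff_smul_eq ((Lp.memLp _).locallyIntegrable (by norm_num))
    hcont.locallyIntegrable fun φ hφ hφc => ?_
  have hψc : HasCompactSupport (fun x => (φ x : ℂ)) := hφc.comp_left Complex.ofReal_zero
  have hψ : ContDiff ℝ ∞ (fun x => (φ x : ℂ)) := Complex.ofRealCLM.contDiff.comp hφ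
  let ψ : 𝓢(V, ℂ) := hψc.toSchwartzMap hψ
  have e1 : ∫ x, φ x • (𝓕 (h2.toLp g) : Lp ℂ 2 (volume : Measure V)) x
      = ∫ x, (𝓕 ψ) x • (h2.toLp g) x := by
    have := congrArg (fun T => T ψ) (Lp.fourier_toTemperedDistribution_eq (h2.toLp g))
    simp only [TemperedDistribution.fourier_apply, Lp.toTemperedDistribution_apply] at this
    rw [this]
    congr 1
  have e2 : ∫ x, (𝓕 ψ) x • (h2.toLp g) x = ∫ x, (𝓕 (ψ : V → ℂ)) x • g x := by
    refine integral_congr_ae ?_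
    filter_upwards [h2.coeFn_toLp] with x hx
    rw [hx, SchwartzMap.fourier_coe]
  rw [e1, e2]
  have := VectorFourier.integral_fourierIntegral_smul_eq_flip (μ := (volume : Measure V))
    (ν := (volume : Measure V)) (L := innerₗ V) Real.continuous_fourierChar continuous_inner
    ψ.integrable h1
  rw [flip_innerₗ] at this
  exact this

lemma eLpNorm_fourier {g : V → ℂ} (h1 : Integrable g) (h2 : MemLp g 2) :
    eLpNorm (𝓕 g) 2 volume = eLpNorm g 2 volume := by
  rw [← eLpNorm_congr_ae (fourier_toLp_ae_eq h1 h2), ← eLpNorm_congr_ae h2.coeFn_toLp]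
  have := Lp.norm_fourier_eq (h2.toLp g)
  rw [Lp.norm_def, Lp.norm_def] at this
  exact (ENNReal.toReal_eq_toReal_iff' (Lp.eLpNorm_ne_top _) (Lp.eLpNorm_ne_top _)).mp this

lemma integral_inner_fourier {f g : V → ℂ} (hf1 : Integrable f) (hf2 : MemLp f 2)
    (hg1 : Integrable g) (hg2 : MemLp g 2) :
    ∫ ξ, (inner ℝ (𝓕 f ξ) (𝓕 g ξ) : ℝ) = ∫ x, (inner ℝ (f x) (g x) : ℝ) := by
  have key : ∀ {a b : V → ℂ} (A B : Lp ℂ 2 (volume : Measure V)), A =ᵐ[volume] a →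
      B =ᵐ[volume] b → ∫ x, (inner ℝ (a x) (b x) : ℝ) = RCLike.re (inner ℂ A B) := by
    intro a b A B hA hB
    rw [L2.inner_def, ← integral_re (L2.integrable_inner A B)]
    refine integral_congr_ae ?_
    filter_upwards [hA, hB] with x hx hy
    rw [hx, hy]
    rfl
  rw [key _ _ (fourier_toLp_ae_eq hf1 hf2) (fourier_toLp_ae_eq hg1 hg2),
    key _ _ hf2.coeFn_toLp hg2.coeFn_toLp, Lp.inner_fourier_eq]

lemma eLpNorm_fourierInv {g : V → ℂ} (h1 : Integrable g) (h2 : MemLp g 2) :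
    eLpNorm (𝓕⁻ g) 2 volume = eLpNorm g 2 volume := by
  rw [← eLpNorm_fourier h1 h2, Real.fourierInv_eq_fourier_comp_neg]
  have h3 : MemLp (fun x => g (-x)) 2 :=
    h2.comp_measurePreserving (Measure.measurePreserving_neg _)
  rw [eLpNorm_fourier h1.comp_neg h3, eLpNorm_fourier h1 h2]
  exact eLpNorm_comp_measurePreserving h2.1 (Measure.measurePreserving_neg _)

end Plancherel

/-! ### The partial Fourier transform -/

/-- The Fourier transform in the position variable. -/
def FT (f : Phase n → ℂ) (p : Phase n) : ℂ := 𝓕 (fun x => f (x, p.2)) p.1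

section slices

variable {F : Type*} [NormedAddCommGroup F] {f : Phase n → F}

lemma CC.slice_left (hf : CC f) (y : Space n) :
    Continuous (fun x => f (x, y)) ∧ HasCompactSupport fun x => f (x, y) := by
  refine ⟨hf.1.comp (by fun_prop), ?_⟩
  refine HasCompactSupport.of_support_subset_isCompact
    (hf.2.isCompact.image continuous_fst) fun x hx => ?_
  exact ⟨(x, y), subset_tsupport _ hx, rfl⟩

lemma CC.slice_right (hf : CC f) (x : Space n) :
    Continuous (fun y => f (x, y)) ∧ HasCompactSupport fun y => f (x, y) := by
  refine ⟨hf.1.comp (by fun_prop), ?_⟩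
  refine HasCompactSupport.of_support_subset_isCompact
    (hf.2.isCompact.image continuous_snd) fun y hy => ?_
  exact ⟨(x, y), subset_tsupport _ hy, rfl⟩

end slices

variable {f g : Phase n → ℂ}

lemma CC.slice_integrable (hf : CC f) (y : Space n) : Integrable fun x => f (x, y) :=
  (hf.slice_left y).1.integrable_of_hasCompactSupport (hf.slice_left y).2

lemma CC.slice_memLp (hf : CC f) (y : Space n) : MemLp (fun x => f (x, y)) 2 :=
  (hf.slice_left y).1.memLp_of_hasCompactSupport (hf.slice_left y).2

lemma continuous_FT (hf : CC f) : Continuous (FT f) := by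
  set S : Set (Space n) := Prod.fst '' tsupport f with hS
  have hSc : IsCompact S := hf.2.isCompact.image continuous_fst
  have h0 : ∀ x y, x ∉ S → f (x, y) = 0 := fun x y hx => by
    by_contra hne
    exact hx ⟨(x, y), subset_tsupport _ hne, rfl⟩
  -- Restricting to the compact projection of the support makes this an integral over a fixed
  -- compact set of a jointly continuous integrand.
  have h1 : FT f = fun p => ∫ x in S, Real.fourierChar (-inner ℝ x p.1) • f (x, p.2) := by
    ext p
    rw [FT, Real.fourier_eq]
    refine (setIntegral_eq_integral_of_forall_compl_eq_zero fun x hx => ?_).symm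
    rw [h0 x _ hx, smul_zero]
  rw [h1]
  refine continuous_parametric_integral_of_continuous
    (f := fun (p : Phase n) x => Real.fourierChar (-inner ℝ x p.1) • f (x, p.2)) ?_ hSc
  have h2 : Continuous fun q : Phase n × Space n => f (q.2, q.1.2) := hf.1.comp (by fun_prop)
  have h3 : Continuous fun q : Phase n × Space n =>
      ((Real.fourierChar (-inner ℝ q.2 q.1.1) : Circle) : ℂ) :=
    continuous_subtype_val.comp (Real.continuous_fourierChar.comp (by fun_prop))
  exact h3.mul h2

lemma eLpNorm_two_sq {α : Type*} [MeasurableSpace α] (μ : Measure α) (h : α → ℂ) :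
    eLpNorm h 2 μ ^ 2 = ∫⁻ x, ‖h x‖ₑ ^ 2 ∂μ := by
  have := eLpNorm_nnreal_pow_eq_lintegral (μ := μ) (f := h) (p := 2) (by norm_num)
  simpa using this

lemma lintegral_phase_symm {h : Phase n → ℝ≥0∞} (hh : Measurable h) :
    ∫⁻ p, h p = ∫⁻ y, ∫⁻ x, h (x, y) :=
  lintegral_prod_symm (μ := (volume : Measure (Space n))) (ν := (volume : Measure (Space n)))
    h hh.aemeasurable

lemma lintegral_FT_sq (hf : CC f) : ∫⁻ p, ‖FT f p‖ₑ ^ 2 = ∫⁻ p, ‖f p‖ₑ ^ 2 := by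
  rw [lintegral_phase_symm ((continuous_FT hf).enorm.measurable.pow_const 2),
    lintegral_phase_symm (hf.1.enorm.measurable.pow_const 2)]
  congr 1; ext y
  have := eLpNorm_fourier (hf.slice_integrable y) (hf.slice_memLp y)
  rw [← eLpNorm_two_sq volume fun x => f (x, y), ← this, eLpNorm_two_sq]
  rfl

lemma eLpNorm_FT (hf : CC f) : eLpNorm (FT f) 2 volume = eLpNorm f 2 volume := by
  have h := lintegral_FT_sq hf
  rw [← eLpNorm_two_sq, ← eLpNorm_two_sq] at h
  exact (ENNReal.pow_right_strictMono (by norm_num)).injective h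

lemma sqInt_FT (hf : CC f) : SqInt (FT f) :=
  ⟨(continuous_FT hf).aestronglyMeasurable, by rw [eLpNorm_FT hf]; exact hf.sqInt.2⟩

lemma nrm_FT (hf : CC f) : nrm (FT f) = nrm f := by rw [nrm, eLpNorm_FT hf, nrm]

lemma SqInt.integrable_inner (hf : SqInt f) (hg : SqInt g) :
    Integrable fun p => (inner ℝ (f p) (g p) : ℝ) :=
  (hf.integrable_mul_norm hg).mono' (hf.1.inner hg.1)
    (ae_of_all _ fun _ => norm_inner_le_norm _ _)

lemma ip_FT (hf : CC f) (hg : CC g) : ip (FT f) (FT g) = ip f g := by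
  have e : ∀ {a b : Phase n → ℂ}, SqInt a → SqInt b →
      ip a b = ∫ y, ∫ x, (inner ℝ (a (x, y)) (b (x, y)) : ℝ) := fun ha hb =>
    integral_prod_symm (μ := (volume : Measure (Space n))) (ν := (volume : Measure (Space n)))
      _ (ha.integrable_inner hb)
  rw [e (sqInt_FT hf) (sqInt_FT hg), e hf.sqInt hg.sqInt]
  congr 1; ext y
  exact integral_inner_fourier (hf.slice_integrable y) (hf.slice_memLp y) (hg.slice_integrable y)
    (hg.slice_memLp y)

lemma FT_sub (hf : CC f) (hg : CC g) (p : Phase n) :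
    FT (fun q => f q - g q) p = FT f p - FT g p := by
  rw [FT, FT, FT, Real.fourier_eq, Real.fourier_eq, Real.fourier_eq, ← integral_sub]
  · congr 1; ext x; rw [smul_sub]
  · exact (Real.fourierIntegral_convergent_iff p.1).2 (hf.slice_integrable p.2)
  · exact (Real.fourierIntegral_convergent_iff p.1).2 (hg.slice_integrable p.2)

lemma FT_shift (f : Phase n → ℂ) (j : Fin n) (t : ℝ) (p : Phase n) :
    FT (fun q => f (q + t • ex j)) p
      = Complex.exp ((t * (2 * Real.pi * p.1 j) : ℝ) * Complex.I) * FT f p := by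
  have h := VectorFourier.fourierIntegral_comp_add_right Real.fourierChar
    (volume : Measure (Space n)) (innerₗ (Space n)) (fun x => f (x, p.2))
    (t • EuclideanSpace.single j (1 : ℝ))
  have h' := congrFun h p.1
  have e : ∀ x : Space n, f ((x, p.2) + t • ex j)
      = f (x + t • EuclideanSpace.single j (1 : ℝ), p.2) := fun x => by simp [ex]
  simp only [FT, e]
  refine h'.trans ?_
  rw [Circle.smul_def, Real.fourierChar_apply, smul_eq_mul]
  congr 2
  simp [EuclideanSpace.inner_single_left]
  ring

lemma fourier_fderiv_single {h : Space n → ℂ} (hh : ContDiff ℝ 1 h) (hc : HasCompactSupport h)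
    (j : Fin n) (ξ : Space n) :
    𝓕 (fun x => fderiv ℝ h x (EuclideanSpace.single j 1)) ξ
      = (2 * Real.pi * ξ j : ℝ) * Complex.I * 𝓕 h ξ := by
  have hd1 : Integrable (fderiv ℝ h) :=
    (hh.continuous_fderiv (by norm_num)).integrable_of_hasCompactSupport (hc.fderiv (𝕜 := ℝ))
  have h0 := Real.fourier_fderiv (hh.continuous.integrable_of_hasCompactSupport hc)
    (hh.differentiable (by norm_num)) hd1
  have h1 := congrArg (fun L => L (EuclideanSpace.single j (1 : ℝ))) (congrFun h0 ξ)
  rw [Real.fourier_continuousLinearMap_apply hd1] at h1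
  rw [h1]
  have e : innerSL ℝ ξ (EuclideanSpace.single j (1 : ℝ)) = ξ.ofLp j := by
    simp [innerSL_apply_apply, EuclideanSpace.inner_single_right]
  simp [VectorFourier.fourierSMulRight_apply, e]
  ring

lemma FT_dx (hf : Test f) (j : Fin n) (p : Phase n) :
    FT (dx j f) p = (2 * Real.pi * p.1 j : ℝ) * Complex.I * FT f p := by
  have hfd : ∀ x v, fderiv ℝ (fun x => f (x, p.2)) x v = fderiv ℝ f (x, p.2) (v, 0) := fun x v => by
    have h0 : HasFDerivAt (fun x => f (x, p.2)) ((fderiv ℝ f (x, p.2)).comp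
        (ContinuousLinearMap.inl ℝ (Space n) (Space n))) x :=
      (hf.differentiable (x, p.2)).hasFDerivAt.comp x (hasFDerivAt_prodMk_left x p.2)
    rw [h0.fderiv]
    rfl
  have h1 : ContDiff ℝ 1 fun x => f (x, p.2) := hf.contDiff.comp (contDiff_prodMk_left p.2)
  have h := fourier_fderiv_single (h := fun x => f (x, p.2)) h1 (hf.cc.slice_left p.2).2 j p.1
  simp only [hfd] at h
  exact h

end

noncomputable section

variable {n : ℕ}

/-! ### Dyadic differences -/

/-- The cube root of two, the dyadic ratio. -/
def crt : ℝ := 2 ^ (1 / 3 : ℝ)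

lemma crt_pos : 0 < crt := Real.rpow_pos_of_pos two_pos _

lemma crt_cube : crt ^ 3 = 2 := by
  rw [crt, ← Real.rpow_natCast, ← Real.rpow_mul zero_le_two]; norm_num

lemma le_crt : 5 / 4 ≤ crt := by
  by_contra h
  push Not at h
  have := pow_lt_pow_left₀ h crt_pos.le three_ne_zero
  rw [crt_cube] at this
  norm_num at this

lemma crt_le : crt ≤ 63 / 50 := by
  by_contra h
  push Not at h
  have := pow_lt_pow_left₀ h (by norm_num) three_ne_zero
  rw [crt_cube] at this
  norm_num at this

/-- The dyadic sum `∑_{k<M} 2^{k/3} min(ρ³ 2^{-k}, 2)`. -/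
def dyadicSum (M : ℕ) (ρ : ℝ) : ℝ := ∑ k ∈ Finset.range M, crt ^ k * min (ρ ^ 3 / 2 ^ k) 2

/-- As `crt` cubed is 2, dropping the term k = 0 reproduces the sum at ρ/`crt`. This self-similarity
drives both inductions below. -/
lemma dyadicSum_succ (M : ℕ) (ρ : ℝ) :
    dyadicSum (M + 1) ρ = min (ρ ^ 3) 2 + crt * dyadicSum M (ρ / crt) := by
  rw [dyadicSum, Finset.sum_range_succ', add_comm, dyadicSum, Finset.mul_sum]
  congr 1
  · simp
  · refine Finset.sum_congr rfl fun k _ => ?_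
    rw [div_pow, crt_cube, pow_succ crt k, pow_succ (2 : ℝ) k, div_div, mul_comm (2 : ℝ) (2 ^ k)]
    ring

/-- The bound for small ρ: the series is geometric with ratio `crt`⁻², and the constant 3 is stable
because 1 + 3/`crt`² ≤ 3. -/
lemma dyadicSum_le_cube (M : ℕ) : ∀ ρ : ℝ, 0 ≤ ρ → dyadicSum M ρ ≤ 3 * ρ ^ 3 := by
  induction M with
  | zero => intro ρ hρ; simp only [dyadicSum, Finset.range_zero, Finset.sum_empty]; positivity
  | succ M ih =>
    intro ρ hρ
    have hq := crt_pos
    have h1 := ih (ρ / crt) (by positivity)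
    have h2 : crt * (3 * (ρ / crt) ^ 3) = 3 / crt ^ 2 * ρ ^ 3 := by field_simp
    have h3 : 3 / crt ^ 2 ≤ 2 := by
      rw [div_le_iff₀ (by positivity)]; nlinarith [le_crt]
    rw [dyadicSum_succ]
    have h4 : 3 / crt ^ 2 * ρ ^ 3 ≤ 2 * ρ ^ 3 := by gcongr
    have h5 := mul_le_mul_of_nonneg_left h1 hq.le
    linarith [min_le_left (ρ ^ 3) 2]

/-- The term -8 makes the induction close: rescaling turns 16ρ - 8 into 16ρ - 8·`crt`, and the gain
8(`crt` - 1) ≥ 2 pays for the new term. For 1 ≤ ρ < `crt` the cubic bound is at most 6, below 16ρ -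
8. -/
lemma dyadicSum_le_affine (M : ℕ) : ∀ ρ : ℝ, 1 ≤ ρ → dyadicSum M ρ ≤ 16 * ρ - 8 := by
  induction M with
  | zero =>
    intro ρ hρ; simp only [dyadicSum, Finset.range_zero, Finset.sum_empty]; linarith
  | succ M ih =>
    intro ρ hρ
    have hq := crt_pos
    rcases le_or_gt crt ρ with h | h
    · have h1 := ih (ρ / crt) ((one_le_div hq).2 h)
      have h2 := mul_le_mul_of_nonneg_left h1 hq.le
      have h3 : crt * (16 * (ρ / crt) - 8) = 16 * ρ - 8 * crt := by field_simp
      rw [dyadicSum_succ]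
      linarith [min_le_right (ρ ^ 3) 2, le_crt]
    · have h1 := dyadicSum_le_cube (M + 1) ρ (by linarith)
      have h2 : ρ ^ 3 ≤ 2 := by rw [← crt_cube]; gcongr
      linarith

lemma dyadicSum_le (M : ℕ) {ρ : ℝ} (hρ : 0 ≤ ρ) : dyadicSum M ρ ≤ 16 * ρ := by
  rcases le_or_gt 1 ρ with h | h
  · linarith [dyadicSum_le_affine M ρ h]
  · have h1 := dyadicSum_le_cube M ρ hρ
    have h2 : ρ ^ 3 ≤ ρ := by
      calc ρ ^ 3 = ρ ^ 2 * ρ := by ring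
        _ ≤ 1 * ρ := by gcongr; exact pow_le_one₀ hρ h.le
        _ = ρ := one_mul ρ
    linarith

/-- The frequency variable `2π ξⱼ`. -/
def freq (j : Fin n) (p : Phase n) : ℝ := 2 * Real.pi * p.1 j

/-- The cube root of `|2π ξⱼ|`. -/
def rho (j : Fin n) (p : Phase n) : ℝ := |freq j p| ^ (1 / 3 : ℝ)

lemma continuous_freq (j : Fin n) : Continuous (freq j : Phase n → ℝ) := by
  unfold freq; fun_prop

lemma continuous_rho (j : Fin n) : Continuous (rho j : Phase n → ℝ) :=
  (continuous_freq j).abs.rpow_const fun _ => Or.inr (by norm_num)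

lemma rho_nonneg (j : Fin n) (p : Phase n) : 0 ≤ rho j p := Real.rpow_nonneg (abs_nonneg _) _

lemma rho_cube (j : Fin n) (p : Phase n) : rho j p ^ 3 = |freq j p| := by
  rw [rho, ← Real.rpow_natCast, ← Real.rpow_mul (abs_nonneg _)]; norm_num

/-- The symbol of the difference operator. -/
def symD (j : Fin n) (t : ℝ) (p : Phase n) : ℂ := Complex.exp ((t * freq j p : ℝ) * Complex.I) - 1

lemma norm_symD_le (j : Fin n) {t s : ℝ} (h : |t| ≤ s) (p : Phase n) :
    ‖symD j t p‖ ≤ min (s * |freq j p|) 2 := by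
  refine le_min ?_ ?_
  · have := Real.norm_exp_I_mul_ofReal_sub_one_le (x := t * freq j p)
    rw [mul_comm] at this
    refine this.trans ?_
    rw [Real.norm_eq_abs, abs_mul]
    gcongr
  · refine (norm_sub_le _ _).trans ?_
    rw [Complex.norm_exp_ofReal_mul_I]
    norm_num

/-- The difference operator in the direction `xⱼ`. -/
def diff (j : Fin n) (t : ℝ) (f : Phase n → ℂ) (p : Phase n) : ℂ := f (p + t • ex j) - f p

variable {f g : Phase n → ℂ}

lemma CC.diff (hf : CC f) (j : Fin n) (t : ℝ) : CC (diff j t f) := (hf.shift _).sub hf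

lemma Test.diff (hf : Test f) (j : Fin n) (t : ℝ) : Test (FokkerPlanck.diff j t f) :=
  (hf.shift _).sub hf

lemma FT_diff (hf : CC f) (j : Fin n) (t : ℝ) (p : Phase n) :
    FT (diff j t f) p = symD j t p * FT f p := by
  rw [show diff j t f = fun q => f (q + t • ex j) - f q from rfl, FT_sub (hf.shift _) hf,
    FT_shift, symD, sub_mul, one_mul, freq]

/-- The fractional derivative `|D_{xⱼ}|^{k/3}` on the Fourier side. -/
def frac (j : Fin n) (k : ℕ) (f : Phase n → ℂ) (p : Phase n) : ℂ := rho j p ^ k • FT f p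

lemma norm_frac (j : Fin n) (k : ℕ) (f : Phase n → ℂ) (p : Phase n) :
    ‖frac j k f p‖ = rho j p ^ k * ‖FT f p‖ := by
  rw [frac, norm_smul, Real.norm_of_nonneg (pow_nonneg (rho_nonneg j p) k)]

/-- For k ≤ 3 one has ρᵏ ≤ 1 + ρ³, and ρ³|FT f| is the modulus of the transform of ∂_{xⱼ}f. -/
lemma sqInt_frac (hf : Test f) (j : Fin n) {k : ℕ} (hk : k ≤ 3) : SqInt (frac j k f) := by
  have hc : Continuous (frac j k f) := ((continuous_rho j).pow k).smul (continuous_FT hf.cc)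
  refine ((sqInt_FT hf.cc).norm.add (sqInt_FT (hf.dx j).cc).norm).mono'
    hc.aestronglyMeasurable (ae_of_all _ fun p => ?_)
  have h1 : ‖FT (dx j f) p‖ = rho j p ^ 3 * ‖FT f p‖ := by
    rw [FT_dx hf, rho_cube, freq]; simp [abs_mul]
  have h0 := rho_nonneg j p
  rw [Pi.add_apply, h1, norm_frac, ← one_add_mul]
  gcongr
  rcases le_total (rho j p) 1 with h | h
  · linarith [pow_le_one₀ h0 h (n := k), pow_nonneg h0 3]
  · linarith [pow_le_pow_right₀ h hk]

/-- The majorant of `⟨g, (τ_t - 1) f⟩` for `|t| ≤ s`. -/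
def major (j : Fin n) (s : ℝ) (g f : Phase n → ℂ) : ℝ :=
  ∫ p, min (s * |freq j p|) 2 * (‖FT g p‖ * ‖FT f p‖)

lemma SqInt.integrable_bounded_mul {a b : Phase n → ℂ} (ha : SqInt a) (hb : SqInt b)
    {w : Phase n → ℝ} (hw : Continuous w) {C : ℝ} (hC : ∀ p, |w p| ≤ C) :
    Integrable fun p => w p * (‖a p‖ * ‖b p‖) :=
  (ha.integrable_mul_norm hb).bdd_mul hw.aestronglyMeasurable (c := C) (ae_of_all _ hC)

lemma integrable_major (hg : CC g) (hf : CC f) (j : Fin n) {s : ℝ} (hs : 0 ≤ s) :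
    Integrable fun p => min (s * |freq j p|) 2 * (‖FT g p‖ * ‖FT f p‖) := by
  refine (sqInt_FT hg).integrable_bounded_mul (sqInt_FT hf)
    ((continuous_const.mul (continuous_freq j).abs).min continuous_const) (C := 2) fun p => ?_
  rw [abs_of_nonneg (le_min (by positivity) zero_le_two)]
  exact min_le_right _ _

/-- The majorant depends on s alone, so one bound serves all translations of length at most s, of
either sign. -/
lemma abs_ip_diff_le (hg : CC g) (hf : CC f) (j : Fin n) {t s : ℝ} (h : |t| ≤ s) :
    |ip g (diff j t f)| ≤ major j s g f := by
  rw [← ip_FT hg (hf.diff j t)]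
  rw [ip, ← Real.norm_eq_abs]
  refine norm_integral_le_of_norm_le (integrable_major hg hf j ((abs_nonneg t).trans h))
    (ae_of_all _ fun p => ?_)
  rw [FT_diff hf]
  refine (norm_inner_le_norm _ _).trans ?_
  rw [norm_mul]
  calc ‖FT g p‖ * (‖symD j t p‖ * ‖FT f p‖) = ‖symD j t p‖ * (‖FT g p‖ * ‖FT f p‖) := by ring
    _ ≤ _ := by gcongr; exact norm_symD_le j h p

/-- Under the integral the sum over scales is `dyadicSum` at ρ, at most 16ρ: exactly one third of a
derivative, placed on f alone. -/
lemma sum_major_le (hg : CC g) (hf : Test f) (j : Fin n) (M : ℕ) :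
    ∑ k ∈ Finset.range M, crt ^ k * major j ((2 ^ k)⁻¹) g f
      ≤ 16 * (nrm g * nrm (frac j 1 f)) := by
  have hi := fun k : ℕ => (integrable_major hg hf.cc j
    (inv_nonneg.2 (pow_nonneg zero_le_two k) : (0 : ℝ) ≤ (2 ^ k)⁻¹)).const_mul (crt ^ k)
  have e : ∑ k ∈ Finset.range M, crt ^ k * major j ((2 ^ k)⁻¹) g f
      = ∫ p, dyadicSum M (rho j p) * (‖FT g p‖ * ‖FT f p‖) := by
    simp only [major, ← integral_const_mul]
    rw [← integral_finsetSum _ fun k _ => hi k]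
    congr 1; ext p
    rw [dyadicSum, Finset.sum_mul]
    refine Finset.sum_congr rfl fun k _ => ?_
    rw [rho_cube, div_eq_inv_mul]; ring
  rw [e, ← nrm_FT hg]
  refine (le_abs_self _).trans (abs_integral_le (sqInt_FT hg) (sqInt_frac hf j (by norm_num))
    (by norm_num) fun p => ?_)
  have h0 : 0 ≤ dyadicSum M (rho j p) := Finset.sum_nonneg fun k _ =>
    mul_nonneg (pow_nonneg crt_pos.le k)
      (le_min (div_nonneg (pow_nonneg (rho_nonneg j p) 3) (by positivity)) zero_le_two)
  rw [abs_of_nonneg (mul_nonneg h0 (by positivity)), norm_frac, pow_one]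
  calc _ ≤ (16 * rho j p) * (‖FT g p‖ * ‖FT f p‖) := by
        gcongr; exact dyadicSum_le M (rho_nonneg j p)
    _ = _ := by ring

/-- With a difference on each side the multipliers are squares of the terms of `dyadicSum`; their
sum is at most the square of the sum, (16ρ)² = 256ρ². Both thirds of a derivative go onto f, so g
needs no regularity. -/
lemma sum_ip_diff_diff_le (hg : CC g) (hf : Test f) (j : Fin n) (M : ℕ) :
    ∑ k ∈ Finset.range M, crt ^ (2 * k) * |ip (diff j ((2 ^ k)⁻¹) g) (diff j ((2 ^ k)⁻¹) f)|
      ≤ 256 * (nrm g * nrm (frac j 2 f)) := by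
  have h2k : ∀ k : ℕ, (0 : ℝ) < (2 ^ k)⁻¹ := fun k => by positivity
  let w : ℕ → Phase n → ℝ := fun k p => (crt ^ k * min ((2 ^ k)⁻¹ * |freq j p|) 2) ^ 2
  have hw : ∀ k, Continuous (w k) := fun k =>
    (continuous_const.mul ((continuous_const.mul (continuous_freq j).abs).min continuous_const)).pow 2
  have hwb : ∀ k p, |w k p| ≤ (crt ^ k * 2) ^ 2 := fun k p => by
    have hc := pow_nonneg crt_pos.le k
    have h0 : 0 ≤ min ((2 ^ k)⁻¹ * |freq j p|) 2 :=
      le_min (mul_nonneg (h2k k).le (abs_nonneg _)) zero_le_two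
    simp only [w]
    rw [abs_of_nonneg (sq_nonneg _)]
    gcongr
    exact min_le_right _ _
  have hi : ∀ k, Integrable fun p => w k p * (‖FT g p‖ * ‖FT f p‖) := fun k =>
    (sqInt_FT hg).integrable_bounded_mul (sqInt_FT hf.cc) (hw k) (hwb k)
  have h1 : ∀ k, crt ^ (2 * k) * |ip (diff j ((2 ^ k)⁻¹) g) (diff j ((2 ^ k)⁻¹) f)|
      ≤ ∫ p, w k p * (‖FT g p‖ * ‖FT f p‖) := by
    intro k
    have hc := pow_nonneg crt_pos.le (2 * k)
    rw [← ip_FT (hg.diff j _) (hf.cc.diff j _), ← abs_of_nonneg hc, ← abs_mul, ip,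
      ← integral_const_mul]
    rw [← Real.norm_eq_abs]
    refine norm_integral_le_of_norm_le (hi k) (ae_of_all _ fun p => ?_)
    rw [FT_diff hg, FT_diff hf.cc, norm_mul, Real.norm_of_nonneg hc]
    have h3 := norm_symD_le j (abs_of_pos (h2k k)).le p
    calc _ ≤ crt ^ (2 * k) * (‖symD j (2 ^ k)⁻¹ p * FT g p‖ * ‖symD j (2 ^ k)⁻¹ p * FT f p‖) := by
          gcongr; exact norm_inner_le_norm _ _
      _ = (crt ^ k * ‖symD j (2 ^ k)⁻¹ p‖) ^ 2 * (‖FT g p‖ * ‖FT f p‖) := by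
          rw [norm_mul, norm_mul]; ring
      _ ≤ _ := by
          have hc' := pow_nonneg crt_pos.le k
          simp only [w]
          gcongr
  refine (Finset.sum_le_sum fun k _ => h1 k).trans ?_
  rw [← integral_finsetSum _ fun k _ => hi k, ← nrm_FT hg]
  refine (le_abs_self _).trans (abs_integral_le (sqInt_FT hg) (sqInt_frac hf j (by norm_num))
    (by norm_num) fun p => ?_)
  have hr := rho_nonneg j p
  have hs : ∑ k ∈ Finset.range M, w k p ≤ (16 * rho j p) ^ 2 := by
    have e : dyadicSum M (rho j p)
        = ∑ k ∈ Finset.range M, crt ^ k * min ((2 ^ k)⁻¹ * |freq j p|) 2 := by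
      simp only [dyadicSum, rho_cube, div_eq_inv_mul]
    have hnn : ∀ k ∈ Finset.range M, 0 ≤ crt ^ k * min ((2 ^ k)⁻¹ * |freq j p|) 2 := fun k _ =>
      mul_nonneg (pow_nonneg crt_pos.le k)
        (le_min (mul_nonneg (h2k k).le (abs_nonneg _)) zero_le_two)
    calc _ ≤ (∑ k ∈ Finset.range M, crt ^ k * min ((2 ^ k)⁻¹ * |freq j p|) 2) ^ 2 :=
          Finset.sum_sq_le_sq_sum_of_nonneg hnn
      _ ≤ _ := by
          rw [← e]
          exact pow_le_pow_left₀ (by rw [e]; exact Finset.sum_nonneg hnn) (dyadicSum_le M hr) 2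
  have h0 : 0 ≤ ∑ k ∈ Finset.range M, w k p := Finset.sum_nonneg fun k _ => sq_nonneg _
  rw [← Finset.sum_mul, abs_of_nonneg (mul_nonneg h0 (by positivity)), norm_frac]
  calc _ ≤ (16 * rho j p) ^ 2 * (‖FT g p‖ * ‖FT f p‖) := by gcongr
    _ = _ := by ring

lemma norm_symD_sq (j : Fin n) (t : ℝ) (p : Phase n) :
    ‖symD j t p‖ ^ 2 = 2 - 2 * Real.cos (t * freq j p) := by
  rw [symD, Complex.exp_mul_I, ← Complex.ofReal_cos, ← Complex.ofReal_sin,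
    ← Complex.normSq_eq_norm_sq, Complex.normSq_apply]
  simp only [Complex.sub_re, Complex.add_re, Complex.ofReal_re, Complex.mul_re, Complex.I_re,
    Complex.ofReal_im, Complex.I_im, Complex.one_re, Complex.sub_im, Complex.add_im,
    Complex.mul_im, Complex.one_im]
  nlinarith [Real.sin_sq_add_cos_sq (t * freq j p)]

/-- Each high frequency is seen by one scale: if 2ᵏ ≤ |2πξⱼ| < 2ᵏ⁺¹, the phase of the step 2⁻ᵏ has
modulus between 1 and 2, and |e^{iθ} - 1|² = 2 - 2cos θ ≥ 1/2. The 8 is 2 from this bound times 4,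
which dominates `crt`^{2r}. -/
lemma exists_rho_le (j : Fin n) (r : ℕ) (hr : r ≤ 2) (p : Phase n) (h : 1 ≤ rho j p) :
    ∃ k : ℕ, (rho j p ^ r) ^ 2 ≤ 8 * (crt ^ (r * k)) ^ 2 * ‖symD j ((2 ^ k)⁻¹) p‖ ^ 2 := by
  have h1 : 1 ≤ |freq j p| := by rw [← rho_cube]; exact one_le_pow₀ h
  obtain ⟨k, hk1, hk2⟩ := exists_nat_pow_near h1 one_lt_two
  have hq := crt_pos
  have h2k : (0 : ℝ) < 2 ^ k := by positivity
  refine ⟨k, ?_⟩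
  have e1 : 1 / 2 ≤ ‖symD j ((2 ^ k)⁻¹) p‖ ^ 2 := by
    rw [norm_symD_sq]
    have e : Real.cos ((2 ^ k)⁻¹ * freq j p) = Real.cos (|freq j p| / 2 ^ k) := by
      rw [← Real.cos_abs, abs_mul, abs_of_pos (inv_pos.2 h2k), div_eq_inv_mul]
    have e2 : 1 ≤ |freq j p| / 2 ^ k := (one_le_div h2k).2 hk1
    have e3 : |freq j p| / 2 ^ k ≤ 2 := by
      rw [div_le_iff₀ h2k]; rw [pow_succ] at hk2; linarith
    have e4 := Real.cos_le_cos_of_nonneg_of_le_pi zero_le_one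
      (e3.trans (by linarith [Real.pi_gt_three])) e2
    have e5 := Real.cos_one_le
    rw [e]
    linarith
  have e2 : rho j p ≤ crt * crt ^ k := by
    by_contra hlt
    push Not at hlt
    have := pow_lt_pow_left₀ hlt (by positivity) three_ne_zero
    rw [rho_cube, mul_pow, crt_cube, ← pow_mul, mul_comm k 3, pow_mul, crt_cube] at this
    rw [pow_succ] at hk2
    linarith
  have e3 : (rho j p ^ r) ^ 2 ≤ 4 * (crt ^ (r * k)) ^ 2 := by
    have hr0 := rho_nonneg j p
    have h4 : (crt ^ r) ^ 2 ≤ 4 := by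
      have h5 : crt ^ r ≤ crt ^ 2 := pow_le_pow_right₀ (by linarith [le_crt]) hr
      have h6 : crt ^ 2 ≤ 2 := by nlinarith [crt_le]
      have h7 : 0 ≤ crt ^ r := by positivity
      nlinarith
    calc (rho j p ^ r) ^ 2 ≤ ((crt * crt ^ k) ^ r) ^ 2 := by gcongr
      _ = (crt ^ r) ^ 2 * (crt ^ (r * k)) ^ 2 := by rw [mul_comm r k, pow_mul]; ring
      _ ≤ _ := by gcongr
  have h8 : 0 ≤ (crt ^ (r * k)) ^ 2 := by positivity
  calc (rho j p ^ r) ^ 2 ≤ 8 * (crt ^ (r * k)) ^ 2 * (1 / 2) := by linarith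
    _ ≤ _ := by gcongr

lemma SqInt.lintegral_sq (hf : SqInt f) :
    ∫⁻ p, ENNReal.ofReal (‖f p‖ ^ 2) = ENNReal.ofReal (nrm f ^ 2) := by
  rw [hf.nrm_sq, ofReal_integral_eq_lintegral_ofReal hf.integrable_sq
    (ae_of_all _ fun p => by positivity)]

/-- Differences control fractional derivatives. Where ρ ≤ 1, ‖f‖ suffices; elsewhere the single
scale of `exists_rho_le` is bounded by the sum over all scales. Working in [0, ∞] avoids any
convergence question. -/
lemma nrm_frac_sq_le (hf : Test f) (j : Fin n) {r : ℕ} (hr : r ≤ 2) {S : ℝ}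
    (hS : ∀ M : ℕ, ∑ k ∈ Finset.range M, crt ^ (2 * r * k) * nrm (diff j ((2 ^ k)⁻¹) f) ^ 2 ≤ S) :
    nrm (frac j r f) ^ 2 ≤ nrm f ^ 2 + 8 * S := by
  have hS0 : 0 ≤ S := by simpa using hS 0
  let T : ℕ → Phase n → ℝ := fun k p =>
    8 * crt ^ (2 * r * k) * ‖FT (diff j ((2 ^ k)⁻¹) f) p‖ ^ 2
  have hTm : ∀ k, Measurable fun p => ENNReal.ofReal (T k p) := fun k =>
    (((continuous_FT (hf.cc.diff j _)).norm.pow 2).const_mul _).measurable.ennreal_ofReal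
  have hpt : ∀ p, ENNReal.ofReal (‖frac j r f p‖ ^ 2)
      ≤ ENNReal.ofReal (‖FT f p‖ ^ 2) + ∑' k, ENNReal.ofReal (T k p) := by
    intro p
    rw [norm_frac, mul_pow]
    rcases le_total (rho j p) 1 with h | h
    · refine le_add_right (ENNReal.ofReal_le_ofReal ?_)
      have := pow_le_one₀ (pow_nonneg (rho_nonneg j p) r) (pow_le_one₀ (rho_nonneg j p) h (n := r))
        (n := 2)
      exact mul_le_of_le_one_left (by positivity) this
    · obtain ⟨k, hk⟩ := exists_rho_le j r hr p h
      refine le_add_left (le_trans (ENNReal.ofReal_le_ofReal ?_) (ENNReal.le_tsum k))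
      simp only [T]
      rw [FT_diff hf.cc, norm_mul]
      calc _ ≤ (8 * (crt ^ (r * k)) ^ 2 * ‖symD j ((2 ^ k)⁻¹) p‖ ^ 2) * ‖FT f p‖ ^ 2 := by gcongr
        _ = _ := by rw [← pow_mul, mul_assoc 2 r k, mul_comm 2 (r * k)]; ring
  have hint : ∀ k, ∫⁻ p, ENNReal.ofReal (T k p)
      = ENNReal.ofReal (8 * (crt ^ (2 * r * k) * nrm (diff j ((2 ^ k)⁻¹) f) ^ 2)) := by
    intro k
    have hc : 0 ≤ 8 * crt ^ (2 * r * k) := mul_nonneg (by norm_num) (pow_nonneg crt_pos.le _)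
    simp only [T]
    rw [← mul_assoc, ENNReal.ofReal_mul hc, ← nrm_FT (hf.cc.diff j _),
      ← (sqInt_FT (hf.cc.diff j _)).lintegral_sq, ← lintegral_const_mul' _ _ ENNReal.ofReal_ne_top]
    congr 1; ext p
    rw [ENNReal.ofReal_mul hc]
  have hsum : ∑' k, ENNReal.ofReal (8 * (crt ^ (2 * r * k) * nrm (diff j ((2 ^ k)⁻¹) f) ^ 2))
      ≤ ENNReal.ofReal (8 * S) := by
    refine ENNReal.tsum_le_of_sum_range_le fun M => ?_
    rw [← ENNReal.ofReal_sum_of_nonneg fun k _ =>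
      mul_nonneg (by norm_num) (mul_nonneg (pow_nonneg crt_pos.le _) (sq_nonneg _))]
    refine ENNReal.ofReal_le_ofReal ?_
    rw [← Finset.mul_sum]
    linarith [hS M]
  have hmain : ENNReal.ofReal (nrm (frac j r f) ^ 2)
      ≤ ENNReal.ofReal (nrm f ^ 2) + ENNReal.ofReal (8 * S) := by
    rw [← (sqInt_frac hf j (hr.trans (by norm_num))).lintegral_sq, ← nrm_FT hf.cc,
      ← (sqInt_FT hf.cc).lintegral_sq]
    refine (lintegral_mono hpt).trans ?_
    have hm : Measurable fun p => ENNReal.ofReal (‖FT f p‖ ^ 2) :=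
      ((continuous_FT hf.cc).norm.pow 2).measurable.ennreal_ofReal
    rw [lintegral_add_left hm,
      lintegral_tsum fun k => (hTm k).aemeasurable]
    gcongr
    simpa only [hint] using hsum
  rw [← ENNReal.ofReal_add (by positivity) (by positivity)] at hmain
  exact (ENNReal.ofReal_le_ofReal_iff (by positivity)).1 hmain

/-- The symbol of ∂_{xⱼ} has modulus ρ³, divided between the factors as ρ²·ρ. -/
lemma abs_ip_dx_le (hf : Test f) (hg : Test g) (j : Fin n) :
    |ip (dx j f) g| ≤ nrm (frac j 2 f) * nrm (frac j 1 g) := by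
  rw [← ip_FT (hf.dx j).cc hg.cc, ← one_mul (nrm (frac j 2 f) * _)]
  refine abs_integral_le (sqInt_frac hf j (by norm_num)) (sqInt_frac hg j (by norm_num))
    zero_le_one fun p => ?_
  have h1 : ‖FT (dx j f) p‖ = rho j p ^ 3 * ‖FT f p‖ := by
    rw [FT_dx hf, rho_cube, freq]; simp [abs_mul]
  refine (abs_real_inner_le_norm _ _).trans_eq ?_
  rw [h1, norm_frac, norm_frac]
  ring

end

noncomputable section

variable {n : ℕ} {f g : Phase n → ℂ}

/-! ### The fractional operators of the statement -/

lemma bracket_sq {E : Type*} [NormedAddCommGroup E] (a : E) : bracket a ^ 2 = 1 + ‖a‖ ^ 2 :=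
  Real.sq_sqrt (by positivity)

lemma one_le_bracket {E : Type*} [NormedAddCommGroup E] (a : E) : 1 ≤ bracket a :=
  Real.one_le_sqrt.2 (by linarith [sq_nonneg ‖a‖])

lemma contDiff_slice_left {k : WithTop ℕ∞} (hf : ContDiff ℝ k f) (y : Space n) :
    ContDiff ℝ k fun x => f (x, y) := hf.comp (contDiff_prodMk_left y)

lemma contDiff_slice_right {k : WithTop ℕ∞} (hf : ContDiff ℝ k f) (x : Space n) :
    ContDiff ℝ k fun y => f (x, y) := hf.comp (contDiff_prodMk_right x)

lemma fourier_dy_slice (hf : Test f) (j : Fin n) (x η : Space n) :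
    𝓕 (fun y => dy j f (x, y)) η = (2 * Real.pi * η j : ℝ) * Complex.I * 𝓕 (fun y => f (x, y)) η := by
  have hfd : ∀ y v, fderiv ℝ (fun y => f (x, y)) y v = fderiv ℝ f (x, y) (0, v) := fun y v => by
    have h0 : HasFDerivAt (fun y => f (x, y)) ((fderiv ℝ f (x, y)).comp
        (ContinuousLinearMap.inr ℝ (Space n) (Space n))) y :=
      (hf.differentiable (x, y)).hasFDerivAt.comp y (hasFDerivAt_prodMk_right x y)
    rw [h0.fderiv]
    rfl
  have h := fourier_fderiv_single (h := fun y => f (x, y)) (contDiff_slice_right hf.contDiff x) (hf.cc.slice_right x).2 j η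
  simp only [hfd] at h
  exact h

lemma norm_two_pi_smul_sq (ξ : Space n) :
    ‖(2 * Real.pi) • ξ‖ ^ 2 = ∑ j, (2 * Real.pi * ξ j) ^ 2 := by
  rw [EuclideanSpace.norm_sq_eq]
  simp only [PiLp.smul_apply, smul_eq_mul, Real.norm_eq_abs, sq_abs]

lemma test_laplaceY (hf : Test f) : Test (laplaceY f) :=
  ⟨ContDiff.sum fun j _ => ((hf.dy j).dy j).1, (Coeffs.cc_laplaceY hf).2⟩

lemma bracketDy_two (hf : Test f) (p : Phase n) : bracketDy 2 f p = f p - laplaceY f p := by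
  have hT : Test fun p => f p - laplaceY f p := hf.sub (test_laplaceY hf)
  have hF : ∀ {h : Phase n → ℂ}, Test h → Integrable fun y => h (p.1, y) := fun hh =>
    (hh.cc.slice_right p.1).1.integrable_of_hasCompactSupport (hh.cc.slice_right p.1).2
  have h1 : 𝓕 (fun y => f (p.1, y) - laplaceY f (p.1, y)) = fun η =>
      ((bracket ((2 * Real.pi) • η) ^ (2 : ℝ) : ℝ) : ℂ) * 𝓕 (fun y => f (p.1, y)) η := by
    ext η
    have e1 : 𝓕 (fun y => f (p.1, y) - laplaceY f (p.1, y)) η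
        = 𝓕 (fun y => f (p.1, y)) η - ∑ j, 𝓕 (fun y => dy j (dy j f) (p.1, y)) η := by
      simp only [Real.fourier_eq]
      rw [← integral_finsetSum, ← integral_sub]
      · congr 1; ext y
        rw [smul_sub, laplaceY, Finset.smul_sum]
      · exact (Real.fourierIntegral_convergent_iff η).2 (hF hf)
      · exact integrable_finsetSum _ fun j _ =>
          (Real.fourierIntegral_convergent_iff η).2 (hF ((hf.dy j).dy j))
      · exact fun j _ => (Real.fourierIntegral_convergent_iff η).2 (hF ((hf.dy j).dy j))
    rw [e1, show (2 : ℝ) = ((2 : ℕ) : ℝ) by norm_num, Real.rpow_natCast]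
    push_cast
    rw [← Complex.ofReal_pow, bracket_sq, norm_two_pi_smul_sq]
    simp only [fourier_dy_slice (hf.dy _), fourier_dy_slice hf]
    push_cast
    rw [add_mul, one_mul, sub_eq_add_neg, ← Finset.sum_neg_distrib, Finset.sum_mul]
    congr 1
    refine Finset.sum_congr rfl fun j _ => ?_
    linear_combination (-(2 * (Real.pi : ℂ) * (η j : ℂ)) ^ 2 * 𝓕 (fun y => f (p.1, y)) η)
      * Complex.I_sq
  -- Fourier inversion needs an integrable transform; the slice is a test function, hence Schwartz.
  have hint : Integrable (𝓕 fun y => f (p.1, y) - laplaceY f (p.1, y)) := by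
    let ψ := (hT.cc.slice_right p.1).2.toSchwartzMap (contDiff_slice_right hT.1 p.1)
    have : 𝓕 (fun y => f (p.1, y) - laplaceY f (p.1, y)) = (𝓕 ψ : SchwartzMap (Space n) ℂ) := by
      rw [SchwartzMap.fourier_coe]; rfl
    rw [this]
    exact (𝓕 ψ).integrable
  have h2 := (hT.cc.slice_right p.1).1.fourierInv_fourier_eq (hF hT) hint
  rw [bracketDy, bracketD, ← h1, h2]

/-- The Fourier symbol of `⟨D_x⟩^{2/3}` applied to `f`. -/
def symDx (f : Phase n → ℂ) (p : Phase n) : ℂ :=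
  ((bracket ((2 * Real.pi) • p.1) ^ (2 / 3 : ℝ) : ℝ) : ℂ) * FT f p

/-- With S the right-hand side, 1 ≤ S² and ρⱼ⁶ ≤ ρⱼ²S², so 1 + ∑ρⱼ⁶ ≤ S²(1 + ∑ρⱼ²) = S³. The
left-hand side is the cube root of 1 + ∑ρⱼ⁶. -/
lemma bracket_rpow_le (p : Phase n) :
    bracket ((2 * Real.pi) • p.1) ^ (2 / 3 : ℝ) ≤ 1 + ∑ j, rho j p ^ 2 := by
  set S := 1 + ∑ j, rho j p ^ 2 with hS
  have hS1 : 1 ≤ S := by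
    have : 0 ≤ ∑ j, rho j p ^ 2 := Finset.sum_nonneg fun j _ => sq_nonneg _
    linarith
  have hb : 0 ≤ bracket ((2 * Real.pi) • p.1) := zero_le_one.trans (one_le_bracket _)
  have h1 : bracket ((2 * Real.pi) • p.1) ^ 2 ≤ S ^ 3 := by
    rw [bracket_sq, norm_two_pi_smul_sq]
    have h2 : ∀ j, (2 * Real.pi * p.1 j) ^ 2 ≤ rho j p ^ 2 * S ^ 2 := fun j => by
      have h3 : (2 * Real.pi * p.1 j) ^ 2 = rho j p ^ 2 * (rho j p ^ 2) ^ 2 := by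
        rw [show 2 * Real.pi * p.1 j = freq j p from rfl, ← sq_abs, ← rho_cube]; ring
      have h4 : rho j p ^ 2 ≤ S := by
        have := Finset.single_le_sum (f := fun j => rho j p ^ 2) (fun i _ => sq_nonneg _)
          (Finset.mem_univ j)
        linarith
      rw [h3]
      gcongr
    calc 1 + ∑ j, (2 * Real.pi * p.1 j) ^ 2 ≤ S ^ 2 + ∑ j, rho j p ^ 2 * S ^ 2 := by
          gcongr with j
          exacts [one_le_pow₀ hS1, h2 j]
      _ = S ^ 3 := by rw [← Finset.sum_mul, hS]; ring
  have hS0 : 0 ≤ S := by linarith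
  calc bracket ((2 * Real.pi) • p.1) ^ (2 / 3 : ℝ)
      = (bracket ((2 * Real.pi) • p.1) ^ 2) ^ (1 / 3 : ℝ) := by
        rw [← Real.rpow_natCast, ← Real.rpow_mul hb]; norm_num
    _ ≤ (S ^ 3) ^ (1 / 3 : ℝ) := by gcongr
    _ = S := by rw [← Real.rpow_natCast, ← Real.rpow_mul hS0]; norm_num

lemma continuous_symDx (hf : CC f) : Continuous (symDx f) := by
  refine (Complex.continuous_ofReal.comp ?_).mul (continuous_FT hf)
  unfold bracket
  exact (Continuous.rpow_const (by fun_prop) fun _ => Or.inr (by norm_num))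

lemma nrm_symDx_le (hf : Test f) :
    SqInt (symDx f) ∧ nrm (symDx f) ≤ nrm f + ∑ j, nrm (frac j 2 f) := by
  let h : Phase n → ℂ := fun p => ((‖FT f p‖ : ℝ) : ℂ) + ∑ j, ((‖frac j 2 f p‖ : ℝ) : ℂ)
  have h1 : ∀ {a : Phase n → ℂ}, SqInt a → SqInt fun p => ((‖a p‖ : ℝ) : ℂ) := fun ha =>
    ha.norm.ofReal
  have h2 : ∀ j, SqInt fun p => ((‖frac j 2 f p‖ : ℝ) : ℂ) := fun j =>
    h1 (sqInt_frac hf j (by norm_num))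
  have h3 : SqInt h := (h1 (sqInt_FT hf.cc)).add (memLp_finsetSum _ fun j _ => h2 j)
  have h4 : ∀ p, ‖symDx f p‖ ≤ ‖h p‖ := by
    intro p
    have e : h p = ((‖FT f p‖ + ∑ j, ‖frac j 2 f p‖ : ℝ) : ℂ) := by simp [h]
    have e0 : 0 ≤ bracket ((2 * Real.pi) • p.1) ^ (2 / 3 : ℝ) :=
      Real.rpow_nonneg (zero_le_one.trans (one_le_bracket _)) _
    rw [e, Complex.norm_real, Real.norm_of_nonneg (by positivity), symDx, norm_mul,
      Complex.norm_real, Real.norm_of_nonneg e0]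
    simp only [norm_frac]
    calc _ ≤ (1 + ∑ j, rho j p ^ 2) * ‖FT f p‖ := by gcongr; exact bracket_rpow_le p
      _ = _ := by rw [add_mul, one_mul, Finset.sum_mul]
  have h5 : ∀ a : Phase n → ℂ, nrm (fun p => ((‖a p‖ : ℝ) : ℂ)) = nrm a := fun a =>
    nrm_congr_norm fun p => by simp
  refine ⟨h3.mono (continuous_symDx hf.cc).aestronglyMeasurable (ae_of_all _ h4),
    (nrm_mono h3 h4).trans ?_⟩
  refine (nrm_add_le (h1 (sqInt_FT hf.cc)) (memLp_finsetSum _ fun j _ => h2 j)).trans ?_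
  rw [h5, nrm_FT hf.cc]
  gcongr
  refine (nrm_sum_le _ h2).trans_eq ?_
  simp only [h5]

/-- On a slice the symbol is dominated by ⟨2πξ⟩² times a Schwartz function, which is again Schwartz.
-/
lemma symDx_slice (hf : Test f) (y : Space n) :
    Integrable (fun ξ => symDx f (ξ, y)) ∧ MemLp (fun ξ => symDx f (ξ, y)) 2 := by
  let ψ := (hf.cc.slice_left y).2.toSchwartzMap (contDiff_slice_left hf.1 y)
  have hψ : ∀ ξ, FT f (ξ, y) = (𝓕 ψ) ξ := fun ξ => by
    rw [SchwartzMap.fourier_coe]; rfl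
  let w : Space n → ℝ := fun ξ => 1 + ‖(2 * Real.pi) • ξ‖ ^ 2
  have hw : w.HasTemperateGrowth := by
    have : w = fun ξ : Space n => 1 + (2 * Real.pi) ^ 2 * ‖ξ‖ ^ 2 := by
      ext ξ; simp only [w]; rw [norm_smul, mul_pow, Real.norm_eq_abs, sq_abs]
    rw [this]
    fun_prop
  let Φ : SchwartzMap (Space n) ℂ := SchwartzMap.smulLeftCLM ℂ w (𝓕 ψ)
  have hΦ : ∀ ξ, Φ ξ = w ξ • (𝓕 ψ) ξ := fun ξ => SchwartzMap.smulLeftCLM_apply_apply hw _ _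
  have hc : Continuous fun ξ => symDx f (ξ, y) := (continuous_symDx hf.cc).comp (by fun_prop)
  have hle : ∀ ξ, ‖symDx f (ξ, y)‖ ≤ ‖Φ ξ‖ := by
    intro ξ
    have e1 := one_le_bracket ((2 * Real.pi) • ξ)
    have e2 : bracket ((2 * Real.pi) • ξ) ^ (2 / 3 : ℝ) ≤ w ξ := by
      simp only [w]
      rw [← bracket_sq, ← Real.rpow_natCast]
      exact Real.rpow_le_rpow_of_exponent_le e1 (by norm_num)
    have e3 : 0 ≤ bracket ((2 * Real.pi) • ξ) ^ (2 / 3 : ℝ) := by positivity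
    rw [hΦ, symDx, hψ, norm_mul, norm_smul, Complex.norm_real, Real.norm_of_nonneg e3,
      Real.norm_of_nonneg (e3.trans e2)]
    gcongr
  exact ⟨Φ.integrable.mono hc.aestronglyMeasurable (ae_of_all _ hle),
    (Φ.memLp 2).mono hc.aestronglyMeasurable (ae_of_all _ hle)⟩

lemma normL2_bracketDx_le (hf : Test f) :
    normL2 (bracketDx (2 / 3) f) ≤ ENNReal.ofReal (nrm f + ∑ j, nrm (frac j 2 f)) := by
  obtain ⟨h1, h2⟩ := nrm_symDx_le hf
  refine le_trans ?_ (ENNReal.ofReal_le_ofReal h2)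
  rw [← h1.normL2_eq, normL2, normL2,
    ← (ENNReal.pow_right_strictMono (n := 2) (by norm_num)).le_iff_le]
  rw [eLpNorm_two_sq, eLpNorm_two_sq,
    lintegral_phase_symm ((continuous_symDx hf.cc).enorm.measurable.pow_const 2)]
  have e1 : ∫⁻ p : Phase n, ‖bracketDx (2 / 3) f p‖ₑ ^ 2
      = ∫⁻ p : Phase n, ‖bracketDx (2 / 3) f p.swap‖ₑ ^ 2 :=
    (lintegral_prod_swap (μ := (volume : Measure (Space n))) (ν := (volume : Measure (Space n)))
      fun p => ‖bracketDx (2 / 3) f p‖ₑ ^ 2).symm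
  rw [e1]
  -- Only an upper bound is wanted, so joint measurability of `bracketDx` is not required;
  -- Plancherel is then applied slice by slice.
  refine (lintegral_prod_le (μ := (volume : Measure (Space n)))
    (ν := (volume : Measure (Space n))) _).trans_eq ?_
  congr 1; ext y
  obtain ⟨i1, i2⟩ := symDx_slice hf y
  have := eLpNorm_fourierInv i1 i2
  rw [← eLpNorm_two_sq volume fun ξ => symDx f (ξ, y), ← this, eLpNorm_two_sq]
  rfl

end

noncomputable section

variable {n : ℕ} {f g h : Phase n → ℂ}

/-! ### Bilinearity of the inner product -/

lemma ip_add_left (hf : CC f) (hg : CC g) (hh : CC h) :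
    ip (fun p => f p + g p) h = ip f h + ip g h := by
  simp only [ip, inner_add_left]
  exact integral_add (hf.inner hh.1).integrable (hg.inner hh.1).integrable

lemma ip_sub_left (hf : CC f) (hg : CC g) (hh : CC h) :
    ip (fun p => f p - g p) h = ip f h - ip g h := by
  simp only [ip, inner_sub_left]
  exact integral_sub (hf.inner hh.1).integrable (hg.inner hh.1).integrable

lemma ip_sub_right (hf : CC f) (hg : CC g) (hh : CC h) :
    ip h (fun p => f p - g p) = ip h f - ip h g := by
  simp only [ip, inner_sub_right]
  exact integral_sub (hh.inner hf.1).integrable (hh.inner hg.1).integrable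

lemma ip_sum_left {ι : Type*} (s : Finset ι) {f : ι → Phase n → ℂ} (hf : ∀ i, CC (f i))
    (hh : CC h) : ip (fun p => ∑ i ∈ s, f i p) h = ∑ i ∈ s, ip (f i) h := by
  simp only [ip, sum_inner]
  exact integral_finsetSum _ fun i _ => ((hf i).inner hh.1).integrable

lemma ip_sum_right {ι : Type*} (s : Finset ι) {f : ι → Phase n → ℂ} (hf : ∀ i, CC (f i))
    (hh : CC h) : ip h (fun p => ∑ i ∈ s, f i p) = ∑ i ∈ s, ip h (f i) := by
  simp only [ip, inner_sum]
  exact integral_finsetSum _ fun i _ => (hh.inner (hf i).1).integrable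

lemma ip_shift_left (f g : Phase n → ℂ) (v : Phase n) :
    ip (fun p => f (p + v)) g = ip f (fun p => g (p + -v)) := by
  rw [ip, ip, ← integral_shift (fun p => inner ℝ (f p) (g (p + -v))) v]
  simp

lemma ip_dx_right (hf : Test f) (hg : Test g) (j : Fin n) : ip f (dx j g) = -ip (dx j f) g :=
  ip_fderiv_right (hf.contDiff (k := 1)) hf.2 (hg.contDiff (k := 1)) (ex j)

lemma dx_shift (f : Phase n → ℂ) (v : Phase n) (j : Fin n) (p : Phase n) :
    dx j (fun p => f (p + v)) p = dx j f (p + v) := by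
  rw [dx, dx, fderiv_comp_add_right]

lemma dy_shift (f : Phase n → ℂ) (v : Phase n) (j : Fin n) (p : Phase n) :
    dy j (fun p => f (p + v)) p = dy j f (p + v) := by
  rw [dy, dy, fderiv_comp_add_right]

lemma dy_sub (hf : Test f) (hg : Test g) (j : Fin n) (p : Phase n) :
    dy j (fun p => f p - g p) p = dy j f p - dy j g p := by
  rw [dy, fderiv_fun_sub (hf.differentiable p) (hg.differentiable p)]; rfl

lemma dy_diff (hf : Test f) (i j : Fin n) (t : ℝ) : dy i (diff j t f) = diff j t (dy i f) := by
  ext p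
  rw [show diff j t f = fun p => f (p + t • ex j) - f p from rfl, dy_sub (hf.shift _) hf, dy_shift]
  rfl

lemma add_ex_fst (p : Phase n) (j : Fin n) (t : ℝ) :
    (p + t • ex j).1 = p.1 + t • EuclideanSpace.single j (1 : ℝ) := rfl

lemma add_ex_snd (p : Phase n) (j : Fin n) (t : ℝ) : (p + t • ex j).2 = p.2 := by
  simp [ex]

/-! ### Commuting the operators with translations -/

namespace Coeffs

variable {K : ℝ} (c : Coeffs n K)

/-- A Lipschitz weight that is at least 1 varies by a bounded factor over unit distances. -/
lemma μ_le {x z : Space n} (h : ‖z - x‖ ≤ 1) : c.μ z ≤ (1 + K) * c.μ x := by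
  have h1 := Convex.norm_image_sub_le_of_norm_fderiv_le (𝕜 := ℝ) (f := c.μ) (s := Set.univ)
    (fun x _ => c.contDiff_μ.differentiable (by norm_num) x) (fun x _ => c.bound_dμ x)
    convex_univ (Set.mem_univ x) (Set.mem_univ z)
  have h2 : c.μ z - c.μ x ≤ K * ‖z - x‖ := (le_abs_self _).trans h1
  have h3 : K * ‖z - x‖ ≤ K * 1 := by gcongr; exact c.K_nonneg
  nlinarith [c.one_le x, c.K_nonneg]

lemma abs_sub_le_of_fderiv {φ : Space n → ℝ} (hφ : ContDiff ℝ 1 φ) {m : ℕ}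
    (hb : ∀ x, ‖fderiv ℝ φ x‖ ≤ K * c.μ x ^ m) {x z : Space n} (h : ‖z - x‖ ≤ 1) :
    |φ z - φ x| ≤ K * (1 + K) ^ m * ‖z - x‖ * c.μ x ^ m := by
  have hK := c.K_nonneg
  have h1 := Convex.norm_image_sub_le_of_norm_fderiv_le (𝕜 := ℝ) (f := φ)
    (s := Metric.closedBall x 1) (C := K * ((1 + K) * c.μ x) ^ m)
    (fun x _ => hφ.differentiable (by norm_num) x) (fun w hw => (hb w).trans (by
      have := c.μ_pos w
      gcongr
      exact c.μ_le (by simpa [dist_eq_norm] using hw))) (convex_closedBall x 1)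
    (Metric.mem_closedBall_self zero_le_one) (by simpa [dist_eq_norm] using h : z ∈ _)
  refine h1.trans_eq ?_
  rw [mul_pow]; ring

/-- The bound holds with μ² at either endpoint, hence with the product of the two values. The
product form lets each of the two paired functions carry one factor μ at its own point. -/
lemma abs_E_sub_le (k : Fin n) {x z : Space n} (h : ‖z - x‖ ≤ 1) :
    |c.E k z - c.E k x| ≤ K * (1 + K) ^ 2 * ‖z - x‖ * (c.μ x * c.μ z) := by
  have h1 := c.abs_sub_le_of_fderiv (c.contDiff_E k) (c.bound_dE k) h
  have h2 := c.abs_sub_le_of_fderiv (c.contDiff_E k) (c.bound_dE k)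
    (by rwa [norm_sub_rev] : ‖x - z‖ ≤ 1)
  rw [abs_sub_comm, norm_sub_rev] at h2
  have hK := c.K_nonneg
  have hx := c.μ_pos x
  have hz := c.μ_pos z
  rcases le_total (c.μ x) (c.μ z) with hxz | hxz
  · refine h1.trans ?_
    rw [sq (c.μ x)]
    gcongr
  · refine h2.trans ?_
    rw [sq (c.μ z)]
    gcongr

lemma abs_b_sub_le (i k : Fin n) {x z : Space n} (h : ‖z - x‖ ≤ 1) :
    |c.b i k z - c.b i k x| ≤ K * (1 + K) ^ 2 * ‖z - x‖ * c.μ x := by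
  have h1 := c.abs_sub_le_of_fderiv (m := 1) (c.contDiff_b i k)
    (fun x => by simpa using c.bound_db i k x) h
  have hK := c.K_nonneg
  have hx := c.μ_pos x
  refine h1.trans ?_
  rw [pow_one, pow_one]
  gcongr
  -- The exponent is raised only to share the constant of `abs_E_sub_le`.
  exact le_self_pow₀ (by linarith) two_ne_zero

/-- The commutator of the transport operator with a translation in `xⱼ`, applied to `u`. -/
def comm (j : Fin n) (t : ℝ) (u : Phase n → ℂ) (p : Phase n) : ℂ :=
  ∑ k, (c.E k (p + t • ex j).1 - c.E k p.1) • dy k u (p + t • ex j)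
    + ∑ i, ∑ k, ((c.b i k (p + t • ex j).1 - c.b i k p.1) * p.2 i) • dy k u (p + t • ex j)

lemma Q_shift (j : Fin n) (t : ℝ) (u : Phase n → ℂ) (p : Phase n) :
    c.Q (fun p => u (p + t • ex j)) p = c.Q u (p + t • ex j) + c.comm j t u p := by
  simp only [Q, comm, dx_shift, dy_shift, add_ex_snd, sub_smul, sub_mul, Finset.sum_sub_distrib]
  ring

lemma P_shift (j : Fin n) (t : ℝ) (u : Phase n → ℂ) (p : Phase n) :
    c.P (fun p => u (p + t • ex j)) p = c.P u (p + t • ex j) + c.comm j t u p := by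
  have h : ∀ k, dy k (dy k fun p => u (p + t • ex j)) p = dy k (dy k u) (p + t • ex j) := by
    intro k
    rw [show (dy k fun p => u (p + t • ex j)) = fun p => dy k u (p + t • ex j) from
      funext fun p => dy_shift _ _ _ _, dy_shift]
  simp only [P, Q_shift, laplaceY, h, add_ex_snd]
  ring

lemma Q_sub {u v : Phase n → ℂ} (hu : Test u) (hv : Test v) (p : Phase n) :
    c.Q (fun p => u p - v p) p = c.Q u p - c.Q v p := by
  rw [Q_eq, Q_eq, Q_eq, fderiv_fun_sub (hu.differentiable p) (hv.differentiable p)]; rfl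

lemma P_sub {u v : Phase n → ℂ} (hu : Test u) (hv : Test v) (p : Phase n) :
    c.P (fun p => u p - v p) p = c.P u p - c.P v p := by
  have h : ∀ k, dy k (dy k fun p => u p - v p) p = dy k (dy k u) p - dy k (dy k v) p := by
    intro k
    rw [show (dy k fun p => u p - v p) = fun p => dy k u p - dy k v p from
      funext fun p => dy_sub hu hv _ _, dy_sub (hu.dy k) (hv.dy k)]
  simp only [P, Q_sub c hu hv, laplaceY, h, Finset.sum_sub_distrib, smul_sub]
  ring

lemma P_diff {u : Phase n → ℂ} (hu : Test u) (j : Fin n) (t : ℝ) (p : Phase n) :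
    c.P (diff j t u) p = diff j t (c.P u) p + c.comm j t u p := by
  rw [show diff j t u = fun p => u (p + t • ex j) - u p from rfl, P_sub c (hu.shift _) hu, P_shift,
    diff]
  ring

lemma cc_comm_E {u : Phase n → ℂ} (hu : Test u) (j k : Fin n) (t : ℝ) :
    CC fun p => (c.E k (p + t • ex j).1 - c.E k p.1) • dy k u (p + t • ex j) := by
  have h := (c.contDiff_E k).continuous
  exact ((hu.dy k).cc.shift _).smul (by fun_prop)

lemma cc_comm_b {u : Phase n → ℂ} (hu : Test u) (i j k : Fin n) (t : ℝ) :
    CC fun p => ((c.b i k (p + t • ex j).1 - c.b i k p.1) * p.2 i) • dy k u (p + t • ex j) := by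
  have h := (c.contDiff_b i k).continuous
  exact ((hu.dy k).cc.shift _).smul (by fun_prop)

lemma cc_comm {u : Phase n → ℂ} (hu : Test u) (j : Fin n) (t : ℝ) : CC (c.comm j t u) :=
  (CC.sum _ fun k => c.cc_comm_E hu j k t).add
    (CC.sum _ fun i => CC.sum _ fun k => c.cc_comm_b hu i j k t)

lemma norm_add_ex_sub (p : Phase n) (j : Fin n) {t : ℝ} (ht : 0 ≤ t) :
    ‖(p + t • ex j).1 - p.1‖ = t := by
  rw [add_ex_fst, add_sub_cancel_left, norm_smul]
  simp [abs_of_nonneg ht]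

/-- The commutator with a translation by `t` is of size `t`, measured by weighted norms. -/
lemma abs_ip_comm_le {u z : Phase n → ℂ} (hu : Test u) (hz : CC z) (j : Fin n) {t : ℝ}
    (ht : 0 ≤ t) (ht1 : t ≤ 1) {A : ℝ} (hA : ∀ k, nrm (c.wt 1 0 (dy k u)) ≤ A)
    (hB : ∀ k, nrm (c.wt 0 1 (dy k u)) ≤ A) :
    |ip (c.comm j t u) z| ≤ K * (1 + K) ^ 2 * (n + n * n) * t * A * nrm (c.wt 1 0 z) := by
  have hK := c.K_nonneg
  have hC : 0 ≤ K * (1 + K) ^ 2 * t := by positivity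
  have hz0 := nrm_nonneg (c.wt 1 0 z)
  -- The factor μ at the translated point goes to ∂_y u, the one at p to z; translation invariance
  -- of the norm then removes the shift.
  have e1 : ∀ k, |ip (fun p => (c.E k (p + t • ex j).1 - c.E k p.1) • dy k u (p + t • ex j)) z|
      ≤ K * (1 + K) ^ 2 * t * (A * nrm (c.wt 1 0 z)) := by
    intro k
    have hw := c.cc_wt 1 0 (hu.dy k).cc
    refine (abs_integral_le (hw.shift (t • ex j)).sqInt (c.cc_wt 1 0 hz).sqInt hC
      fun p => ?_).trans ?_
    · refine (abs_real_inner_le_norm _ _).trans ?_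
      have hn := norm_add_ex_sub p j ht
      have := c.abs_E_sub_le k (hn.trans_le ht1)
      rw [hn] at this
      rw [norm_smul, norm_wt, norm_wt, Real.norm_eq_abs]
      calc _ ≤ K * (1 + K) ^ 2 * t * (c.μ p.1 * c.μ (p + t • ex j).1) * ‖dy k u (p + t • ex j)‖
            * ‖z p‖ := by gcongr
        _ = _ := by ring
    · rw [nrm_shift _ hw]
      gcongr
      exact hA k
  -- Here ∂_y u carries |y|, which the translation in x leaves unchanged, and z carries the single
  -- factor μ from ∂b.
  have e2 : ∀ i k, |ip (fun p => ((c.b i k (p + t • ex j).1 - c.b i k p.1) * p.2 i)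
      • dy k u (p + t • ex j)) z| ≤ K * (1 + K) ^ 2 * t * (A * nrm (c.wt 1 0 z)) := by
    intro i k
    have hw := c.cc_wt 0 1 (hu.dy k).cc
    refine (abs_integral_le (hw.shift (t • ex j)).sqInt (c.cc_wt 1 0 hz).sqInt hC
      fun p => ?_).trans ?_
    · refine (abs_real_inner_le_norm _ _).trans ?_
      have hn := norm_add_ex_sub p j ht
      have := c.abs_b_sub_le i k (hn.trans_le ht1)
      rw [hn] at this
      rw [norm_smul, norm_wt, norm_wt, Real.norm_eq_abs, abs_mul, add_ex_snd]
      calc _ ≤ K * (1 + K) ^ 2 * t * c.μ p.1 * ‖p.2‖ * ‖dy k u (p + t • ex j)‖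
            * ‖z p‖ := by gcongr; exacts [(mul_nonneg hC (c.μ_pos p.1).le), abs_coord_le _ _]
        _ = _ := by ring
    · rw [nrm_shift _ hw]
      gcongr
      exact hB k
  have e3 : ip (c.comm j t u) z
      = ∑ k, ip (fun p => (c.E k (p + t • ex j).1 - c.E k p.1) • dy k u (p + t • ex j)) z
        + ∑ i, ∑ k, ip (fun p => ((c.b i k (p + t • ex j).1 - c.b i k p.1) * p.2 i)
          • dy k u (p + t • ex j)) z := by
    rw [show c.comm j t u = fun p =>
        (∑ k, (c.E k (p + t • ex j).1 - c.E k p.1) • dy k u (p + t • ex j))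
        + ∑ i, ∑ k, ((c.b i k (p + t • ex j).1 - c.b i k p.1) * p.2 i) • dy k u (p + t • ex j)
        from rfl,
      ip_add_left (CC.sum _ fun k => c.cc_comm_E hu j k t)
        (CC.sum _ fun i => CC.sum _ fun k => c.cc_comm_b hu i j k t) hz,
      ip_sum_left _ (fun k => c.cc_comm_E hu j k t) hz,
      ip_sum_left _ (fun i => CC.sum _ fun k => c.cc_comm_b hu i j k t) hz]
    simp only [ip_sum_left _ (fun k => c.cc_comm_b hu _ j k t) hz]
  rw [e3]
  calc _ ≤ ∑ _k : Fin n, K * (1 + K) ^ 2 * t * (A * nrm (c.wt 1 0 z))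
        + ∑ _i : Fin n, ∑ _k : Fin n, K * (1 + K) ^ 2 * t * (A * nrm (c.wt 1 0 z)) := by
        refine (abs_add_le _ _).trans (add_le_add ?_ ?_)
        · exact (Finset.abs_sum_le_sum_abs _ _).trans (Finset.sum_le_sum fun k _ => e1 k)
        · refine (Finset.abs_sum_le_sum_abs _ _).trans (Finset.sum_le_sum fun i _ => ?_)
          exact (Finset.abs_sum_le_sum_abs _ _).trans (Finset.sum_le_sum fun k _ => e2 i k)
    _ = _ := by simp only [Finset.sum_const, Finset.card_univ, Fintype.card_fin, nsmul_eq_mul]; ring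

lemma nrm_wt_diff_le {u : Phase n → ℂ} (hu : Test u) (j : Fin n) {t : ℝ}
    (ht : 0 ≤ t) (ht1 : t ≤ 1) : nrm (c.wt 1 0 (diff j t u)) ≤ (2 + K) * nrm (c.wt 1 0 u) := by
  have hK := c.K_nonneg
  have hw := c.cc_wt 1 0 hu.cc
  have h1 : nrm (c.wt 1 0 fun p => u (p + t • ex j)) ≤ (1 + K) * nrm (c.wt 1 0 u) := by
    rw [← nrm_shift _ hw (t • ex j), ← abs_of_nonneg (by positivity : 0 ≤ 1 + K),
      ← nrm_const_smul]
    refine nrm_mono ((hw.shift _).smul continuous_const).sqInt fun p => ?_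
    rw [norm_smul, norm_wt, norm_wt, Real.norm_of_nonneg (by positivity), pow_one, pow_one]
    have := c.μ_le (x := (p + t • ex j).1) (z := p.1)
      (by rw [norm_sub_rev, norm_add_ex_sub p j ht]; exact ht1)
    simp only [pow_zero, mul_one]
    rw [← mul_assoc]
    gcongr
  have h2 := nrm_sub_le (c.cc_wt 1 0 (hu.cc.shift (t • ex j))).sqInt hw.sqInt
  have h3 : c.wt 1 0 (diff j t u)
      = fun p => c.wt 1 0 (fun p => u (p + t • ex j)) p - c.wt 1 0 u p := by
    ext p; simp only [wt, diff, smul_sub]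
  rw [h3]
  linarith

end Coeffs

end

noncomputable section

variable {n : ℕ}

/-! ### Fractional regularity in position -/

/-- A geometric series of ratio at most 4/5. -/
lemma sum_inv_crt_le (M : ℕ) : ∑ k ∈ Finset.range M, (crt⁻¹) ^ k ≤ 5 := by
  have h1 : crt⁻¹ ≤ 4 / 5 := by
    rw [inv_le_comm₀ crt_pos (by norm_num)]; linarith [le_crt]
  have h0 : 0 ≤ crt⁻¹ := inv_nonneg.2 crt_pos.le
  have h := geom_sum_mul_neg crt⁻¹ M
  have h2 : 0 ≤ (crt⁻¹) ^ M := pow_nonneg h0 M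
  have h3 : 0 ≤ ∑ k ∈ Finset.range M, (crt⁻¹) ^ k := Finset.sum_nonneg fun k _ => pow_nonneg h0 k
  nlinarith

lemma inv_two_pow_eq (k : ℕ) : ((2 : ℝ) ^ k)⁻¹ = (crt⁻¹) ^ (3 * k) := by
  rw [pow_mul, inv_pow, crt_cube, inv_pow]

lemma inv_two_pow_le_one (k : ℕ) : ((2 : ℝ) ^ k)⁻¹ ≤ 1 := inv_le_one_of_one_le₀ (one_le_pow₀ one_le_two)

namespace Coeffs

variable {K : ℝ} (c : Coeffs n K)

/-- The unweighted energy identity, with the nonnegative term |y|²/4 dropped. -/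
lemma sum_nrm_dy_sq_le {w : Phase n → ℂ} (hw : Test w) :
    ∑ i, nrm (dy i w) ^ 2 ≤ ip (c.P w) w + n / 2 * nrm w ^ 2 := by
  have h := c.integral_weight_P hw (φ := fun _ => 1) contDiff_const
  simp only [fderiv_fun_const, Pi.zero_apply, zero_apply, zero_mul, integral_zero, one_mul,
    Finset.sum_const_zero, mul_zero, add_zero, zero_add] at h
  have h1 : -(n / 2 * nrm w ^ 2) ≤ ∫ p, (‖p.2‖ ^ 2 / 4 - (n : ℝ) / 2) * ‖w p‖ ^ 2 := by
    rw [hw.cc.sqInt.nrm_sq, ← integral_const_mul, ← integral_neg]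
    refine integral_mono (hw.cc.norm_sq.integrable.const_mul _).neg
      (hw.cc.norm_sq.mul (by fun_prop)).integrable fun p => ?_
    simp only
    nlinarith [mul_nonneg (sq_nonneg ‖p.2‖) (sq_nonneg ‖w p‖)]
  have h2 : ∀ i, nrm (dy i w) ^ 2 = ∫ p, ‖dy i w p‖ ^ 2 := fun i => (hw.dy i).cc.sqInt.nrm_sq
  simp only [h2]
  rw [show ip (c.P w) w = ∫ p, inner ℝ (c.P w p) (w p) from rfl, h]
  linarith

/-- One third of a derivative in `xⱼ` on `∂_y u`. -/
lemma nrm_frac_one_dy_le {u : Phase n → ℂ} (hu : Test u) (i j : Fin n) {A : ℝ}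
    (hA : ∀ k, nrm (c.wt 1 0 (dy k u)) ≤ A) (hB : ∀ k, nrm (c.wt 0 1 (dy k u)) ≤ A)
    (hX : nrm (c.wt 2 0 u) ≤ A) :
    nrm (frac j 1 (dy i u)) ^ 2 ≤ A ^ 2
      + 8 * ((256 * nrm (c.P u) + 128 * n * nrm u) * nrm (frac j 2 u)
        + 5 * (K * (1 + K) ^ 2 * (n + n * n) * (2 + K) * A ^ 2)) := by
  have hK := c.K_nonneg
  have hA0 : 0 ≤ A := (nrm_nonneg _).trans hX
  obtain ⟨L, hL0, hL⟩ : ∃ L, 0 ≤ L ∧ L = K * (1 + K) ^ 2 * (n + n * n) * (2 + K) * A ^ 2 :=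
    ⟨_, by positivity, rfl⟩
  have hd : nrm (dy i u) ≤ A := (c.nrm_le_wt 1 (hu.dy i).cc).trans (hA i)
  have hq := crt_pos
  -- The energy estimate for the difference of u at step 2⁻ᵏ, weighted by `crt`^{2k}.
  have key : ∀ k : ℕ, crt ^ (2 * 1 * k) * nrm (diff j ((2 ^ k)⁻¹) (dy i u)) ^ 2
      ≤ crt ^ (2 * k) * |ip (diff j ((2 ^ k)⁻¹) (c.P u)) (diff j ((2 ^ k)⁻¹) u)|
        + n / 2 * (crt ^ (2 * k) * |ip (diff j ((2 ^ k)⁻¹) u) (diff j ((2 ^ k)⁻¹) u)|)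
        + (crt⁻¹) ^ k * L := by
    intro k
    obtain ⟨t, ht⟩ : ∃ t : ℝ, t = (2 ^ k)⁻¹ := ⟨_, rfl⟩
    have ht0 : 0 ≤ t := by rw [ht]; positivity
    have ht1 : t ≤ 1 := ht ▸ inv_two_pow_le_one k
    -- Since 2⁻ᵏ = `crt`^{-3k}, the commutator error, proportional to the step, is summable over k.
    have e0 : crt ^ (2 * k) * t = (crt⁻¹) ^ k := by
      rw [ht, inv_two_pow_eq, show 3 * k = 2 * k + k by ring, pow_add, ← mul_assoc, ← mul_pow,
        mul_inv_cancel₀ hq.ne', one_pow, one_mul]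
    rw [← ht, mul_one, ← e0]
    have hw := hu.diff j t
    have e1 := c.sum_nrm_dy_sq_le hw
    have e2 : nrm (diff j t (dy i u)) ^ 2 ≤ ∑ i, nrm (dy i (diff j t u)) ^ 2 := by
      rw [← dy_diff hu]
      exact Finset.single_le_sum (f := fun i => nrm (dy i (diff j t u)) ^ 2)
        (fun i _ => sq_nonneg _) (Finset.mem_univ i)
    have e3 : ip (c.P (diff j t u)) (diff j t u)
        = ip (diff j t (c.P u)) (diff j t u) + ip (c.comm j t u) (diff j t u) := by
      rw [← ip_add_left ((c.cc_P hu).diff j t) (c.cc_comm hu j t) hw.cc]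
      congr 1; ext p
      exact c.P_diff hu j t p
    have e4 : ip (c.comm j t u) (diff j t u) ≤ t * L := by
      refine (le_abs_self _).trans ((c.abs_ip_comm_le hu hw.cc j ht0 ht1 hA hB).trans ?_)
      have e5 : nrm (c.wt 1 0 (diff j t u)) ≤ (2 + K) * A :=
        (c.nrm_wt_diff_le hu j ht0 ht1).trans (by
          gcongr; exact (c.nrm_wt_mono one_le_two 0 hu.cc).trans hX)
      calc _ ≤ K * (1 + K) ^ 2 * (n + n * n) * t * A * ((2 + K) * A) := by gcongr
        _ = t * L := by rw [hL]; ring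
    have e6 : nrm (diff j t (dy i u)) ^ 2 ≤ |ip (diff j t (c.P u)) (diff j t u)|
        + n / 2 * |ip (diff j t u) (diff j t u)| + t * L := by
      rw [ip_self hw.cc.sqInt, abs_of_nonneg (sq_nonneg (nrm (diff j t u)))]
      linarith [le_abs_self (ip (diff j t (c.P u)) (diff j t u))]
    have hc : 0 ≤ crt ^ (2 * k) := by positivity
    linarith [mul_le_mul_of_nonneg_left e6 hc]
  have hS := nrm_frac_sq_le (hu.dy i) j (r := 1) one_le_two
    (S := (256 * nrm (c.P u) + 128 * n * nrm u) * nrm (frac j 2 u) + 5 * L) (fun M => by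
      refine (Finset.sum_le_sum fun k _ => key k).trans ?_
      rw [Finset.sum_add_distrib, Finset.sum_add_distrib, ← Finset.mul_sum, ← Finset.sum_mul]
      -- All fractional regularity falls on u, so Pu enters only through its L² norm; 128n is
      -- 256·n/2.
      have s1 := sum_ip_diff_diff_le (c.cc_P hu) hu j M
      have s2 := mul_le_mul_of_nonneg_left (sum_ip_diff_diff_le hu.cc hu j M)
        (by positivity : (0 : ℝ) ≤ n / 2)
      have s3 := mul_le_mul_of_nonneg_right (sum_inv_crt_le M) hL0
      linarith)
  rw [← hL]
  have : nrm (dy i u) ^ 2 ≤ A ^ 2 := by gcongr; exact nrm_nonneg _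
  linarith

end Coeffs

end

/-! ### Mean-square differences and two thirds of a derivative in position. -/

noncomputable section

variable {n : ℕ}

lemma hasDerivAt_ip_shift {f g : Phase n → ℂ} (hf : CC f) (hg : Test g) (j : Fin n) (t : ℝ) :
    HasDerivAt (fun t => ip f fun p => g (p + t • ex j)) (ip f fun p => dx j g (p + t • ex j)) t := by
  obtain ⟨M, hM⟩ := (hg.dx j).cc.1.bounded_above_of_compact_support (hg.dx j).2
  have hsh : ∀ {h : Phase n → ℂ}, CC h → ∀ s : ℝ, CC fun p => (inner ℝ (f p) (h (p + s • ex j)) : ℝ) :=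
    fun hh s => hf.inner (hh.shift (s • ex j)).1
  refine (hasDerivAt_integral_of_dominated_loc_of_deriv_le (s := Set.univ)
    (F := fun s p => inner ℝ (f p) (g (p + s • ex j)))
    (F' := fun s p => inner ℝ (f p) (dx j g (p + s • ex j))) (bound := fun p => ‖f p‖ * M)
    Filter.univ_mem (Filter.Eventually.of_forall fun s => (hsh hg.cc s).1.aestronglyMeasurable)
    (hsh hg.cc t).integrable (hsh (hg.dx j).cc t).1.aestronglyMeasurable
    (ae_of_all _ fun p s _ => ?_) (hf.integrable.norm.mul_const M) (ae_of_all _ fun p s _ => ?_)).2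
  · refine (norm_inner_le_norm _ _).trans ?_
    gcongr
    exact hM _
  · have h1 : HasDerivAt (fun s : ℝ => g (p + s • ex j)) (dx j g (p + s • ex j)) s := by
      have h2 : HasDerivAt (fun s : ℝ => p + s • (ex j : Phase n)) (ex j) s := by
        simpa using ((hasDerivAt_id s).smul_const (ex j : Phase n)).const_add p
      exact (hg.differentiable _).hasFDerivAt.comp_hasDerivAt s h2
    simpa using (hasDerivAt_const s (f p)).inner ℝ h1

/-- Differences in mean square are controlled by the quadratic form of `∂ₓ`. -/
lemma nrm_diff_sq_le {u : Phase n → ℂ} (hu : Test u) (j : Fin n) {t B : ℝ} (ht : 0 ≤ t)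
    (hB : ∀ s, 0 ≤ s → s ≤ t → |ip u fun p => dx j u (p + s • ex j)| ≤ B) :
    nrm (diff j t u) ^ 2 ≤ 2 * t * B := by
  -- Translations are isometries, so the square expands to a value of the autocorrelation s ↦ ⟨u,
  -- u(· + s eⱼ)⟩, whose derivative is the quantity bounded by B.
  have h1 : nrm (diff j t u) ^ 2 = 2 * (nrm u ^ 2 - ip u fun p => u (p + t • ex j)) := by
    have hs := hu.shift (t • ex j)
    rw [← ip_self (hu.diff j t).cc.sqInt, show diff j t u = fun p => u (p + t • ex j) - u p from rfl,
      ip_sub_left hs.cc hu.cc (hs.sub hu).cc, ip_sub_right hs.cc hu.cc hs.cc,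
      ip_sub_right hs.cc hu.cc hu.cc, ip_self hs.cc.sqInt, ip_self hu.cc.sqInt,
      nrm_shift _ hu.cc, Coeffs.ip_comm (fun p => u (p + t • ex j)) u]
    ring
  have h2 := norm_image_sub_le_of_norm_deriv_le_segment' (a := 0) (b := t)
    (f := fun t => ip u fun p => u (p + t • ex j)) (C := B)
    (fun s _ => (hasDerivAt_ip_shift hu.cc hu j s).hasDerivWithinAt)
    (fun s hs => hB s hs.1 hs.2.le) t ⟨ht, le_rfl⟩
  simp only [zero_smul, add_zero, sub_zero] at h2
  rw [ip_self hu.cc.sqInt, Real.norm_eq_abs, abs_sub_comm] at h2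
  rw [h1]
  linarith [le_abs_self (nrm u ^ 2 - ip u fun p => u (p + t • ex j))]

namespace Coeffs

variable {K : ℝ} (c : Coeffs n K)

lemma cc_b {u : Phase n → ℂ} (hu : CC u) (i k : Fin n) : CC fun p => c.b i k p.1 • u p :=
  hu.smul ((c.contDiff_b i k).continuous.comp continuous_fst)

lemma nrm_b_le {u : Phase n → ℂ} (hu : CC u) (i k : Fin n) :
    nrm (fun p => c.b i k p.1 • u p) ≤ K * nrm (c.wt 2 0 u) := by
  have h := nrm_const_smul K (c.wt 2 0 u)
  rw [abs_of_nonneg c.K_nonneg] at h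
  rw [← h]
  refine nrm_mono ((c.cc_wt 2 0 hu).smul continuous_const).sqInt fun p => ?_
  rw [norm_smul, norm_smul, norm_wt, Real.norm_of_nonneg c.K_nonneg, Real.norm_eq_abs, pow_zero,
    mul_one, ← mul_assoc]
  gcongr
  exact c.bound_b i k p.1

/-- The polarised commutator identity for u and its translate, minus the same identity for u and u,
where ⟨u, ∂_{xⱼ}u⟩ = 0. After the subtraction ∂_y u occurs only as a difference, except beside the
commutator, which is itself of the size of the step. -/
lemma ip_shift_dx_eq {u : Phase n → ℂ} (hu : Test u) (j : Fin n) (s : ℝ) :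
    (ip u fun p => dx j u (p + s • ex j))
      = ip (c.Q u) (diff j s (dy j u)) - ip (c.Q u) (diff j (-s) (dy j u))
        - ip (c.comm j s u) (dy j u)
        + ∑ k, ip (fun p => c.b j k p.1 • u p) (diff j s (dy k u)) := by
  have hv := hu.shift (s • ex j)
  have h1 := c.ip_Q_dy_sub hu hv j
  have h2 := c.ip_Q_dy_sub hu hu j
  have h3 : ip u (dx j u) = 0 := by
    have := ip_dx_right hu hu j
    rw [ip_comm (dx j u)] at this
    linarith
  have h4 : ip (c.Q fun p => u (p + s • ex j)) (dy j u)
      = ip (c.Q u) (dy j u) + ip (c.Q u) (diff j (-s) (dy j u)) + ip (c.comm j s u) (dy j u) := by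
    have e : c.Q (fun p => u (p + s • ex j))
        = fun p => c.Q u (p + s • ex j) + c.comm j s u p := funext fun p => c.Q_shift j s u p
    rw [e, ip_add_left ((c.cc_Q hu).shift _) (c.cc_comm hu j s) (hu.dy j).cc, ip_shift_left,
      show diff j (-s) (dy j u) = fun p => dy j u (p + -s • ex j) - dy j u p from rfl,
      ip_sub_right ((hu.dy j).cc.shift _) (hu.dy j).cc (c.cc_Q hu), neg_smul]
    ring
  have h5 : ∀ {w : Phase n → ℂ}, CC w → ∀ k, ip w (diff j s (dy k u))
      = ip w (dy k fun p => u (p + s • ex j)) - ip w (dy k u) := by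
    intro w hw k
    rw [show diff j s (dy k u) = fun p => dy k u (p + s • ex j) - dy k u p from rfl,
      ip_sub_right ((hu.dy k).cc.shift _) (hu.dy k).cc hw,
      show (dy k fun p => u (p + s • ex j)) = fun p => dy k u (p + s • ex j) from
        funext fun p => dy_shift _ _ _ _]
  have h6 : dx j (fun p => u (p + s • ex j)) = fun p => dx j u (p + s • ex j) :=
    funext fun p => dx_shift _ _ _ _
  rw [h4, h6] at h1
  rw [h5 (c.cc_Q hu) j]
  simp only [fun k => h5 (c.cc_b hu.cc j k) k, Finset.sum_sub_distrib]
  rw [h3] at h2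
  linarith

/-- Two thirds of a derivative in `xⱼ`. -/
lemma nrm_frac_two_le {u : Phase n → ℂ} (hu : Test u) (j : Fin n) {A a : ℝ}
    (hA : ∀ k, nrm (c.wt 1 0 (dy k u)) ≤ A) (hB : ∀ k, nrm (c.wt 0 1 (dy k u)) ≤ A)
    (hX : nrm (c.wt 2 0 u) ≤ A) (ha : ∀ k, nrm (frac j 1 (dy k u)) ≤ a) :
    nrm (frac j 2 u) ^ 2 ≤ A ^ 2
      + 8 * (64 * (nrm (c.Q u) * a) + 32 * (n * K) * (A * a)
        + 10 * (K * (1 + K) ^ 2 * (n + n * n) * A ^ 2)) := by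
  have hK := c.K_nonneg
  have hA0 : 0 ≤ A := (nrm_nonneg _).trans hX
  obtain ⟨L, hL0, hL⟩ : ∃ L, 0 ≤ L ∧ L = K * (1 + K) ^ 2 * (n + n * n) * A ^ 2 :=
    ⟨_, by positivity, rfl⟩
  have hq := crt_pos
  -- Uniform in s ≤ t, as the mean value argument of `nrm_diff_sq_le` demands.
  have bound : ∀ t s : ℝ, t ≤ 1 → 0 ≤ s → s ≤ t → |ip u fun p => dx j u (p + s • ex j)|
      ≤ 2 * major j t (c.Q u) (dy j u)
        + ∑ k, major j t (fun p => c.b j k p.1 • u p) (dy k u) + t * L := by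
    intro t s ht1 hs hst
    have hs1 : |s| ≤ t := by rwa [abs_of_nonneg hs]
    have hs2 : |-s| ≤ t := by rwa [abs_neg]
    have e1 := abs_ip_diff_le (c.cc_Q hu) (hu.dy j).cc j hs1
    have e2 := abs_ip_diff_le (c.cc_Q hu) (hu.dy j).cc j hs2
    have e3 : |∑ k, ip (fun p => c.b j k p.1 • u p) (diff j s (dy k u))|
        ≤ ∑ k, major j t (fun p => c.b j k p.1 • u p) (dy k u) :=
      (Finset.abs_sum_le_sum_abs _ _).trans (Finset.sum_le_sum fun k _ =>
        abs_ip_diff_le (c.cc_b hu.cc j k) (hu.dy k).cc j hs1)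
    have e4 : |ip (c.comm j s u) (dy j u)| ≤ t * L := by
      have ht0 := hs.trans hst
      have hAj := hA j
      have hn := nrm_nonneg (c.wt 1 0 (dy j u))
      refine (c.abs_ip_comm_le hu (hu.dy j).cc j hs (hst.trans ht1) hA hB).trans ?_
      calc _ ≤ K * (1 + K) ^ 2 * (n + n * n) * t * A * A := by gcongr
        _ = t * L := by rw [hL]; ring
    rw [c.ip_shift_dx_eq hu]
    rw [abs_le] at e1 e2 e3 e4 ⊢
    constructor <;> linarith [e1.1, e1.2, e2.1, e2.2, e3.1, e3.2, e4.1, e4.2]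
  have key : ∀ k : ℕ, crt ^ (2 * 2 * k) * nrm (diff j ((2 ^ k)⁻¹) u) ^ 2
      ≤ 4 * (crt ^ k * major j ((2 ^ k)⁻¹) (c.Q u) (dy j u))
        + 2 * (∑ i, crt ^ k * major j ((2 ^ k)⁻¹) (fun p => c.b j i p.1 • u p) (dy i u))
        + 2 * ((crt⁻¹) ^ k * L) := by
    intro k
    obtain ⟨t, ht⟩ : ∃ t : ℝ, t = (2 ^ k)⁻¹ := ⟨_, rfl⟩
    have ht0 : 0 ≤ t := by rw [ht]; positivity
    have ht1 : t ≤ 1 := ht ▸ inv_two_pow_le_one k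
    -- The factor t from `nrm_diff_sq_le` lowers the weight `crt`^{4k} to `crt`^k, exactly the
    -- weight in `sum_major_le`.
    have e0 : crt ^ (2 * 2 * k) * t = crt ^ k := by
      rw [ht, inv_two_pow_eq, show 2 * 2 * k = k + 3 * k by ring, pow_add, mul_assoc, ← mul_pow,
        mul_inv_cancel₀ hq.ne', one_pow, mul_one]
    -- The commutator brings a second factor t, leaving `crt`^{-2k}, which is bounded by the
    -- geometric series already summed.
    have e1 : crt ^ k * t ≤ (crt⁻¹) ^ k := by
      have : crt⁻¹ ≤ 1 := inv_le_one_of_one_le₀ (by linarith [le_crt])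
      rw [ht, inv_two_pow_eq, show 3 * k = k + 2 * k by ring, pow_add, ← mul_assoc, ← mul_pow,
        mul_inv_cancel₀ hq.ne', one_pow, one_mul]
      exact pow_le_pow_of_le_one (inv_nonneg.2 hq.le) this (by omega)
    rw [← ht, ← Finset.mul_sum]
    calc _ ≤ crt ^ (2 * 2 * k) * (2 * t * (2 * major j t (c.Q u) (dy j u)
        + ∑ k, major j t (fun p => c.b j k p.1 • u p) (dy k u) + t * L)) := by
          gcongr
          exact nrm_diff_sq_le hu j ht0 fun s hs hst => bound t s ht1 hs hst
      _ = (crt ^ (2 * 2 * k) * t) * (4 * major j t (c.Q u) (dy j u)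
        + 2 * ∑ k, major j t (fun p => c.b j k p.1 • u p) (dy k u))
        + 2 * ((crt ^ (2 * 2 * k) * t) * t * L) := by ring
      _ ≤ _ := by
        rw [e0]
        linarith [mul_le_mul_of_nonneg_right e1 hL0]
  -- Here 64 = 4·16 and 32 = 2·16 come from `sum_major_le`, and 10 = 2·5 from `sum_inv_crt_le`.
  have hS := nrm_frac_sq_le hu j (r := 2) le_rfl
    (S := 64 * (nrm (c.Q u) * a) + 32 * (n * K) * (A * a) + 10 * L) (fun M => by
      refine (Finset.sum_le_sum fun k _ => key k).trans ?_
      rw [Finset.sum_add_distrib, Finset.sum_add_distrib, ← Finset.mul_sum, ← Finset.mul_sum,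
        ← Finset.mul_sum, ← Finset.sum_mul, Finset.sum_comm]
      have s1 : ∑ k ∈ Finset.range M, crt ^ k * major j ((2 ^ k)⁻¹) (c.Q u) (dy j u)
          ≤ 16 * (nrm (c.Q u) * a) :=
        (sum_major_le (c.cc_Q hu) (hu.dy j) j M).trans (by
          gcongr
          exacts [nrm_nonneg _, ha j])
      have s2 : ∑ i, ∑ k ∈ Finset.range M,
          crt ^ k * major j ((2 ^ k)⁻¹) (fun p => c.b j i p.1 • u p) (dy i u)
          ≤ ∑ _i : Fin n, 16 * ((K * A) * a) := by
        refine Finset.sum_le_sum fun i _ =>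
          (sum_major_le (c.cc_b hu.cc j i) (hu.dy i) j M).trans ?_
        have := (c.nrm_b_le hu.cc j i).trans (mul_le_mul_of_nonneg_left hX hK)
        have ha' := ha i
        have h0 := nrm_nonneg (frac j 1 (dy i u))
        gcongr
      have s3 := mul_le_mul_of_nonneg_right (sum_inv_crt_le M) hL0
      simp only [Finset.sum_const, Finset.card_univ, Fintype.card_fin, nsmul_eq_mul] at s2
      linarith)
  rw [← hL]
  have h0 : nrm u ≤ A := (c.nrm_le_wt 2 hu.cc).trans hX
  have : nrm u ^ 2 ≤ A ^ 2 := by gcongr; exact nrm_nonneg _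
  linarith

end Coeffs

end

noncomputable section

variable {n : ℕ}

/-! ### The maximal estimate for general coefficients -/

lemma dy_dy_comm {u : Phase n → ℂ} (hu : Test u) (j k : Fin n) : dy k (dy j u) = dy j (dy k u) := by
  ext p
  have h1 : DifferentiableAt ℝ (fderiv ℝ u) p :=
    ((hu.contDiff (k := 2)).fderiv_right (m := 1) (by norm_num)).differentiable (by norm_num) p
  have hs : IsSymmSndFDerivAt ℝ u p :=
    (hu.contDiff (k := 2)).contDiffAt.isSymmSndFDerivAt (by simp)
  have h2 : ∀ i l : Fin n, dy l (dy i u) p = fderiv ℝ (fderiv ℝ u) p (ey l) (ey i) := by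
    intro i l
    rw [show dy i u = fun p => fderiv ℝ u p (ey i) from rfl, dy,
      fderiv_clm_apply h1 (differentiableAt_const _)]
    simp [ey]
  rw [h2, h2, hs.eq]

/-- The system of quadratic inequalities behind the maximal estimate. -/
lemma quadratic_system_maximal {k : ℝ} (hk : 1 ≤ k) : ∃ C : ℝ, 0 ≤ C ∧ ∀ N D U a : ℝ,
    0 ≤ N → 0 ≤ D → 0 ≤ U → 0 ≤ a → D ^ 2 ≤ k * (N * D + U * a + N ^ 2) →
    U ^ 2 ≤ k * ((D + N) * a + N ^ 2) → a ^ 2 ≤ k * (N * U + N ^ 2) →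
    U ≤ C * N ∧ D ≤ C * N := by
  have hk0 : 0 ≤ k := by linarith
  obtain ⟨M, hM0, hM⟩ : ∃ M : ℝ, 0 ≤ M ∧ M = 40 * k ^ 2 := ⟨_, by positivity, rfl⟩
  obtain ⟨C₁, hC₁0, hC₁⟩ : ∃ C₁ : ℝ, 0 ≤ C₁ ∧ C₁ = M * k + (M * k + M) + 1 :=
    ⟨_, by positivity, rfl⟩
  obtain ⟨C₂, hC₂0, hC₂⟩ : ∃ C₂ : ℝ, 0 ≤ C₂ ∧ C₂ = C₁ ^ 2 + M * (k * C₁ + k) + M :=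
    ⟨_, by positivity, rfl⟩
  refine ⟨C₁ + (0 + C₂ + 1), by positivity, fun N D U a hN hD hU ha h₁ h₂ h₃ => ?_⟩
  -- The small coefficient of U² lets the term Da in the bound for U² be absorbed; then U² ≲ a² +
  -- N², and a² is only linear in U.
  have e1 : D ^ 2 ≤ U ^ 2 / 4 + 8 * k ^ 2 * a ^ 2 + 3 * k ^ 2 * N ^ 2 := by
    have s1 : k * (N * D) ≤ D ^ 2 / 2 + k ^ 2 * N ^ 2 / 2 := by linarith [sq_nonneg (D - k * N)]
    have s2 : k * (U * a) ≤ U ^ 2 / 8 + 2 * k ^ 2 * a ^ 2 := by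
      linarith [sq_nonneg (U / 2 - 2 * (k * a))]
    have s3 : k * N ^ 2 ≤ k ^ 2 * N ^ 2 := by gcongr; nlinarith
    linarith [sq_nonneg (k * a)]
  have e2 : U ^ 2 ≤ M * a ^ 2 + M * N ^ 2 := by
    have s1 : k * (D * a) ≤ D ^ 2 + k ^ 2 * a ^ 2 / 4 := by linarith [sq_nonneg (D - k * a / 2)]
    have s2 : k * (N * a) ≤ N ^ 2 + k ^ 2 * a ^ 2 / 4 := by linarith [sq_nonneg (N - k * a / 2)]
    have s3 : k * N ^ 2 ≤ k ^ 2 * N ^ 2 := by gcongr; nlinarith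
    have s4 : N ^ 2 ≤ k ^ 2 * N ^ 2 := le_mul_of_one_le_left (sq_nonneg N) (one_le_pow₀ hk)
    rw [hM]
    linarith [sq_nonneg (k * a), sq_nonneg (k * N)]
  have e3 : U ≤ C₁ * N := by
    rw [hC₁]
    refine le_mul_of_sq_le hN (by positivity) (by positivity) ?_
    linarith [mul_le_mul_of_nonneg_left h₃ hM0]
  have e4 : D ^ 2 ≤ 0 * (N * D) + C₂ * N ^ 2 := by
    have s1 : U ^ 2 ≤ C₁ ^ 2 * N ^ 2 := by rw [← mul_pow]; gcongr
    have s2 : k * (N * U) ≤ k * (N * (C₁ * N)) := by gcongr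
    have s3 : 8 * k ^ 2 * a ^ 2 ≤ M * a ^ 2 := by rw [hM]; nlinarith [sq_nonneg (k * a)]
    have s4 : 3 * k ^ 2 * N ^ 2 ≤ M * N ^ 2 := by rw [hM]; nlinarith [sq_nonneg (k * N)]
    have s5 : M * a ^ 2 ≤ M * (k * (N * (C₁ * N)) + k * N ^ 2) := by
      gcongr; linarith
    rw [hC₂]
    nlinarith [sq_nonneg U]
  have e5 := le_mul_of_sq_le hN le_rfl hC₂0 e4
  have r1 : 0 ≤ C₁ * N := by positivity
  have r2 : 0 ≤ (0 + C₂ + 1) * N := by positivity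
  constructor <;> rw [add_mul] <;> linarith

/-! ### Estimates for Δ_y and for the transport operator. -/

namespace Coeffs

variable {K : ℝ} (c : Coeffs n K)

lemma ip_Q_self {u : Phase n → ℂ} (hu : Test u) : ip (c.Q u) u = 0 := by
  have := c.ip_Q hu hu
  rw [ip_comm u] at this
  linarith

/-- The polarised commutator identity with v = ∂_{yⱼ}u, where ⟨Qv, v⟩ = 0. Summed over j, the
magnetic terms pair the antisymmetric b with the symmetric ∂_{yⱼ}∂_{yₖ}u and cancel. -/
lemma ip_Q_laplaceY {u : Phase n → ℂ} (hu : Test u) :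
    ip (c.Q u) (laplaceY u) = -∑ j, ip (dx j u) (dy j u) := by
  have h1 : ∀ j, ip (c.Q u) (dy j (dy j u)) = -ip (dx j u) (dy j u)
      - ∑ k, ip (fun p => c.b j k p.1 • u p) (dy k (dy j u)) := by
    intro j
    have := c.ip_Q_dy_sub hu (hu.dy j) j
    rw [c.ip_Q_self (hu.dy j), sub_zero, ip_dx_right hu (hu.dy j)] at this
    exact this
  have h2 : ∑ j, ∑ k, ip (fun p => c.b j k p.1 • u p) (dy k (dy j u)) = 0 := by
    have h3 : ∑ j, ∑ k, ip (fun p => c.b j k p.1 • u p) (dy k (dy j u))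
        = -∑ j, ∑ k, ip (fun p => c.b j k p.1 • u p) (dy k (dy j u)) := by
      conv_lhs => rw [Finset.sum_comm]
      rw [← Finset.sum_neg_distrib]
      refine Finset.sum_congr rfl fun j _ => ?_
      rw [← Finset.sum_neg_distrib]
      refine Finset.sum_congr rfl fun k _ => ?_
      rw [dy_dy_comm hu, ip, ip, ← integral_neg]
      congr 1; ext p
      rw [c.antisymm j k, neg_smul, inner_neg_left]
    linarith
  rw [show laplaceY u = fun p => ∑ j, dy j (dy j u) p from rfl,
    ip_sum_right _ (fun j => ((hu.dy j).dy j).cc) (c.cc_Q hu)]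
  simp only [h1, Finset.sum_sub_distrib, h2, sub_zero, Finset.sum_neg_distrib]

/-- The zeroth order part of the operator. -/
lemma nrm_potential_le {u : Phase n → ℂ} (hu : Test u) :
    nrm (fun p => (‖p.2‖ ^ 2 / 4 - (n : ℝ) / 2) • u p) ≤ nrm (c.wt 0 2 u) + n * nrm u := by
  have h1 : nrm (fun p : Phase n => (‖p.2‖ ^ 2 / 4) • u p) ≤ nrm (c.wt 0 2 u) := by
    refine nrm_mono (c.cc_wt 0 2 hu.cc).sqInt fun p => ?_
    rw [norm_smul, norm_wt, Real.norm_of_nonneg (by positivity), pow_zero, one_mul]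
    gcongr
    linarith [sq_nonneg ‖p.2‖]
  have h2 : nrm (fun p => ((n : ℝ) / 2) • u p) ≤ n * nrm u := by
    rw [nrm_const_smul, abs_of_nonneg (by positivity)]
    have := nrm_nonneg u
    gcongr
    linarith [(Nat.cast_nonneg n : (0 : ℝ) ≤ n)]
  have h3 := nrm_sub_le (hu.cc.smul (w := fun p : Phase n => ‖p.2‖ ^ 2 / 4) (by fun_prop)).sqInt
    (hu.cc.smul (w := fun _ => (n : ℝ) / 2) continuous_const).sqInt
  simp only [sub_smul]
  linarith

/-- The equation, solved for Δ_y u, is paired with Δ_y u. The transport part becomes ⟨∂ₓu, ∂_y u⟩,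
where the derivative in x is shared as 2/3 + 1/3. -/
lemma nrm_laplaceY_sq_le {u : Phase n → ℂ} (hu : Test u) :
    nrm (laplaceY u) ^ 2 ≤ (nrm (c.P u) + nrm (c.wt 0 2 u) + n * nrm u) * nrm (laplaceY u)
      + ∑ j, nrm (frac j 2 u) * nrm (frac j 1 (dy j u)) := by
  have hΔ := cc_laplaceY hu
  have hW : CC fun p : Phase n => (‖p.2‖ ^ 2 / 4 - (n : ℝ) / 2) • u p := hu.cc.smul (by fun_prop)
  have e : laplaceY u = fun p =>
      (c.Q u p + (‖p.2‖ ^ 2 / 4 - (n : ℝ) / 2) • u p) - c.P u p := by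
    ext p; rw [P]; ring
  have e1 : nrm (laplaceY u) ^ 2 = ip (c.Q u) (laplaceY u)
      + ip (fun p => (‖p.2‖ ^ 2 / 4 - (n : ℝ) / 2) • u p) (laplaceY u)
      - ip (c.P u) (laplaceY u) := by
    rw [← ip_add_left (c.cc_Q hu) hW hΔ, ← ip_sub_left ((c.cc_Q hu).add hW) (c.cc_P hu) hΔ, ← e,
      ip_self hΔ.sqInt]
  have e2 := abs_ip_le hW.sqInt hΔ.sqInt
  have e3 := abs_ip_le (c.cc_P hu).sqInt hΔ.sqInt
  have e4 : |ip (c.Q u) (laplaceY u)| ≤ ∑ j, nrm (frac j 2 u) * nrm (frac j 1 (dy j u)) := by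
    rw [c.ip_Q_laplaceY hu, abs_neg]
    exact (Finset.abs_sum_le_sum_abs _ _).trans
      (Finset.sum_le_sum fun j _ => abs_ip_dx_le hu (hu.dy j) j)
  have e5 := mul_le_mul_of_nonneg_right (c.nrm_potential_le hu) (nrm_nonneg (laplaceY u))
  rw [abs_le] at e2 e3 e4
  linarith [e2.2, e3.1, e4.2]

lemma nrm_Q_le {u : Phase n → ℂ} (hu : Test u) :
    nrm (c.Q u) ≤ nrm (c.P u) + nrm (laplaceY u) + (nrm (c.wt 0 2 u) + n * nrm u) := by
  have hW : CC fun p : Phase n => (‖p.2‖ ^ 2 / 4 - (n : ℝ) / 2) • u p := hu.cc.smul (by fun_prop)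
  have e : c.Q u = fun p =>
      (c.P u p + laplaceY u p) - (‖p.2‖ ^ 2 / 4 - (n : ℝ) / 2) • u p := by
    ext p; rw [P]; ring
  rw [e]
  refine (nrm_sub_le ((c.cc_P hu).add (cc_laplaceY hu)).sqInt hW.sqInt).trans ?_
  exact add_le_add (nrm_add_le (c.cc_P hu).sqInt (cc_laplaceY hu).sqInt) (c.nrm_potential_le hu)

end Coeffs

/-- The maximal estimate for a transport operator with general coefficients. -/
theorem exists_maximal_bound (n : ℕ) (K : ℝ) (hK : 1 ≤ K) : ∃ C : ℝ, 0 ≤ C ∧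
    ∀ (c : Coeffs n K) (u : Phase n → ℂ), Test u →
      nrm (c.wt 2 0 u) ≤ C * (nrm (c.P u) + nrm u) ∧
      (∀ j, nrm (frac j 2 u) ≤ C * (nrm (c.P u) + nrm u)) ∧
      nrm (c.Q u) ≤ C * (nrm (c.P u) + nrm u) ∧
      nrm (laplaceY u) ≤ C * (nrm (c.P u) + nrm u) ∧
      nrm (c.wt 0 2 u) ≤ C * (nrm (c.P u) + nrm u) := by
  obtain ⟨C₀, hC₀, H₀⟩ := exists_weighted_bound n K hK
  have hK0 : 0 ≤ K := by linarith
  obtain ⟨G, hG0, hG⟩ : ∃ G : ℝ, 0 ≤ G ∧ G = K * (1 + K) ^ 2 * (n + n * n) :=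
    ⟨_, by positivity, rfl⟩
  obtain ⟨p, hp0, hp⟩ : ∃ p : ℝ, 0 ≤ p ∧ p = C₀ ^ 2 + 8 * (5 * (G * (2 + K) * C₀ ^ 2)) :=
    ⟨_, by positivity, rfl⟩
  obtain ⟨r, hr0, hr⟩ : ∃ r : ℝ, 0 ≤ r ∧ r = 8 * (256 + 128 * n) := ⟨_, by positivity, rfl⟩
  obtain ⟨w, hw0, hw⟩ : ∃ w : ℝ, 0 ≤ w ∧ w = 1 + C₀ + n := ⟨_, by positivity, rfl⟩
  obtain ⟨m, hm0, hm⟩ : ∃ m : ℝ, 0 ≤ m ∧ m = 8 * (64 * w + 32 * (n * K) * C₀) :=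
    ⟨_, by positivity, rfl⟩
  obtain ⟨l, hl0, hl⟩ : ∃ l : ℝ, 0 ≤ l ∧ l = C₀ ^ 2 + 8 * (10 * (G * C₀ ^ 2)) :=
    ⟨_, by positivity, rfl⟩
  -- A sum of nonnegative terms that dominates every coefficient of the three inequalities; all of
  -- them depend on n and K alone.
  obtain ⟨k, hk⟩ : ∃ k : ℝ, k = 1 + w + n + n * (m + l + 512) + n * n * (p + r) := ⟨_, rfl⟩
  have hk1 : 1 ≤ k := by rw [hk]; linarith [(by positivity : 0 ≤ w + n + n * (m + l + 512) + n * n * (p + r))]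
  obtain ⟨C₁, hC₁, H₁⟩ := quadratic_system_maximal hk1
  refine ⟨C₀ + C₁ + (C₁ + w), by positivity, fun c u hu => ?_⟩
  obtain ⟨hX, hA, hB, hY⟩ := H₀ c u hu
  obtain ⟨N, hN⟩ : ∃ N, N = nrm (c.P u) + nrm u := ⟨_, rfl⟩
  have hPn := nrm_nonneg (c.P u)
  have hun := nrm_nonneg u
  have hN0 : 0 ≤ N := by rw [hN]; positivity
  rw [← hN] at hX hA hB hY ⊢
  have hPN : nrm (c.P u) ≤ N := by linarith
  have huN : nrm u ≤ N := by linarith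
  obtain ⟨D, hD⟩ : ∃ D, D = nrm (laplaceY u) := ⟨_, rfl⟩
  have hD0 : 0 ≤ D := hD ▸ nrm_nonneg _
  -- U and a collect all directions at once, because the bound on Δ_y u couples them.
  obtain ⟨U, hU⟩ : ∃ U, U = √(∑ j, nrm (frac j 2 u) ^ 2) := ⟨_, rfl⟩
  obtain ⟨a, ha⟩ : ∃ a, a = √(∑ j, ∑ i, nrm (frac j 1 (dy i u)) ^ 2) := ⟨_, rfl⟩
  have hU0 : 0 ≤ U := hU ▸ Real.sqrt_nonneg _
  have ha0 : 0 ≤ a := ha ▸ Real.sqrt_nonneg _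
  have hU2 : U ^ 2 = ∑ j, nrm (frac j 2 u) ^ 2 := by
    rw [hU]; exact Real.sq_sqrt (Finset.sum_nonneg fun j _ => sq_nonneg _)
  have ha2 : a ^ 2 = ∑ j, ∑ i, nrm (frac j 1 (dy i u)) ^ 2 := by
    rw [ha]
    exact Real.sq_sqrt (Finset.sum_nonneg fun j _ => Finset.sum_nonneg fun i _ => sq_nonneg _)
  have hUj : ∀ j, nrm (frac j 2 u) ≤ U := fun j => by
    rw [hU]
    exact Real.le_sqrt_of_sq_le (Finset.single_le_sum (f := fun j => nrm (frac j 2 u) ^ 2)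
      (fun j _ => sq_nonneg _) (Finset.mem_univ j))
  have haj : ∀ j i, nrm (frac j 1 (dy i u)) ≤ a := fun j i => by
    rw [ha]
    refine Real.le_sqrt_of_sq_le ((Finset.single_le_sum
      (f := fun i => nrm (frac j 1 (dy i u)) ^ 2) (fun j _ => sq_nonneg _)
      (Finset.mem_univ i)).trans ?_)
    exact Finset.single_le_sum (f := fun j => ∑ i, nrm (frac j 1 (dy i u)) ^ 2)
      (fun j _ => Finset.sum_nonneg fun i _ => sq_nonneg _) (Finset.mem_univ j)
  have hW : nrm (c.P u) + nrm (c.wt 0 2 u) + n * nrm u ≤ w * N := by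
    have : n * nrm u ≤ n * N := by gcongr
    rw [hw]; linarith
  have hQ : nrm (c.Q u) ≤ D + w * N := by
    have := c.nrm_Q_le hu
    rw [hD]; linarith
  have g1 : D ^ 2 ≤ k * (N * D + U * a + N ^ 2) := by
    have h1 := c.nrm_laplaceY_sq_le hu
    rw [← hD] at h1
    have h2 : ∑ j, nrm (frac j 2 u) * nrm (frac j 1 (dy j u)) ≤ ∑ _j : Fin n, U * a := by
      gcongr with j
      exacts [nrm_nonneg _, hUj j, haj j j]
    simp only [Finset.sum_const, Finset.card_univ, Fintype.card_fin, nsmul_eq_mul] at h2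
    have h3 := mul_le_mul_of_nonneg_right hW hD0
    have q1 : w ≤ k := by
      rw [hk]; linarith [(by positivity : 0 ≤ n + n * (m + l + 512) + n * n * (p + r))]
    have q2 : (n : ℝ) ≤ k := by
      rw [hk]; linarith [(by positivity : 0 ≤ n * (m + l + 512) + n * n * (p + r))]
    have p1 : 0 ≤ N * D := by positivity
    have p2 : 0 ≤ U * a := by positivity
    have p3 : 0 ≤ k * N ^ 2 := by positivity
    linarith [mul_le_mul_of_nonneg_right q1 p1, mul_le_mul_of_nonneg_right q2 p2]
  have g2 : U ^ 2 ≤ k * ((D + N) * a + N ^ 2) := by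
    have h1 : ∀ j, nrm (frac j 2 u) ^ 2 ≤ 512 * (D * a) + m * (N * a) + l * N ^ 2 := by
      intro j
      have h2 := c.nrm_frac_two_le hu j hA hB hX (haj j)
      have h3 := mul_le_mul_of_nonneg_right hQ ha0
      rw [hm, hl, hG]
      rw [mul_pow] at h2
      linarith
    have h4 : U ^ 2 ≤ n * (512 * (D * a) + m * (N * a) + l * N ^ 2) := by
      rw [hU2]
      refine (Finset.sum_le_sum fun j _ => h1 j).trans_eq ?_
      simp only [Finset.sum_const, Finset.card_univ, Fintype.card_fin, nsmul_eq_mul]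
    have p1 : 0 ≤ D * a := by positivity
    have p2 : 0 ≤ N * a := by positivity
    have p3 : 0 ≤ N ^ 2 := by positivity
    have q0 : 0 ≤ 1 + w + n + n * n * (p + r) := by positivity
    have q1 : n * 512 ≤ k := by rw [hk]; linarith [(by positivity : 0 ≤ n * m + n * l)]
    have q2 : n * m ≤ k := by rw [hk]; linarith [(by positivity : 0 ≤ n * (512 : ℝ) + n * l)]
    have q3 : n * l ≤ k := by rw [hk]; linarith [(by positivity : 0 ≤ n * (512 : ℝ) + n * m)]
    linarith [mul_le_mul_of_nonneg_right q1 p1, mul_le_mul_of_nonneg_right q2 p2,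
      mul_le_mul_of_nonneg_right q3 p3]
  have g3 : a ^ 2 ≤ k * (N * U + N ^ 2) := by
    have h1 : ∀ j i, nrm (frac j 1 (dy i u)) ^ 2 ≤ r * (N * U) + p * N ^ 2 := by
      intro j i
      have h2 := c.nrm_frac_one_dy_le hu i j hA hB hX
      have h3 : (256 * nrm (c.P u) + 128 * n * nrm u) * nrm (frac j 2 u)
          ≤ (256 * N + 128 * n * N) * U := by
        have := hUj j
        have := nrm_nonneg (frac j 2 u)
        gcongr
      rw [hr, hp, hG]
      rw [mul_pow] at h2
      linarith
    have h4 : a ^ 2 ≤ n * n * (r * (N * U) + p * N ^ 2) := by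
      rw [ha2]
      refine (Finset.sum_le_sum fun j _ => Finset.sum_le_sum fun i _ => h1 j i).trans_eq ?_
      simp only [Finset.sum_const, Finset.card_univ, Fintype.card_fin, nsmul_eq_mul]
      ring
    have p2 : 0 ≤ N * U := by positivity
    have p3 : 0 ≤ N ^ 2 := by positivity
    have q0 : 0 ≤ 1 + w + n + n * (m + l + 512) := by positivity
    have q1 : n * n * r ≤ k := by rw [hk]; linarith [(by positivity : 0 ≤ n * n * p)]
    have q2 : n * n * p ≤ k := by rw [hk]; linarith [(by positivity : 0 ≤ n * n * r)]
    linarith [mul_le_mul_of_nonneg_right q1 p2, mul_le_mul_of_nonneg_right q2 p3]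
  obtain ⟨r1, r2⟩ := H₁ N D U a hN0 hD0 hU0 ha0 g1 g2 g3
  have t1 : 0 ≤ C₀ * N := by positivity
  have t2 : 0 ≤ C₁ * N := by positivity
  have t3 : 0 ≤ w * N := by positivity
  have t4 : (C₀ + C₁ + (C₁ + w)) * N = C₀ * N + C₁ * N + (C₁ * N + w * N) := by ring
  rw [t4]
  refine ⟨by linarith, fun j => by linarith [hUj j], by linarith, by linarith, by linarith⟩

end

noncomputable section

variable {n : ℕ}

/-! ### The operators of the statement -/

lemma gradient_apply (V : Space n → ℝ) (x : Space n) (j : Fin n) : gradient V x j = pd j V x := by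
  have h : inner ℝ (gradient V x) (EuclideanSpace.single j (1 : ℝ)) = pd j V x := by
    rw [gradient, InnerProductSpace.toDual_symm_apply]; rfl
  rw [← h, real_inner_comm, EuclideanSpace.inner_single_left]
  simp

namespace Admissible

variable {F : Type*} [NormedAddCommGroup F] [NormedSpace ℝ F] {C₀ s δ : ℝ} {V : Space n → ℝ}
  {H : Space n → F}

/-- The weight `⟨∂ₓV⟩^{1/3}`. -/
def weight (V : Space n → ℝ) (x : Space n) : ℝ := (1 + ∑ j, pd j V x ^ 2) ^ (1 / 6 : ℝ)

lemma one_le_base (V : Space n → ℝ) (x : Space n) : 1 ≤ 1 + ∑ j, pd j V x ^ 2 := by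
  linarith [Finset.sum_nonneg fun j (_ : j ∈ Finset.univ) => sq_nonneg (pd j V x)]

lemma one_le_weight (V : Space n → ℝ) (x : Space n) : 1 ≤ weight V x :=
  Real.one_le_rpow (one_le_base V x) (by norm_num)

lemma weight_pow_six (V : Space n → ℝ) (x : Space n) :
    weight V x ^ 6 = 1 + ∑ j, pd j V x ^ 2 := by
  rw [weight, ← Real.rpow_natCast, ← Real.rpow_mul (zero_le_one.trans (one_le_base V x))]
  norm_num

lemma bracket_gradient (V : Space n → ℝ) (x : Space n) :
    bracket (gradient V x) = weight V x ^ 3 := by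
  have h0 := zero_le_one.trans (one_le_weight V x)
  rw [bracket, EuclideanSpace.norm_sq_eq]
  simp only [gradient_apply, Real.norm_eq_abs, sq_abs]
  rw [← weight_pow_six, show weight V x ^ 6 = (weight V x ^ 3) ^ 2 by ring,
    Real.sqrt_sq (by positivity)]

lemma bracket_gradient_rpow (V : Space n → ℝ) (x : Space n) :
    bracket (gradient V x) ^ (2 / 3 : ℝ) = weight V x ^ 2 := by
  have h0 := zero_le_one.trans (one_le_weight V x)
  rw [bracket_gradient, ← Real.rpow_natCast, ← Real.rpow_mul h0]
  norm_num

lemma bracket_gradient_rpow_third (V : Space n → ℝ) (x : Space n) :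
    bracket (gradient V x) ^ (1 / 3 : ℝ) = weight V x := by
  have h0 := zero_le_one.trans (one_le_weight V x)
  rw [bracket_gradient, ← Real.rpow_natCast, ← Real.rpow_mul h0]
  norm_num

lemma contDiff_pd (h : Admissible C₀ s δ V H) (j : Fin n) : ContDiff ℝ 1 (pd j V) :=
  (h.contDiff_V.fderiv_right (m := 1) (by norm_num)).clm_apply contDiff_const

lemma contDiff_weight (h : Admissible C₀ s δ V H) : ContDiff ℝ 1 (weight V) := by
  refine ContDiff.rpow_const_of_ne (contDiff_const.add
    (ContDiff.sum fun j _ => (h.contDiff_pd j).pow 2)) fun x => ?_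
  exact (zero_lt_one.trans_le (one_le_base V x)).ne'

lemma nonneg (h : Admissible C₀ s δ V H) : 0 ≤ C₀ := by
  have h1 := (norm_nonneg _).trans (h.bound_H 0)
  have h2 : 0 < bracket (gradient V 0) ^ δ :=
    Real.rpow_pos_of_pos (zero_lt_one.trans_le (one_le_bracket _)) _
  exact nonneg_of_mul_nonneg_left h1 h2

lemma norm_fderiv_pd_le (h : Admissible C₀ s δ V H) (hs : s ≤ 2 / 3) (j : Fin n) (x : Space n) :
    ‖fderiv ℝ (pd j V) x‖ ≤ n * C₀ * weight V x ^ 2 := by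
  have hC := h.nonneg
  refine ContinuousLinearMap.opNorm_le_bound _ (by positivity) fun v => ?_
  have e : fderiv ℝ (pd j V) x v = ∑ i, v i * pd i (pd j V) x := by
    conv_lhs => rw [space_eq_sum v]
    simp [pd]
  rw [e]
  refine (norm_sum_le _ _).trans ?_
  calc ∑ i, ‖v i * pd i (pd j V) x‖ ≤ ∑ _i : Fin n, ‖v‖ * (C₀ * weight V x ^ 2) := by
        refine Finset.sum_le_sum fun i _ => ?_
        rw [norm_mul, ← bracket_gradient_rpow]
        gcongr
        · exact PiLp.norm_apply_le v i
        · exact (h.bound_V i j x).trans (by gcongr; exact one_le_bracket _)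
    _ = _ := by
      simp only [Finset.sum_const, Finset.card_univ, Fintype.card_fin, nsmul_eq_mul]; ring

/-- Differentiating μ⁶ = 1 + |∂V|² gives 6μ⁵∂μ = 2∑∂ⱼV ∂(∂ⱼV), of size μ³·μ²; the powers of μ cancel
exactly at the exponent s = 2/3. -/
lemma norm_fderiv_weight_le (h : Admissible C₀ s δ V H) (hs : s ≤ 2 / 3) (x : Space n) :
    ‖fderiv ℝ (weight V) x‖ ≤ n * (n * C₀) := by
  have hC := h.nonneg
  have hw := zero_lt_one.trans_le (one_le_weight V x)
  have h1 : HasFDerivAt (fun x => weight V x ^ 6)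
      ((6 * weight V x ^ 5) • fderiv ℝ (weight V) x) x := by
    simpa using ((h.contDiff_weight.differentiable (by norm_num) x).hasFDerivAt.pow 6)
  have h2 : HasFDerivAt (fun x => weight V x ^ 6)
      (∑ j, (2 * pd j V x) • fderiv ℝ (pd j V) x) x := by
    rw [funext (weight_pow_six V)]
    refine (HasFDerivAt.fun_sum fun j _ => ?_).const_add 1
    simpa using ((h.contDiff_pd j).differentiable (by norm_num) x).hasFDerivAt.pow 2
  have h3 : ∀ j, |pd j V x| ≤ weight V x ^ 3 := fun j => by
    refine abs_le_of_sq_le_sq ?_ (by positivity)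
    have := Finset.single_le_sum (f := fun j => pd j V x ^ 2) (fun i _ => sq_nonneg _)
      (Finset.mem_univ j)
    rw [← pow_mul, weight_pow_six]
    linarith
  have h4 : (6 * weight V x ^ 5) * ‖fderiv ℝ (weight V) x‖
      ≤ (6 * weight V x ^ 5) * (n * (n * C₀)) := by
    rw [← Real.norm_of_nonneg (by positivity : 0 ≤ 6 * weight V x ^ 5), ← norm_smul,
      h1.unique h2, Real.norm_of_nonneg (by positivity)]
    refine (norm_sum_le _ _).trans ?_
    calc _ ≤ ∑ _j : Fin n, (2 * weight V x ^ 3) * (n * C₀ * weight V x ^ 2) := by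
          refine Finset.sum_le_sum fun j _ => ?_
          rw [norm_smul, norm_mul, Real.norm_two]
          gcongr
          exacts [h3 j, h.norm_fderiv_pd_le hs j x]
      _ = 2 * weight V x ^ 5 * (n * (n * C₀)) := by
        simp only [Finset.sum_const, Finset.card_univ, Fintype.card_fin, nsmul_eq_mul]; ring
      _ ≤ _ := by gcongr; norm_num
  exact le_of_mul_le_mul_left h4 (by positivity)

/-- The coefficients belonging to an admissible potential and magnetic field, where the linear
forms `ℓ` give the entries of the magnetic matrix. -/
def coeffs (h : Admissible C₀ s δ V H) (hs : s ≤ 2 / 3) (hδ : δ ≤ 2 / 3)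
    (ℓ : Fin n → Fin n → F →L[ℝ] ℝ) (hanti : ∀ i j, ℓ j i = -ℓ i j)
    (hℓ : ∀ i j, ‖ℓ i j‖ ≤ 1) : Coeffs n (1 + (1 + n + n * n) * |C₀|) where
  E j := pd j V
  b i j x := ℓ i j (H x)
  μ := weight V
  one_le_K := by linarith [(by positivity : 0 ≤ (1 + (n : ℝ) + n * n) * |C₀|)]
  contDiff_E := h.contDiff_pd
  contDiff_b i j := (ℓ i j).contDiff.comp h.contDiff_H
  contDiff_μ := h.contDiff_weight
  antisymm i j x := by rw [hanti]; rfl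
  one_le := one_le_weight V
  pow_six := weight_pow_six V
  bound_dE j x := by
    have hC := h.nonneg
    refine (h.norm_fderiv_pd_le hs j x).trans ?_
    rw [abs_of_nonneg hC]
    gcongr
    linarith [(by positivity : 0 ≤ (1 + (n : ℝ) * n) * C₀)]
  bound_b i j x := by
    have hC := h.nonneg
    have hb := one_le_bracket (gradient V x)
    calc |ℓ i j (H x)| ≤ 1 * ‖H x‖ := (ℓ i j).le_of_opNorm_le (hℓ i j) _
      _ ≤ C₀ * bracket (gradient V x) ^ (2 / 3 : ℝ) := by
        rw [one_mul]
        exact (h.bound_H x).trans (by gcongr)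
      _ ≤ _ := by
        rw [bracket_gradient_rpow, abs_of_nonneg hC]
        gcongr
        linarith [(by positivity : 0 ≤ ((n : ℝ) + (n : ℝ) * n) * C₀)]
  bound_db i j x := by
    have hC := h.nonneg
    have hb := one_le_bracket (gradient V x)
    have hw := zero_lt_one.trans_le (one_le_weight V x)
    have e : fderiv ℝ (fun x => ℓ i j (H x)) x = (ℓ i j).comp (fderiv ℝ H x) :=
      ((ℓ i j).hasFDerivAt.comp x
        (h.contDiff_H.differentiable (by norm_num) x).hasFDerivAt).fderiv
    rw [e]
    calc _ ≤ ‖ℓ i j‖ * ‖fderiv ℝ H x‖ := ContinuousLinearMap.opNorm_comp_le _ _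
      _ ≤ 1 * (C₀ * bracket (gradient V x) ^ (1 / 3 : ℝ)) := by
        exact mul_le_mul (hℓ i j) ((h.bound_dH x).trans (mul_le_mul_of_nonneg_left
          (Real.rpow_le_rpow_of_exponent_le hb (by linarith)) hC)) (norm_nonneg _) zero_le_one
      _ ≤ _ := by
        rw [bracket_gradient_rpow_third, abs_of_nonneg hC, one_mul]
        gcongr
        linarith [(by positivity : 0 ≤ ((n : ℝ) + (n : ℝ) * n) * C₀)]
  bound_dμ x := by
    have hC := h.nonneg
    refine (h.norm_fderiv_weight_le hs x).trans ?_
    rw [abs_of_nonneg hC]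
    linarith [(by positivity : 0 ≤ (1 + (n : ℝ)) * C₀)]

end Admissible

lemma MaximalEstimate.mono {C C' : ℝ≥0} (hC : C ≤ C') {V : Space n → ℝ}
    {B : (Phase n → ℂ) → Phase n → ℂ} {u : Phase n → ℂ} (h : MaximalEstimate C V B u) :
    MaximalEstimate C' V B u :=
  h.trans (by gcongr)

/-- The maximal estimate in the form of the statement, for operators with a magnetic term that
is given by linear forms `ℓ` in the magnetic field. -/
theorem exists_maximalEstimate {F : Type*} [NormedAddCommGroup F] [NormedSpace ℝ F] (C₀ s : ℝ)
    (hs : s ≤ 2 / 3) (ℓ : Fin n → Fin n → F →L[ℝ] ℝ) (hanti : ∀ i j, ℓ j i = -ℓ i j)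
    (hℓ : ∀ i j, ‖ℓ i j‖ ≤ 1) : ∃ C : ℝ≥0, ∀ δ : ℝ, δ < 2 / 3 →
      ∀ (V : Space n → ℝ) (H : Space n → F) (B : (Phase n → ℂ) → Phase n → ℂ),
        (∀ u p, B u p = ∑ i, ∑ j, (ℓ i j (H p.1) * p.2 i) • dy j u p) →
        Admissible C₀ s δ V H →
        ∀ u : Phase n → ℂ, Test u → MaximalEstimate C V B u := by
  obtain ⟨C, hC, hb⟩ := exists_maximal_bound n (1 + (1 + n + n * n) * |C₀|)
    (by linarith [(by positivity : 0 ≤ (1 + (n : ℝ) + n * n) * |C₀|)])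
  -- One summand for each norm of the estimate, in order; each 1 accounts for ‖u‖, which comes from
  -- ⟨Dₓ⟩^{2/3} ≤ 1 + ∑ρⱼ², ⟨D_y⟩² = 1 - Δ_y and ⟨y⟩² = 1 + |y|².
  obtain ⟨M, hM⟩ : ∃ M : ℝ≥0, (M : ℝ) = C + (1 + n * C) + C + (1 + C) + (1 + C) :=
    ⟨⟨_, by positivity⟩, rfl⟩
  refine ⟨M, fun δ hδ V H B hB h u hu => ?_⟩
  obtain ⟨c, hcE, hcb, hcμ⟩ : ∃ c : Coeffs n (1 + (1 + n + n * n) * |C₀|),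
      (c.E = fun j => pd j V) ∧ (c.b = fun i j x => ℓ i j (H x)) ∧ c.μ = Admissible.weight V :=
    ⟨h.coeffs hs hδ.le ℓ hanti hℓ, rfl, rfl, rfl⟩
  obtain ⟨h1, h2, h3, h4, h5⟩ := hb c u hu
  have hQ : opQ V B u = c.Q u := by
    ext p
    simp only [opQ, Coeffs.Q, hB, Complex.real_smul, gradient_apply, hcE, hcb]
  have hP : opP V B u = c.P u := by
    ext p
    rw [opP, hQ, Coeffs.P, Complex.real_smul]
  have hV : (fun p : Phase n => ((bracket (gradient V p.1) ^ (2 / 3 : ℝ) : ℝ) : ℂ) * u p)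
      = c.wt 2 0 u := by
    ext p
    rw [Admissible.bracket_gradient_rpow, Coeffs.wt, pow_zero, mul_one, Complex.real_smul, hcμ]
  have hDy : bracketDy 2 u = fun p => u p - laplaceY u p := funext (bracketDy_two hu)
  have hy : (fun p : Phase n => ((bracket p.2 ^ 2 : ℝ) : ℂ) * u p)
      = fun p => u p + c.wt 0 2 u p := by
    ext p
    rw [bracket_sq, Coeffs.wt, pow_zero, one_mul, Complex.real_smul]
    push_cast
    ring
  have hΔ : CC (laplaceY u) := Coeffs.cc_laplaceY hu
  have hw := c.cc_wt 0 2 hu.cc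
  obtain ⟨N, hN⟩ : ∃ N, N = nrm (c.P u) + nrm u := ⟨_, rfl⟩
  have hun := nrm_nonneg u
  have hPn := nrm_nonneg (c.P u)
  rw [← hN] at h1 h2 h3 h4 h5
  have e1 := nrm_sub_le hu.cc.sqInt hΔ.sqInt
  have e2 := nrm_add_le hu.cc.sqInt hw.sqInt
  have e3 : ∑ j, nrm (frac j 2 u) ≤ n * (C * N) := by
    refine (Finset.sum_le_sum fun j _ => h2 j).trans_eq ?_
    simp only [Finset.sum_const, Finset.card_univ, Fintype.card_fin, nsmul_eq_mul]
  have hN0 : 0 ≤ N := by rw [hN]; positivity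
  have key : ∀ {f : Phase n → ℂ} {a : ℝ}, CC f → nrm f ≤ a * N →
      normL2 f ≤ ENNReal.ofReal (a * N) := fun hf ha =>
    hf.sqInt.normL2_eq.trans_le (ENNReal.ofReal_le_ofReal ha)
  have hnC : 0 ≤ n * C := by positivity
  have n1 := key (c.cc_wt 2 0 hu.cc) h1
  have n2 : normL2 (bracketDx (2 / 3) u) ≤ ENNReal.ofReal ((1 + n * C) * N) :=
    (normL2_bracketDx_le hu).trans (ENNReal.ofReal_le_ofReal (by linarith))
  have n3 := key (c.cc_Q hu) h3
  have n4 := key (a := 1 + C) (hu.cc.sub hΔ) (by linarith)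
  have n5 := key (a := 1 + C) (hu.cc.add hw) (by linarith)
  have n6 : ENNReal.ofReal N = normL2 (c.P u) + normL2 u := by
    rw [hN, ENNReal.ofReal_add hPn hun, (c.cc_P hu).sqInt.normL2_eq, hu.cc.sqInt.normL2_eq]
  rw [MaximalEstimate, hQ, hP, hV, hDy, hy, ← n6]
  refine (add_le_add (add_le_add (add_le_add (add_le_add n1 n2) n3) n4) n5).trans_eq ?_
  rw [← ENNReal.ofReal_coe_nnreal, hM, ← ENNReal.ofReal_mul (by positivity),
    ← ENNReal.ofReal_add (by positivity) (by positivity),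
    ← ENNReal.ofReal_add (by positivity) (by positivity),
    ← ENNReal.ofReal_add (by positivity) (by positivity),
    ← ENNReal.ofReal_add (by positivity) (by positivity)]
  congr 1
  ring

/-- The entries of the magnetic matrix for `n = 2`. -/
def form2 : Fin 2 → Fin 2 → ℝ →L[ℝ] ℝ :=
  ![![0, ContinuousLinearMap.id ℝ ℝ], ![-ContinuousLinearMap.id ℝ ℝ, 0]]

/-- The entries of the magnetic matrix for `n = 3`. -/
def form3 : Fin 3 → Fin 3 → Space 3 →L[ℝ] ℝ :=
  ![![0, EuclideanSpace.proj 2, -EuclideanSpace.proj 1],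
    ![-EuclideanSpace.proj 2, 0, EuclideanSpace.proj 0],
    ![EuclideanSpace.proj 1, -EuclideanSpace.proj 0, 0]]

lemma form2_antisymm (i j : Fin 2) : form2 j i = -form2 i j := by
  fin_cases i <;> fin_cases j <;> simp [form2]

lemma form3_antisymm (i j : Fin 3) : form3 j i = -form3 i j := by
  fin_cases i <;> fin_cases j <;> simp [form3]

lemma norm_form2_le (i j : Fin 2) : ‖form2 i j‖ ≤ 1 := by
  fin_cases i <;> fin_cases j <;> simp [form2, ContinuousLinearMap.norm_id]

lemma norm_form3_le (i j : Fin 3) : ‖form3 i j‖ ≤ 1 := by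
  have h : ∀ k : Fin 3, ‖(EuclideanSpace.proj k : Space 3 →L[ℝ] ℝ)‖ ≤ 1 := fun k =>
    ContinuousLinearMap.opNorm_le_bound _ zero_le_one fun x => by
      simpa using PiLp.norm_apply_le x k
  fin_cases i <;> fin_cases j <;> simp [form3, h]

lemma magnetic2_eq (H : Space 2 → ℝ) (u : Phase 2 → ℂ) (p : Phase 2) :
    magnetic2 H u p = ∑ i, ∑ j, (form2 i j (H p.1) * p.2 i) • dy j u p := by
  simp [magnetic2, form2, Fin.sum_univ_two]
  ring

lemma magnetic3_eq (H : Space 3 → Space 3) (u : Phase 3 → ℂ) (p : Phase 3) :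
    magnetic3 H u p = ∑ i, ∑ j, (form3 i j (H p.1) * p.2 i) • dy j u p := by
  simp [magnetic3, form3, Fin.sum_univ_three]
  ring

end

end FokkerPlanck

theorem corollary1p2 (C₀ s : ℝ) (hs : s ≤ 2 / 3) :
    ∃ C : ℝ≥0,
      (∀ δ : ℝ, δ < 2 / 3 →
        ∀ (V : FokkerPlanck.Space 2 → ℝ) (H : FokkerPlanck.Space 2 → ℝ),
          FokkerPlanck.Admissible C₀ s δ V H →
          ∀ u : FokkerPlanck.Phase 2 → ℂ, ContDiff ℝ ∞ u → HasCompactSupport u →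
            FokkerPlanck.MaximalEstimate C V (FokkerPlanck.magnetic2 H) u) ∧
      (∀ δ : ℝ, δ < 2 / 3 →
        ∀ (V : FokkerPlanck.Space 3 → ℝ) (H : FokkerPlanck.Space 3 → FokkerPlanck.Space 3),
          FokkerPlanck.Admissible C₀ s δ V H →
          ∀ u : FokkerPlanck.Phase 3 → ℂ, ContDiff ℝ ∞ u → HasCompactSupport u →
            FokkerPlanck.MaximalEstimate C V (FokkerPlanck.magnetic3 H) u) := by
  obtain ⟨C₂, h₂⟩ := FokkerPlanck.exists_maximalEstimate C₀ s hs FokkerPlanck.form2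
    FokkerPlanck.form2_antisymm FokkerPlanck.norm_form2_le
  obtain ⟨C₃, h₃⟩ := FokkerPlanck.exists_maximalEstimate C₀ s hs FokkerPlanck.form3
    FokkerPlanck.form3_antisymm FokkerPlanck.norm_form3_le
  refine ⟨max C₂ C₃, fun δ hδ V H h u hu hc => ?_, fun δ hδ V H h u hu hc => ?_⟩
  · exact (h₂ δ hδ V H _ (FokkerPlanck.magnetic2_eq H) h u ⟨hu, hc⟩).mono (le_max_left _ _)
  · exact (h₃ δ hδ V H _ (FokkerPlanck.magnetic3_eq H) h u ⟨hu, hc⟩).mono (le_max_right _ _)
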